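/- Let $n=2k$, $M=\mathbb R^{n}_{x,t}$ with $x,t\in\mathbb R^{k}$, $X=\{t=0\}\cong\mathbb R^{k}_x$, $i:X\hookrightarrow M$ the embedding, $x_0=0$; the momenta dual to $(x,t)$ are $(p,\tau)$. Let $F$ be the unitary Fourier transform with kernel $(2\pi)^{-d/2}e^{-i\langle x,p\rangle}$ (also on tempered distributions), $\widetilde H^s(\mathbb R^d)=L^2(\mathbb R^d,(1+|p|^2)^s\,dp)$, and $H^s=F^{-1}\widetilde H^s$ with the norm $\|u\|_{H^s}=\|Fu\|_{\widetilde H^s}$. Let $g:(x',t',p',\tau')\mapsto(x,t,p,\tau)$ be a canonical transformation (smooth, injective, preserving $dp\wedge dx+d\tau\wedge dt$), homogeneous of degree $1$ in the momenta, defined on the cotangent bundle with removed zero section over an open neighbourhood $\Omega$ of $x_0$ in $M$. Assume: A) $g$ maps the fibre over $x_0$ (without zero) onto itself, and if $g$ takes some non-zero covector over a point $x'\in X\cap\Omega$ to a covector over a point $x\in X\cap\Omega$, then $x=x'=x_0$; such a covector over $x_0$ exists, so $k\ge 1$. B) $g(0,0,p',\tau')=(0,0,h(p',\tau'),\tau)$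 with some $\tau$ for $(p',\tau')\ne0$, where $h$ is homogeneous of degree $1$ and $\tau'\mapsto h(p',\tau')$ is a diffeomorphism of $\mathbb R^{k}$ onto itself for each $p'\ne0$, and of $\mathbb R^{k}\setminus\{0\}$ onto itself for $p'=0$. Suppose that near the fibre over $(x_0,x_0)$ the graph of $g$ is given by the equations $(x',t')=\partial S/\partial(p',\tau')$, $(p,\tau)=\partial S/\partial(x,t)$ with a generating function $S(x,t,p',\tau')$ that is smooth for $(p',\tau')\neq 0$, homogeneous of degree $1$ in $(p',\tau')$, and (affine) linear in $(x,t)$. Let $a_0(p',\tau')$ be smooth outside the origin and homogeneous of degree $m\in\mathbb R$, let $a(p',\tau')$ be a smooth function on the whole space that coincides with $a_0$ at infinity, let $\mu(p',\tau')$ be a positive density, smooth outside the origin and homogeneous of degree $0$, and put $a_\mu=\sqrt\mu\,a$. Let $\Phi$ be the Fourier integral operator with the Schwartz kernel $F_{(p',\tau')\to(x',t')}\{e^{iS(x,t,p',\tau')}a_\mu(p',\tau')\}$, that is, $$\Phi v(x,t)=\iint e^{iS(x,t,p',\tau')}\,a_\mu(p',\tau')\,(Fv)(p',\tau')\,dp'\,d\tau'$$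 as an oscillatory integral. Let $s<0$ and $s-m-n/2>0$. Then $i_*u=u\otimes\delta_X$ is bounded $H^s(X)\to H^{s-k/2}(M)$, $\Phi$ is bounded $H^{s-k/2}(M)\to H^{s-k/2-m}(M)$, and the restriction $i^*$ to $X$ is bounded $H^{s-k/2-m}(M)\to H^{s-m-k}(X)$; thus the trace $$i^!(\Phi)=i^*\,\Phi\, i_*:H^s(X)\to H^{s-m-n/2}(X)$$ is well defined. Let $\tau'=h^{-1}(p',\eta)$ be the inverse of $\eta=h(p',\tau')$ for fixed $p'$, let $J(p',\eta)=\det\bigl(\partial h^{-1}(p',\eta)/\partial\eta\bigr)$, and put $$b^0(p,p')=|J(p',p)|\,\bigl(\sqrt\mu\,a_0\bigr)\bigl(p',h^{-1}(p',p)\bigr).$$ Then $b^0$ is homogeneous of degree $m$ and smooth on $\mathbb R^{2k}\setminus\{0\}$. For all smooth cut-off functions $\psi,\psi'$ on $\mathbb R^{k}$ that equal $0$ in a neighbourhood of zero and $1$ outside a compact set, the integral operator $$A_{\psi,\psi'}:\widetilde u(p)\longmapsto\int\psi(p)\,b^0(p,p')\,\psi'(p')\,\widetilde u(p')\,dp'$$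 is bounded $\widetilde H^s(\mathbb R^{k})\to\widetilde H^{s-m-n/2}(\mathbb R^{k})$. The trace in dual coordinates, $\widetilde{i^!(\Phi)}=F\,i^!(\Phi)\,F^{-1}$, equals $A_{\psi,\psi'}$ modulo an operator compact in physical coordinates, i.e. $F^{-1}\bigl(\widetilde{i^!(\Phi)}-A_{\psi,\psi'}\bigr)F:H^s(X)\to H^{s-m-n/2}(X)$ is compact. In the same sense $A_{\psi,\psi'}$ is independent of the choice of $\psi,\psi'$ modulo operators compact in physical coordinates. -/

import Mathlib

open MeasureTheory SchwartzMap FourierTransform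
open scoped ENNReal Topology ContDiff

set_option linter.unusedSectionVars false

noncomputable section

namespace TraceFIO

/-! ### Sobolev spaces and their Fourier duals -/

section Sobolev

variable (E : Type*) [NormedAddCommGroup E] [InnerProductSpace ℝ E] [FiniteDimensional ℝ E]
  [MeasurableSpace E] [BorelSpace E]

/-- The unitary Fourier transform `(Fφ)(p) = (2π)^{-d/2} ∫ e^{-i⟨x,p⟩} φ(x) dx` on Schwartz
functions, `d = dim E`; see `fourierSchwartz_apply`. Mathlib's `𝓕` has the kernel
`e^{-2πi⟨x,p⟩}`, hence the dilation. -/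
def fourierSchwartz : 𝓢(E, ℂ) →L[ℂ] 𝓢(E, ℂ) :=
  (((2 * Real.pi) ^ (-(Module.finrank ℝ E : ℝ) / 2) : ℝ) : ℂ) •
    ((compCLMOfContinuousLinearEquiv ℂ
      (ContinuousLinearEquiv.smulLeft (Units.mk0 (2 * Real.pi) Real.two_pi_pos.ne')⁻¹ : E ≃L[ℝ] E)).comp
      (fourierCLM ℂ 𝓢(E, ℂ)))

theorem fourierSchwartz_apply (φ : 𝓢(E, ℂ)) (p : E) :
    fourierSchwartz E φ p = (((2 * Real.pi) ^ (-(Module.finrank ℝ E : ℝ) / 2) : ℝ) : ℂ) *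
      ∫ x, Complex.exp (-(Complex.I * (inner ℝ x p : ℝ))) * φ x := by
  simp only [fourierSchwartz, _root_.smul_apply, ContinuousLinearMap.comp_apply,
    smul_eq_mul]
  congr 1
  simp only [compCLMOfContinuousLinearEquiv_apply, Function.comp_apply, fourierCLM_apply,
    fourier_coe, Real.fourier_eq]
  refine integral_congr_ae (Filter.Eventually.of_forall fun x => ?_)
  simp only [Circle.smul_def, Real.fourierChar_apply, smul_eq_mul]
  congr 2
  have h : (2 * Real.pi) * (inner ℝ x
      ((ContinuousLinearEquiv.smulLeft (Units.mk0 (2 * Real.pi) Real.two_pi_pos.ne')⁻¹ :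
        E ≃L[ℝ] E) p)) = (inner ℝ x p : ℝ) := by
    have : ((ContinuousLinearEquiv.smulLeft (Units.mk0 (2 * Real.pi) Real.two_pi_pos.ne')⁻¹ :
        E ≃L[ℝ] E) p) = (2 * Real.pi)⁻¹ • p := rfl
    rw [this, inner_smul_right]
    field_simp
  rw [← h]
  push_cast
  ring

/-- The inverse of `fourierSchwartz`. -/
def fourierSchwartzInv : 𝓢(E, ℂ) →L[ℂ] 𝓢(E, ℂ) :=
  (((2 * Real.pi) ^ (-(Module.finrank ℝ E : ℝ) / 2) : ℝ) : ℂ)⁻¹ •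
    ((fourierInvCLM ℂ 𝓢(E, ℂ)).comp (compCLMOfContinuousLinearEquiv ℂ
      (ContinuousLinearEquiv.smulLeft (Units.mk0 (2 * Real.pi) Real.two_pi_pos.ne') : E ≃L[ℝ] E)))

theorem fourier_const_ne_zero :
    (((2 * Real.pi) ^ (-(Module.finrank ℝ E : ℝ) / 2) : ℝ) : ℂ) ≠ 0 :=
  Complex.ofReal_ne_zero.mpr (Real.rpow_pos_of_pos Real.two_pi_pos _).ne'

theorem fourierSchwartzInv_fourierSchwartz (φ : 𝓢(E, ℂ)) :
    fourierSchwartzInv E (fourierSchwartz E φ) = φ := by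
  simp only [fourierSchwartz, fourierSchwartzInv, _root_.smul_apply,
    ContinuousLinearMap.comp_apply, map_smul]
  rw [smul_smul, mul_inv_cancel₀ (fourier_const_ne_zero E), one_smul]
  have : ∀ f : 𝓢(E, ℂ), compCLMOfContinuousLinearEquiv ℂ
      (ContinuousLinearEquiv.smulLeft (Units.mk0 (2 * Real.pi) Real.two_pi_pos.ne') : E ≃L[ℝ] E)
      (compCLMOfContinuousLinearEquiv ℂ (ContinuousLinearEquiv.smulLeft
        (Units.mk0 (2 * Real.pi) Real.two_pi_pos.ne')⁻¹ : E ≃L[ℝ] E) f) = f := by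
    intro f
    ext x
    simp only [compCLMOfContinuousLinearEquiv_apply, Function.comp_apply]
    congr 1
    change (2 * Real.pi)⁻¹ • ((2 * Real.pi) • x) = x
    rw [smul_smul, inv_mul_cancel₀ Real.two_pi_pos.ne', one_smul]
  rw [this, fourierCLM_apply, fourierInvCLM_apply, fourierInv_fourier_eq]

theorem fourierSchwartz_fourierSchwartzInv (φ : 𝓢(E, ℂ)) :
    fourierSchwartz E (fourierSchwartzInv E φ) = φ := by
  simp only [fourierSchwartz, fourierSchwartzInv, _root_.smul_apply,
    ContinuousLinearMap.comp_apply, map_smul]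
  rw [smul_smul, inv_mul_cancel₀ (fourier_const_ne_zero E), one_smul]
  rw [fourierCLM_apply, fourierInvCLM_apply, fourier_fourierInv_eq]
  ext x
  simp only [compCLMOfContinuousLinearEquiv_apply, Function.comp_apply]
  congr 1
  change (2 * Real.pi) • ((2 * Real.pi)⁻¹ • x) = x
  rw [smul_smul, mul_inv_cancel₀ Real.two_pi_pos.ne', one_smul]

/-- The unitary Fourier transform of tempered distributions, `⟨F u, φ⟩ = ⟨u, F φ⟩`. -/
def fourierDist : 𝓢'(E, ℂ) →L[ℂ] 𝓢'(E, ℂ) :=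
  PointwiseConvergenceCLM.precomp ℂ (fourierSchwartz E)

/-- The inverse Fourier transform of tempered distributions. -/
def fourierDistInv : 𝓢'(E, ℂ) →L[ℂ] 𝓢'(E, ℂ) :=
  PointwiseConvergenceCLM.precomp ℂ (fourierSchwartzInv E)

theorem fourierDist_fourierDistInv (u : 𝓢'(E, ℂ)) : fourierDist E (fourierDistInv E u) = u := by
  ext φ
  change u (fourierSchwartzInv E (fourierSchwartz E φ)) = u φ
  rw [fourierSchwartzInv_fourierSchwartz]

theorem fourierDistInv_fourierDist (u : 𝓢'(E, ℂ)) : fourierDistInv E (fourierDist E u) = u := by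
  ext φ
  change u (fourierSchwartz E (fourierSchwartzInv E φ)) = u φ
  rw [fourierSchwartz_fourierSchwartzInv]

/-- The measure `(1 + |p|²)^s dp`. -/
def weightMeasure (s : ℝ) : Measure E :=
  volume.withDensity fun p => ENNReal.ofReal ((1 + ‖p‖ ^ 2) ^ s)

theorem weight_pos (s : ℝ) (p : E) : 0 < (1 + ‖p‖ ^ 2) ^ s := by positivity

theorem measurable_weight (s : ℝ) :
    Measurable fun p : E => ENNReal.ofReal ((1 + ‖p‖ ^ 2) ^ s) := by fun_prop

theorem integral_weightMeasure (s : ℝ) (f : E → ℂ) :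
    ∫ p, f p ∂(weightMeasure E s) = ∫ p, (((1 + ‖p‖ ^ 2) ^ s : ℝ) : ℂ) * f p := by
  rw [weightMeasure, integral_withDensity_eq_integral_toReal_smul (measurable_weight E s)
    (Filter.Eventually.of_forall fun _ => ENNReal.ofReal_lt_top)]
  refine integral_congr_ae (Filter.Eventually.of_forall fun p => ?_)
  simp only [ENNReal.toReal_ofReal (weight_pos E s p).le, Complex.real_smul]

instance (s : ℝ) : (weightMeasure E s).HasTemperateGrowth := by
  obtain ⟨n, hn⟩ := (inferInstance : (volume : Measure E).HasTemperateGrowth).exists_integrable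
  obtain ⟨j, C, hC⟩ := (Function.hasTemperateGrowth_one_add_norm_sq_rpow E s).2 0
  refine ⟨n + j, ?_⟩
  rw [weightMeasure, integrable_withDensity_iff_integrable_smul' (measurable_weight E s)
    (Filter.Eventually.of_forall fun _ => ENNReal.ofReal_lt_top)]
  refine (hn.const_mul C).mono (Measurable.aestronglyMeasurable (by fun_prop))
    (Filter.Eventually.of_forall fun p => ?_)
  have h := hC p
  simp only [norm_iteratedFDeriv_zero] at h
  have h0 : (0 : ℝ) < 1 + ‖p‖ := by positivity
  rw [ENNReal.toReal_ofReal (weight_pos E s p).le, smul_eq_mul, norm_mul, norm_mul]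
  have hCn : C ≤ ‖C‖ := le_abs_self C
  rw [Real.norm_of_nonneg (Real.rpow_nonneg h0.le _),
    Real.norm_of_nonneg (Real.rpow_nonneg h0.le _)]
  push_cast
  rw [neg_add, Real.rpow_add h0, Real.rpow_neg h0.le (j : ℝ), Real.rpow_natCast _ j]
  calc ‖(1 + ‖p‖ ^ 2) ^ s‖ * ((1 + ‖p‖) ^ (-(n : ℝ)) * ((1 + ‖p‖) ^ j)⁻¹)
      ≤ (C * (1 + ‖p‖) ^ j) * ((1 + ‖p‖) ^ (-(n : ℝ)) * ((1 + ‖p‖) ^ j)⁻¹) := by gcongr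
    _ = C * (1 + ‖p‖) ^ (-(n : ℝ)) := by field_simp
    _ ≤ _ := by gcongr

instance (s : ℝ) : IsLocallyFiniteMeasure (weightMeasure E s) :=
  IsLocallyFiniteMeasure.withDensity_ofReal <|
    Continuous.rpow_const (by fun_prop) fun p => Or.inl (by positivity)

variable {E} in
theorem ae_weightMeasure_iff (s : ℝ) (q : E → Prop) :
    (∀ᵐ p ∂(weightMeasure E s), q p) ↔ ∀ᵐ p, q p := by
  rw [weightMeasure, ae_withDensity_iff (measurable_weight E s)]
  simp [weight_pos]

/-- The space `H̃^s(E)` of (classes of) measurable functions `f` with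
`‖f‖² = ∫ (1 + |p|²)^s |f(p)|² dp < ∞`. -/
abbrev DualSobolev (s : ℝ) : Type _ := Lp ℂ 2 (weightMeasure E s)

/-- The tempered distribution `φ ↦ ∫ φ(p) f(p) dp` of a function `f ∈ H̃^s(E)`; see
`toDist_apply`. -/
def toDist (s : ℝ) : DualSobolev E s →ₗ[ℂ] 𝓢'(E, ℂ) :=
  ((TemperedDistribution.smulLeftCLM ℂ fun p : E => (((1 + ‖p‖ ^ 2) ^ (-s) : ℝ) : ℂ)).comp
    (Lp.toTemperedDistributionCLM ℂ (weightMeasure E s) 2)).toLinearMap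

theorem hasTemperateGrowth_weight (s : ℝ) :
    (fun p : E => (((1 + ‖p‖ ^ 2) ^ s : ℝ) : ℂ)).HasTemperateGrowth := by
  fun_prop

theorem toDist_apply (s : ℝ) (f : DualSobolev E s) (φ : 𝓢(E, ℂ)) :
    toDist E s f φ = ∫ p, φ p * f p := by
  change Lp.toTemperedDistribution f (SchwartzMap.smulLeftCLM ℂ
    (fun p : E => (((1 + ‖p‖ ^ 2) ^ (-s) : ℝ) : ℂ)) φ) = _
  rw [Lp.toTemperedDistribution_apply, integral_weightMeasure]
  refine integral_congr_ae (Filter.Eventually.of_forall fun p => ?_)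
  simp only [smulLeftCLM_apply_apply (hasTemperateGrowth_weight E (-s)), smul_eq_mul]
  rw [← mul_assoc, ← mul_assoc, ← Complex.ofReal_mul, ← Real.rpow_add (by positivity)]
  simp

theorem toDist_injective (s : ℝ) : Function.Injective (toDist E s) := by
  rw [← LinearMap.ker_eq_bot, LinearMap.ker_eq_bot']
  intro f hf
  have hker := Lp.ker_toTemperedDistributionCLM_eq_bot (F := ℂ) (μ := weightMeasure E s) (p := 2)
  rw [LinearMap.ker_eq_bot'] at hker
  refine hker f ?_
  have h := congrArg
    (TemperedDistribution.smulLeftCLM ℂ fun p : E => (((1 + ‖p‖ ^ 2) ^ s : ℝ) : ℂ)) hf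
  change TemperedDistribution.smulLeftCLM ℂ (fun p : E => (((1 + ‖p‖ ^ 2) ^ s : ℝ) : ℂ))
    (TemperedDistribution.smulLeftCLM ℂ (fun p : E => (((1 + ‖p‖ ^ 2) ^ (-s) : ℝ) : ℂ))
      (Lp.toTemperedDistributionCLM ℂ (weightMeasure E s) 2 f)) = _ at h
  rw [map_zero, TemperedDistribution.smulLeftCLM_smulLeftCLM_apply
    (hasTemperateGrowth_weight E (-s)) (hasTemperateGrowth_weight E s)] at h
  have h1 : ((fun p : E => (((1 + ‖p‖ ^ 2) ^ (-s) : ℝ) : ℂ)) *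
      fun p : E => (((1 + ‖p‖ ^ 2) ^ s : ℝ) : ℂ)) = fun _ => 1 := by
    ext p
    simp only [Pi.mul_apply]
    rw [← Complex.ofReal_mul, ← Real.rpow_add (by positivity)]
    simp
  rw [h1, TemperedDistribution.smulLeftCLM_const, one_smul] at h
  exact h

/-- The Sobolev space `H^s(E)`, as a space of tempered distributions: those whose Fourier transform
is (given by) a function in `H̃^s(E)`. -/
def sobolevSubmodule (s : ℝ) : Submodule ℂ 𝓢'(E, ℂ) :=
  (LinearMap.range (toDist E s)).comap (fourierDist E).toLinearMap

/-- The Sobolev space `H^s(E)`, with the norm `‖u‖_{H^s} = ‖F u‖_{H̃^s}`. -/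
def Sobolev (s : ℝ) : Type _ := sobolevSubmodule E s

instance (s : ℝ) : AddCommGroup (Sobolev E s) :=
  inferInstanceAs (AddCommGroup (sobolevSubmodule E s))

instance (s : ℝ) : Module ℂ (Sobolev E s) :=
  inferInstanceAs (Module ℂ (sobolevSubmodule E s))

variable {E}

/-- An element of `H^s(E)` as a tempered distribution. -/
def Sobolev.dist {s : ℝ} (u : Sobolev E s) : 𝓢'(E, ℂ) := Subtype.val u

theorem Sobolev.exists_fourier {s : ℝ} (u : Sobolev E s) :
    ∃ f : DualSobolev E s, toDist E s f = fourierDist E u.dist := u.2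

variable (E) in
/-- The inverse Fourier transform `H̃^s(E) → H^s(E)`. -/
def fourierInvLin (s : ℝ) : DualSobolev E s →ₗ[ℂ] Sobolev E s :=
  LinearMap.codRestrict (sobolevSubmodule E s) ((fourierDistInv E).toLinearMap ∘ₗ toDist E s)
    fun f => ⟨f, (fourierDist_fourierDistInv E (toDist E s f)).symm⟩

theorem fourierInvLin_bijective (s : ℝ) : Function.Bijective (fourierInvLin E s) := by
  constructor
  · intro f g h
    have h1 : fourierDistInv E (toDist E s f) = fourierDistInv E (toDist E s g) :=
      congrArg Sobolev.dist h
    have h2 := congrArg (fourierDist E) h1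
    rw [fourierDist_fourierDistInv, fourierDist_fourierDistInv] at h2
    exact toDist_injective E s h2
  · intro u
    obtain ⟨f, hf⟩ := u.exists_fourier
    refine ⟨f, Subtype.ext ?_⟩
    change fourierDistInv E (toDist E s f) = u.dist
    rw [hf, fourierDistInv_fourierDist]

variable (E) in
/-- The Fourier transform `H^s(E) → H̃^s(E)` as a linear isomorphism. -/
def fourierLin (s : ℝ) : Sobolev E s ≃ₗ[ℂ] DualSobolev E s :=
  (LinearEquiv.ofBijective (fourierInvLin E s) (fourierInvLin_bijective s)).symm

instance (s : ℝ) : NormedAddCommGroup (Sobolev E s) :=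
  NormedAddCommGroup.induced (Sobolev E s) (DualSobolev E s) (fourierLin E s)
    (fourierLin E s).injective

instance (s : ℝ) : NormedSpace ℂ (Sobolev E s) where
  norm_smul_le c u := by
    change ‖fourierLin E s (c • u)‖ ≤ ‖c‖ * ‖fourierLin E s u‖
    rw [map_smul, norm_smul]

variable (E) in
/-- The Fourier transform as a surjective isometry `H^s(E) → H̃^s(E)`. -/
def fourierIso (s : ℝ) : Sobolev E s ≃ₗᵢ[ℂ] DualSobolev E s where
  toLinearEquiv := fourierLin E s
  norm_map' _ := rfl

theorem toDist_fourierIso (s : ℝ) (u : Sobolev E s) :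
    toDist E s (fourierIso E s u) = fourierDist E u.dist := by
  obtain ⟨f, rfl⟩ := (fourierInvLin_bijective s).surjective u
  have h : fourierIso E s (fourierInvLin E s f) = f :=
    (LinearEquiv.ofBijective (fourierInvLin E s) (fourierInvLin_bijective s)).symm_apply_apply f
  rw [h]
  exact (fourierDist_fourierDistInv E (toDist E s f)).symm

/-- The operator `Ã = F A F⁻¹ : H̃^s → H̃^σ` that is an operator `A : H^s → H^σ` written in dual
coordinates. -/
def dualOperator {s σ : ℝ} (A : Sobolev E s →L[ℂ] Sobolev E σ) :
    DualSobolev E s →L[ℂ] DualSobolev E σ :=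
  ((fourierIso E σ).toContinuousLinearEquiv : Sobolev E σ →L[ℂ] DualSobolev E σ) ∘L A ∘L
    ((fourierIso E s).symm.toContinuousLinearEquiv : DualSobolev E s →L[ℂ] Sobolev E s)

/-- The operator `F⁻¹ R F : H^s → H^σ`, that is, `R : H̃^s → H̃^σ` in physical coordinates. -/
def physicalOperator {s σ : ℝ} (R : DualSobolev E s →L[ℂ] DualSobolev E σ) :
    Sobolev E s →L[ℂ] Sobolev E σ :=
  ((fourierIso E σ).symm.toContinuousLinearEquiv : DualSobolev E σ →L[ℂ] Sobolev E σ) ∘L R ∘L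
    ((fourierIso E s).toContinuousLinearEquiv : Sobolev E s →L[ℂ] DualSobolev E s)

/-- `R` is compact in physical coordinates. -/
def IsCompactInPhysicalCoordinates {s σ : ℝ} (R : DualSobolev E s →L[ℂ] DualSobolev E σ) : Prop :=
  IsCompactOperator (physicalOperator R)

/-- `A : H̃^s → H̃^σ` is the integral operator `(A f)(p) = ∫ K(p,p') f(p') dp'`, the integral
converging absolutely for almost every `p`. -/
def IsIntegralOperator {s σ : ℝ} (K : E → E → ℂ)
    (A : DualSobolev E s →L[ℂ] DualSobolev E σ) : Prop :=
  ∀ f : DualSobolev E s, ∀ᵐ p : E,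
    Integrable (fun p' => K p p' * f p') ∧ A f p = ∫ p', K p p' * f p'

end Sobolev

/-! ### The ambient space, the submanifold, and the trace -/

/-- `X = ℝ^k`, the space of the coordinates `x`. -/
abbrev X (k : ℕ) : Type := EuclideanSpace ℝ (Fin k)

/-- `M = ℝ^{2k}`, the space of the coordinates `(x, t)`; also the space of momenta `(p, τ)`. -/
abbrev M (k : ℕ) : Type := WithLp 2 (X k × X k)

/-- The point of `M` with coordinates `(x, t)`. -/
def pt {k : ℕ} (x t : X k) : M k := WithLp.toLp 2 (x, t)

/-- The embedding `i : X → M`, `x ↦ (x, 0)`. -/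
def embX (k : ℕ) : X k →L[ℝ] M k :=
  ((WithLp.prodContinuousLinearEquiv 2 ℝ (X k) (X k)).symm : X k × X k →L[ℝ] M k) ∘L
    ContinuousLinearMap.inl ℝ (X k) (X k)

theorem embX_apply {k : ℕ} (x : X k) : embX k x = pt x 0 := rfl

theorem norm_embX {k : ℕ} (x : X k) : ‖embX k x‖ = ‖x‖ := by
  rw [embX_apply, pt]
  simp

/-- Restriction `φ ↦ φ|_X` of Schwartz functions. -/
def restrictSchwartz (k : ℕ) : 𝓢(M k, ℂ) →L[ℂ] 𝓢(X k, ℂ) :=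
  compCLMOfAntilipschitz (K := 1) ℂ (embX k).hasTemperateGrowth
    (AddMonoidHomClass.antilipschitz_of_bound (embX k) fun x => by simp [norm_embX])

theorem restrictSchwartz_apply {k : ℕ} (φ : 𝓢(M k, ℂ)) (x : X k) :
    restrictSchwartz k φ x = φ (pt x 0) := rfl

/-- `B` is the boundary operator `i^* : u ↦ u|_X` (the bounded operator that restricts Schwartz
functions to `X`; Schwartz functions are dense in the Sobolev spaces). -/
def IsBoundaryOperator {k : ℕ} {r r' : ℝ} (B : Sobolev (M k) r →L[ℂ] Sobolev (X k) r') : Prop :=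
  ∀ (v : Sobolev (M k) r) (φ : 𝓢(M k, ℂ)), v.dist = toTemperedDistributionCLM (M k) ℂ volume φ →
    (B v).dist = toTemperedDistributionCLM (X k) ℂ volume (restrictSchwartz k φ)

/-- `C` is the coboundary operator `i_* : u ↦ u ⊗ δ_X`, `⟨u ⊗ δ_X, φ⟩ = ⟨u, φ|_X⟩`. -/
def IsCoboundaryOperator {k : ℕ} {r r' : ℝ} (C : Sobolev (X k) r →L[ℂ] Sobolev (M k) r') : Prop :=
  ∀ (u : Sobolev (X k) r) (φ : 𝓢(M k, ℂ)), (C u).dist φ = u.dist (restrictSchwartz k φ)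

/-- `Φ` is the Fourier integral operator with the phase function `S(y, ξ')` and the amplitude
`A(ξ')`, `y = (x,t)`, `ξ' = (p',τ')`. Its Schwartz kernel is `F_{ξ' → y'} {e^{iS(y,ξ')} A(ξ')}`, that
is, `(Φv)(y) = ∫ e^{iS(y,ξ')} A(ξ') ṽ(ξ') dξ'` with `ṽ = F v`, as an oscillatory integral: paired
with a test function `φ`, the integration over `y` is performed first. -/
def IsFourierIntegralOperator {k : ℕ} (S : M k → M k → ℝ) (A : M k → ℂ) {r r' : ℝ}
    (Φ : Sobolev (M k) r →L[ℂ] Sobolev (M k) r') : Prop :=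
  ∀ (v : Sobolev (M k) r) (φ : 𝓢(M k, ℂ)),
    Integrable (fun ξ' : M k =>
      (∫ y : M k, Complex.exp (Complex.I * S y ξ') * φ y) * A ξ' * fourierIso (M k) r v ξ') ∧
    (Φ v).dist φ = ∫ ξ' : M k,
      (∫ y : M k, Complex.exp (Complex.I * S y ξ') * φ y) * A ξ' * fourierIso (M k) r v ξ'

/-- `T` is the trace `i^!(Φ) = i^* Φ i_* : H^s(X) → H^{s-m-n/2}(X)` of the Fourier integral operator
`Φ` of order `m` with phase function `S` and amplitude `A`. Here `n = dim M = 2k`, and `X` has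
codimension `n/2 = k`. The factors are the operators
`i_* : H^s(X) → H^{s-k/2}(M)`, `Φ : H^{s-k/2}(M) → H^{s-k/2-m}(M)` and
`i^* : H^{s-k/2-m}(M) → H^{s-m-k}(X)`. -/
def IsTrace {k : ℕ} (S : M k → M k → ℝ) (A : M k → ℂ) (m s : ℝ)
    (T : Sobolev (X k) s →L[ℂ] Sobolev (X k) (s - m - k)) : Prop :=
  ∃ (C : Sobolev (X k) s →L[ℂ] Sobolev (M k) (s - k / 2))
    (Φ : Sobolev (M k) (s - k / 2) →L[ℂ] Sobolev (M k) (s - k / 2 - m))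
    (B : Sobolev (M k) (s - k / 2 - m) →L[ℂ] Sobolev (X k) (s - m - k)),
    IsCoboundaryOperator C ∧ IsFourierIntegralOperator S A Φ ∧ IsBoundaryOperator B ∧
      T = B ∘L Φ ∘L C

/-! ### The canonical transformation -/

/-- `f` restricts to a diffeomorphism of the open set `U` onto the open set `V`. -/
def IsDiffeomorphismOn {F : Type*} [NormedAddCommGroup F] [NormedSpace ℝ F] (f : F → F)
    (U V : Set F) : Prop :=
  ContDiffOn ℝ ∞ f U ∧ Set.MapsTo f U V ∧
    ∃ f' : F → F, ContDiffOn ℝ ∞ f' V ∧ Set.MapsTo f' V U ∧ Set.InvOn f' f U V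

/-- `f` is positively homogeneous of degree `d` outside the origin. -/
def IsHomogeneous {F G : Type*} [Zero F] [SMul ℝ F] [SMul ℝ G] (d : ℝ) (f : F → G) : Prop :=
  ∀ (ξ : F) (c : ℝ), ξ ≠ 0 → 0 < c → f (c • ξ) = (c ^ d) • f ξ

/-- The symplectic form `dp ∧ dx + dτ ∧ dt` on the space `M × M` of pairs
`(position, momentum)`. -/
def symplecticForm {k : ℕ} (u v : M k × M k) : ℝ :=
  inner ℝ u.2 v.1 - inner ℝ v.2 u.1

/-- `g : (y', ξ') ↦ (y, ξ)` is a homogeneous canonical transformation, defined on the cotangent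
bundle without the zero section over the open set `Ω`. -/
structure IsCanonicalTransformation {k : ℕ} (Ω : Set (M k)) (g : M k × M k → M k × M k) :
    Prop where
  smooth : ContDiffOn ℝ ∞ g (Ω ×ˢ {0}ᶜ)
  momentum_ne_zero : ∀ w ∈ Ω ×ˢ ({0}ᶜ : Set (M k)), (g w).2 ≠ 0
  injOn : Set.InjOn g (Ω ×ˢ {0}ᶜ)
  symplectic : ∀ w ∈ Ω ×ˢ ({0}ᶜ : Set (M k)), ∀ u v : M k × M k,
    symplecticForm (fderiv ℝ g w u) (fderiv ℝ g w v) = symplecticForm u v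
  homogeneous : ∀ y' ∈ Ω, ∀ ξ' : M k, ξ' ≠ 0 → ∀ c : ℝ, 0 < c →
    g (y', c • ξ') = ((g (y', ξ')).1, c • (g (y', ξ')).2)

/-- The transformation maps the fibre over `x₀ = 0` onto itself, and `x₀` is the only point of `X`
whose fibre is related by `g` to the fibre over a point of `X`. -/
structure ConditionA {k : ℕ} (Ω : Set (M k)) (g : M k × M k → M k × M k) : Prop where
  fibre : g '' ({0} ×ˢ {0}ᶜ) = {0} ×ˢ {0}ᶜ
  projection : {q : X k × X k | pt q.1 0 ∈ Ω ∧ pt q.2 0 ∈ Ω ∧ ∃ ξ ξ' : M k, ξ' ≠ 0 ∧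
    g (pt q.2 0, ξ') = (pt q.1 0, ξ)} = {(0, 0)}

/-- Over `x₀ = 0` the transformation is `(0, 0, p', τ') ↦ (0, 0, h(p',τ'), τ)`, where `h` is
homogeneous of degree `1` and is a diffeomorphism in `τ'`. -/
structure ConditionB {k : ℕ} (g : M k × M k → M k × M k) (h : X k → X k → X k) : Prop where
  eq : ∀ p' τ' : X k, pt p' τ' ≠ 0 → ∃ τ : X k, g (0, pt p' τ') = (0, pt (h p' τ') τ)
  homogeneous : IsHomogeneous 1 fun ξ' : M k => h ξ'.fst ξ'.snd
  diffeo : ∀ p' : X k, p' ≠ 0 → IsDiffeomorphismOn (h p') Set.univ Set.univ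
  diffeo_zero : IsDiffeomorphismOn (h 0) {0}ᶜ {0}ᶜ

/-- `S(y, ξ')`, `y = (x,t)`, `ξ' = (p',τ')`, is a generating function of the graph of `g` near the
fibre over `(x₀, x₀)`, in the coordinates `(x, t, p', τ')`: there the graph is given by the equations
`y' = ∂S/∂ξ'`, `ξ = ∂S/∂y`. The function is homogeneous of degree `1` in `ξ'` and (affine) linear in
`y`. -/
structure IsLinearGeneratingFunction {k : ℕ} (Ω : Set (M k)) (g : M k × M k → M k × M k)
    (S : M k → M k → ℝ) : Prop where
  smooth : ContDiffOn ℝ ∞ (fun w : M k × M k => S w.1 w.2) (Set.univ ×ˢ {0}ᶜ)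
  homogeneous : ∀ y : M k, IsHomogeneous 1 (S y)
  linear : ∀ ξ' : M k, ξ' ≠ 0 → ∃ ℓ : M k →L[ℝ] ℝ, ∀ y : M k, S y ξ' = S 0 ξ' + ℓ y
  graph : ∃ U ∈ 𝓝 (0 : M k), U ⊆ Ω ∧ ∀ y ∈ U, ∀ y' ∈ U, ∀ ξ ξ' : M k, ξ ≠ 0 → ξ' ≠ 0 →
    (g (y', ξ') = (y, ξ) ↔
      y' = gradient (fun η => S y η) ξ' ∧ ξ = gradient (fun z => S z ξ') y)

/-! ### Amplitudes, cut-off functions and the homogeneous kernel -/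

/-- `a` is a smooth function on the whole space which coincides at infinity with the function `a₀`,
homogeneous of degree `m` and smooth outside the origin. -/
structure IsSmoothedAmplitude {k : ℕ} (m : ℝ) (a₀ a : M k → ℂ) : Prop where
  smooth_homogeneous : ContDiffOn ℝ ∞ a₀ {0}ᶜ
  homogeneous : IsHomogeneous m a₀
  smooth : ContDiff ℝ ∞ a
  eq_at_infinity : ∀ᶠ ξ' in Filter.cocompact (M k), a ξ' = a₀ ξ'

/-- `μ` is a positive smooth density, homogeneous of degree `0`. -/
structure IsHomogeneousDensity {k : ℕ} (μ : M k → ℝ) : Prop where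
  smooth : ContDiffOn ℝ ∞ μ {0}ᶜ
  pos : ∀ ξ' : M k, ξ' ≠ 0 → 0 < μ ξ'
  homogeneous : IsHomogeneous 0 μ

/-- `a_μ = √μ · a`. -/
def densityAmplitude {k : ℕ} (μ : M k → ℝ) (a : M k → ℂ) (ξ' : M k) : ℂ :=
  (Real.sqrt (μ ξ') : ℂ) * a ξ'

/-- The inverse `η ↦ τ' = h⁻¹(p', η)` of the mapping `τ' ↦ η = h(p', τ')`, `(p', τ') ≠ 0`. -/
def fibreInverse {k : ℕ} (h : X k → X k → X k) (p' : X k) : X k → X k :=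
  Function.invFunOn (h p') {τ' | pt p' τ' ≠ 0}

/-- The Jacobian `J(p', η) = det (∂ h⁻¹(p', η) / ∂η)`. -/
def jacobian {k : ℕ} (h : X k → X k → X k) (p' η : X k) : ℝ :=
  (fderiv ℝ (fibreInverse h p') η).det

/-- The kernel `b⁰(p, p') = |J(p', p)| a_μ(p', h⁻¹(p', p))`, where `a_μ = √μ · a₀`. -/
def homogeneousKernel {k : ℕ} (h : X k → X k → X k) (μ : M k → ℝ) (a₀ : M k → ℂ)
    (p p' : X k) : ℂ :=
  ((|jacobian h p' p| : ℝ) : ℂ) * densityAmplitude μ a₀ (pt p' (fibreInverse h p' p))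

/-- A smooth function that vanishes near the origin and equals `1` at infinity. -/
structure IsCutoff {k : ℕ} (ψ : X k → ℝ) : Prop where
  smooth : ContDiff ℝ ∞ ψ
  eq_zero : ∀ᶠ p in 𝓝 (0 : X k), ψ p = 0
  eq_one : ∀ᶠ p in Filter.cocompact (X k), ψ p = 1

/-- The kernel `ψ(p) b(p, p') ψ'(p')`. -/
def cutKernel {k : ℕ} (ψ ψ' : X k → ℝ) (b : X k → X k → ℂ) (p p' : X k) : ℂ :=
  (ψ p : ℂ) * b p p' * (ψ' p' : ℂ)

end TraceFIO

end

open TraceFIO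

/-! # Traces of quantized canonical transformations with a fixed point

Homogeneity and linearity force the phase to be `S(y, ξ') = ⟨y, H(ξ')⟩`, where `H` is the map that
`g` induces on the fibre over the fixed point (`phase_eq_inner`): `S(0, ·)` vanishes by Euler's
identity, since its gradient at every `ξ'` is the point `0` over which `g` leaves the covector. The
map `H` is a homogeneous diffeomorphism of the complement of the origin; its differential is
injective because `g` is symplectic (`isHomogeneousDiffeo_fibreMap`).

Hence, in dual coordinates, all three factors of the trace are explicit: `i_*` sends `f` to
`(2π)^{-k/2} f(p')`, `Φ` sends `v` to `(2π)^k |det H'|⁻¹ α v`, all taken at `H⁻¹(ξ)`, and `i^*` is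
`(2π)^{-k/2}` times the integration over the fibres `p = const`. Their boundedness reduces to
`∫ (1 + |p|² + |τ|²)^{-e} dτ = c (1 + |p|²)^{k/2 - e}` (`lintegral_bracket`), the Cauchy–Schwarz
inequality, and a change of variables. Pairing the composition with a test function and substituting
first `ξ = H(ξ')` and then `τ' = h⁻¹(p', p)`, one finds that the trace is *exactly* the integral
operator with the kernel `|J(p', p)| α(p', h⁻¹(p', p))`, `α = √μ a` (`exists_trace`).

This kernel is `b⁰` with `a` in place of `a₀`. It is `O((1 + |p|² + |p'|²)^{m/2})`, a bound that by
itself implies the boundedness of the integral operator `H̃^s → H̃^{s-m-k}`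
(`exists_kernelOperator`). The difference from `ψ b⁰ ψ'` obeys the same bound and vanishes when `|p|`
and `|p'|` are both large, so that it is of Hilbert–Schmidt class between the weighted spaces and
therefore compact (`isCompactOperator_of_truncated`). Smoothness and homogeneity of `b⁰` come from
the inverse function theorem for the shear `(p', τ') ↦ (p', h(p', τ'))`
(`isHomogeneousDiffeo_shear`).
-/

namespace TraceFIO

/-! ### Compactness of Hilbert–Schmidt operators, and operators on `L²` given by formulas -/

/-- A bounded operator for which the sums `∑ ‖T eᵢ‖²` over finite orthonormal systems are bounded is
compact: on the orthogonal complement of a system that almost attains the supremum the norm of `T`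
is small, since any unit vector of the complement may be added to the system. -/
theorem isCompactOperator_of_sum_sq_le {H F : Type*} [NormedAddCommGroup H]
    [InnerProductSpace ℂ H] [NormedAddCommGroup F] [NormedSpace ℂ F] [CompleteSpace F]
    (T : H →L[ℂ] F) (C : ℝ)
    (hC : ∀ (n : ℕ) (e : Fin n → H), Orthonormal ℂ e → ∑ i, ‖T (e i)‖ ^ 2 ≤ C) :
    IsCompactOperator T := by
  set V : Set ℝ := {r | ∃ (n : ℕ) (e : Fin n → H), Orthonormal ℂ e ∧ r = ∑ i, ‖T (e i)‖ ^ 2}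
    with hV
  have hbdd : BddAbove V := ⟨C, by rintro r ⟨n, e, he, rfl⟩; exact hC n e he⟩
  have hne : V.Nonempty := ⟨_, 0, Fin.elim0, Orthonormal.of_isEmpty _, rfl⟩
  have hmem : T ∈ closure {S : H →L[ℂ] F | IsCompactOperator S} := by
    rw [Metric.mem_closure_iff]
    intro ε hε
    obtain ⟨_, ⟨n, e, he, rfl⟩, hlt⟩ :=
      exists_lt_of_lt_csSup hne (show sSup V - (ε / 2) ^ 2 < sSup V by nlinarith [sq_nonneg ε])
    set K : Submodule ℂ H := Submodule.span ℂ (Set.range e) with hK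
    have : FiniteDimensional ℂ K := FiniteDimensional.span_of_finite ℂ (Set.finite_range e)
    have hunit : ∀ x ∈ Kᗮ, ‖x‖ = 1 → ‖T x‖ ≤ ε / 2 := by
      intro x hx hx1
      have hon : Orthonormal ℂ (Matrix.vecCons x e) := by
        rw [orthonormal_vecCons_iff]
        refine ⟨hx1, fun i => ?_, he⟩
        rw [← inner_conj_symm, (Submodule.mem_orthogonal _ _).1 hx (e i)
          (Submodule.subset_span ⟨i, rfl⟩), map_zero]
      have := le_csSup hbdd ⟨n + 1, _, hon, rfl⟩
      rw [Fin.sum_univ_succ] at this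
      simp only [Matrix.cons_val_zero, Matrix.cons_val_succ] at this
      exact le_of_sq_le_sq (by linarith) (by positivity)
    have horth : ∀ x ∈ Kᗮ, ‖T x‖ ≤ ε / 2 * ‖x‖ := by
      intro x hx
      rcases eq_or_ne x 0 with rfl | hx0
      · simp
      have hn : ‖x‖ ≠ 0 := norm_ne_zero_iff.2 hx0
      have := hunit (((‖x‖⁻¹ : ℝ) : ℂ) • x) (Submodule.smul_mem _ _ hx)
        (by rw [norm_smul]; simp [hn])
      rw [map_smul, norm_smul] at this
      simp only [Complex.norm_real, norm_inv, norm_norm] at this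
      rwa [inv_mul_le_iff₀ (by positivity), mul_comm] at this
    refine ⟨T ∘L K.starProjection, ?_, ?_⟩
    · have : ProperSpace K := FiniteDimensional.proper ℂ K
      have h1 : IsCompactOperator (T ∘L K.subtypeL) :=
        isCompactOperator_of_locallyCompactSpace_rng _
      exact h1.comp_clm K.orthogonalProjectionOnto
    · rw [dist_eq_norm]
      refine lt_of_le_of_lt (ContinuousLinearMap.opNorm_le_bound _ (by positivity : 0 ≤ ε / 2)
        fun x => ?_) (by linarith)
      have : (T - T ∘L K.starProjection) x = T (x - K.starProjection x) := by simp
      rw [this]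
      refine (horth _ (K.sub_starProjection_mem_orthogonal x)).trans ?_
      gcongr
      rw [← Submodule.starProjection_orthogonal_val]
      exact Submodule.norm_starProjection_apply_le _ x
  rwa [isClosed_setOfPred_isCompactOperator.closure_eq] at hmem

theorem eLpNorm_two_sq {α : Type*} [MeasurableSpace α] (μ : Measure α) (f : α → ℂ) :
    eLpNorm f 2 μ ^ 2 = ∫⁻ x, ‖f x‖ₑ ^ 2 ∂μ := by
  rw [eLpNorm_eq_lintegral_rpow_enorm_toReal (by simp) (by simp), ← ENNReal.rpow_natCast,
    ← ENNReal.rpow_mul]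
  simp

theorem memLp_two_iff_lintegral {α : Type*} [MeasurableSpace α] {μ : Measure α} {f : α → ℂ}
    (hf : AEStronglyMeasurable f μ) : MemLp f 2 μ ↔ ∫⁻ x, ‖f x‖ₑ ^ 2 ∂μ < ⊤ := by
  rw [← eLpNorm_two_sq, MemLp]
  simp [hf]

/-- A formula `f ↦ L f` which is linear up to null sets and satisfies an `L²`-bound defines a bounded
operator. -/
theorem exists_operator_of_bound {α β : Type*} [MeasurableSpace α] [MeasurableSpace β]
    {μ : Measure α} {ν : Measure β} (L : (α → ℂ) → β → ℂ) (C : ℝ≥0∞) (hCtop : C ≠ ⊤)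
    (hmeas : ∀ f : Lp ℂ 2 μ, AEStronglyMeasurable (L f) ν)
    (hadd : ∀ f g : Lp ℂ 2 μ, L (f + g : Lp ℂ 2 μ) =ᵐ[ν] L f + L g)
    (hsmul : ∀ (c : ℂ) (f : Lp ℂ 2 μ), L (c • f : Lp ℂ 2 μ) =ᵐ[ν] c • L f)
    (hbound : ∀ f : Lp ℂ 2 μ, ∫⁻ x, ‖L f x‖ₑ ^ 2 ∂ν ≤ C * ∫⁻ x, ‖f x‖ₑ ^ 2 ∂μ) :
    ∃ T : Lp ℂ 2 μ →L[ℂ] Lp ℂ 2 ν, ∀ f, T f =ᵐ[ν] L f := by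
  have hmem : ∀ f : Lp ℂ 2 μ, MemLp (L f) 2 ν := fun f => by
    rw [memLp_two_iff_lintegral (hmeas f)]
    refine (hbound f).trans_lt (ENNReal.mul_lt_top hCtop.lt_top ?_)
    exact (memLp_two_iff_lintegral (Lp.aestronglyMeasurable f)).1 (Lp.memLp f)
  let T₀ : Lp ℂ 2 μ →ₗ[ℂ] Lp ℂ 2 ν :=
    { toFun := fun f => (hmem f).toLp _
      map_add' := fun f g => by
        rw [← MemLp.toLp_add]
        exact MemLp.toLp_congr _ _ (hadd f g)
      map_smul' := fun c f => by
        rw [RingHom.id_apply, ← MemLp.toLp_const_smul]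
        exact MemLp.toLp_congr _ _ (hsmul c f) }
  refine ⟨T₀.mkContinuous (Real.sqrt C.toReal) fun f => ?_, fun f => (hmem f).coeFn_toLp⟩
  refine le_of_sq_le_sq ?_ (by positivity)
  rw [mul_pow, Real.sq_sqrt ENNReal.toReal_nonneg]
  change ‖(hmem f).toLp _‖ ^ 2 ≤ _
  rw [Lp.norm_toLp, Lp.norm_def, ← ENNReal.toReal_pow, ← ENNReal.toReal_pow, ← ENNReal.toReal_mul,
    eLpNorm_two_sq, eLpNorm_two_sq]
  refine ENNReal.toReal_mono (ENNReal.mul_ne_top hCtop ?_) (hbound f)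
  exact ((memLp_two_iff_lintegral (Lp.aestronglyMeasurable f)).1 (Lp.memLp f)).ne

/-- The operator `f ↦ κ · (f ∘ ρ)` between `L²` spaces. The bound, for `G = 0` almost everywhere,
also makes `κ · (f ∘ ρ)` independent of the representative of `f`. -/
theorem exists_weightedCompOperator {α β : Type*} [MeasurableSpace α] [MeasurableSpace β]
    {μ : Measure α} {ν : Measure β} {ρ : β → α} (hρ : Measurable ρ) {κ : β → ℂ}
    (hκ : Measurable κ) (C : ℝ≥0∞) (hCtop : C ≠ ⊤)
    (hC : ∀ G : α → ℝ≥0∞, Measurable G →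
      ∫⁻ x, ‖κ x‖ₑ ^ 2 * G (ρ x) ∂ν ≤ C * ∫⁻ x, G x ∂μ) :
    ∃ T : Lp ℂ 2 μ →L[ℂ] Lp ℂ 2 ν, ∀ f, T f =ᵐ[ν] fun x => κ x * f (ρ x) := by
  have hsm : ∀ f : Lp ℂ 2 μ, Measurable f := fun f => (Lp.stronglyMeasurable f).measurable
  have hnull : ∀ f g : α → ℂ, Measurable f → Measurable g → f =ᵐ[μ] g →
      (fun x => κ x * f (ρ x)) =ᵐ[ν] fun x => κ x * g (ρ x) := by
    intro f g hf hg hfg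
    have hG : Measurable fun x => ‖f x - g x‖ₑ := by fun_prop
    have h0 : ∫⁻ x, ‖f x - g x‖ₑ ∂μ = 0 := by
      rw [lintegral_eq_zero_iff hG]
      filter_upwards [hfg] with x hx
      simp [hx]
    have h1 := hC _ hG
    rw [h0, mul_zero, nonpos_iff_eq_zero, lintegral_eq_zero_iff (by fun_prop)] at h1
    filter_upwards [h1] with x hx
    simp only [Pi.zero_apply, mul_eq_zero, pow_eq_zero_iff, ne_eq, OfNat.ofNat_ne_zero,
      not_false_eq_true, enorm_eq_zero, sub_eq_zero] at hx
    rcases hx with hx | hx <;> simp [hx]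
  refine exists_operator_of_bound (fun f x => κ x * f (ρ x)) C hCtop ?_ ?_ ?_ ?_
  · intro f
    exact (hκ.mul ((hsm f).comp hρ)).aestronglyMeasurable
  · intro f g
    refine (hnull _ _ (hsm _) ((hsm f).add (hsm g)) (Lp.coeFn_add f g)).trans ?_
    filter_upwards with x
    simp [mul_add]
  · intro c f
    refine (hnull _ _ (hsm _) ((hsm f).const_smul c) (Lp.coeFn_smul c f)).trans ?_
    filter_upwards with x
    simp only [Pi.smul_apply, smul_eq_mul]
    ring
  · intro f
    have := hC (fun x => ‖f x‖ₑ ^ 2) (by have := hsm f; fun_prop)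
    refine le_trans (le_of_eq ?_) this
    refine lintegral_congr fun x => ?_
    rw [enorm_mul, mul_pow]

/-! ### Weights and fibre integrals -/

section Weights

variable {E : Type*} [NormedAddCommGroup E] [InnerProductSpace ℝ E] [FiniteDimensional ℝ E]
  [MeasurableSpace E] [BorelSpace E]

theorem lintegral_weightMeasure (s : ℝ) {G : E → ℝ≥0∞} (hG : Measurable G) :
    ∫⁻ p, G p ∂(weightMeasure E s) = ∫⁻ p, ENNReal.ofReal ((1 + ‖p‖ ^ 2) ^ s) * G p :=
  lintegral_withDensity_eq_lintegral_mul _ (measurable_weight E s) hG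

variable (E) in
/-- The constant `∫ (1 + |τ|²)^{-e} dτ`. -/
noncomputable def bracketConst (e : ℝ) : ℝ≥0∞ := ∫⁻ τ : E, ENNReal.ofReal ((1 + ‖τ‖ ^ 2) ^ (-e))

theorem bracketConst_lt_top {e : ℝ} (he : (Module.finrank ℝ E : ℝ) / 2 < e) :
    bracketConst E e < ⊤ := by
  have h := (integrable_rpow_neg_one_add_norm_sq (E := E) (μ := volume) (r := 2 * e)
    (by linarith)).lintegral_lt_top
  have h2 : -(2 * e) / 2 = -e := by ring
  rwa [h2] at h

theorem lintegral_comp_inv_smul {R : ℝ} (hR : 0 < R) {f : E → ℝ≥0∞} (hf : Measurable f) :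
    ∫⁻ x : E, f (R⁻¹ • x) = ENNReal.ofReal (R ^ Module.finrank ℝ E) * ∫⁻ x, f x := by
  have h := Measure.map_addHaar_smul (volume : Measure E) (inv_ne_zero hR.ne')
  rw [← lintegral_map (μ := volume) hf (measurable_const_smul R⁻¹), h, lintegral_smul_measure,
    smul_eq_mul]
  congr 2
  rw [inv_pow, inv_inv, abs_of_pos (by positivity)]

/-- The homogeneity of the bracket integral, by the substitution `τ ↦ √a τ`. -/
theorem lintegral_bracket {a : ℝ} (ha : 0 < a) (e : ℝ) :
    ∫⁻ τ : E, ENNReal.ofReal ((a + ‖τ‖ ^ 2) ^ (-e)) =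
      ENNReal.ofReal (a ^ ((Module.finrank ℝ E : ℝ) / 2 - e)) * bracketConst E e := by
  have hR : 0 < Real.sqrt a := Real.sqrt_pos.2 ha
  have h1 : ∀ τ : E, ENNReal.ofReal ((a + ‖τ‖ ^ 2) ^ (-e)) = ENNReal.ofReal (a ^ (-e)) *
      ENNReal.ofReal ((1 + ‖(Real.sqrt a)⁻¹ • τ‖ ^ 2) ^ (-e)) := by
    intro τ
    rw [← ENNReal.ofReal_mul (by positivity), ← Real.mul_rpow ha.le (by positivity), norm_smul,
      mul_pow, norm_inv, Real.norm_of_nonneg hR.le, inv_pow, Real.sq_sqrt ha.le]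
    congr 2
    field_simp
  simp_rw [h1]
  rw [lintegral_const_mul _ (by fun_prop), lintegral_comp_inv_smul hR
    (f := fun x : E => ENNReal.ofReal ((1 + ‖x‖ ^ 2) ^ (-e))) (by fun_prop), ← mul_assoc,
    ← ENNReal.ofReal_mul (by positivity), bracketConst]
  congr 2
  rw [Real.sqrt_eq_rpow, ← Real.rpow_natCast, ← Real.rpow_mul ha.le, ← Real.rpow_add ha]
  congr 1
  ring

/-- The Cauchy–Schwarz inequality for `f = (√w f) · (1/√w)`. -/
theorem sq_lintegral_le_weighted {α : Type*} [MeasurableSpace α] {μ : Measure α} {f : α → ℝ≥0∞}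
    (hf : Measurable f) {w : α → ℝ} (hw : Measurable w) (hpos : ∀ x, 0 < w x) :
    (∫⁻ x, f x ∂μ) ^ 2 ≤
      (∫⁻ x, ENNReal.ofReal (w x) * f x ^ 2 ∂μ) * ∫⁻ x, ENNReal.ofReal (w x)⁻¹ ∂μ := by
  have hs : ∀ x, 0 < Real.sqrt (w x) := fun x => Real.sqrt_pos.2 (hpos x)
  have h := ENNReal.lintegral_mul_le_Lp_mul_Lq μ Real.HolderConjugate.two_two
    (f := fun x => ENNReal.ofReal (Real.sqrt (w x)) * f x)
    (g := fun x => ENNReal.ofReal (Real.sqrt (w x))⁻¹) (by fun_prop) (by fun_prop)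
  have h1 : ∀ x, ((fun x => ENNReal.ofReal (Real.sqrt (w x)) * f x) *
      fun x => ENNReal.ofReal (Real.sqrt (w x))⁻¹) x = f x := by
    intro x
    simp only [Pi.mul_apply]
    rw [mul_right_comm, ← ENNReal.ofReal_mul (hs x).le, mul_inv_cancel₀ (hs x).ne']
    simp
  simp_rw [h1] at h
  have h2 : ∀ x, (ENNReal.ofReal (Real.sqrt (w x)) * f x) ^ (2 : ℝ) =
      ENNReal.ofReal (w x) * f x ^ 2 := by
    intro x
    rw [show (2 : ℝ) = ((2 : ℕ) : ℝ) by norm_num, ENNReal.rpow_natCast, mul_pow,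
      ← ENNReal.ofReal_pow (hs x).le, Real.sq_sqrt (hpos x).le]
  have h3 : ∀ x, (ENNReal.ofReal (Real.sqrt (w x))⁻¹) ^ (2 : ℝ) = ENNReal.ofReal (w x)⁻¹ := by
    intro x
    rw [show (2 : ℝ) = ((2 : ℕ) : ℝ) by norm_num, ENNReal.rpow_natCast,
      ← ENNReal.ofReal_pow (inv_nonneg.2 (hs x).le), inv_pow, Real.sq_sqrt (hpos x).le]
  simp_rw [h2, h3] at h
  calc (∫⁻ x, f x ∂μ) ^ 2 ≤ _ := pow_le_pow_left₀ zero_le h 2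
    _ = _ := by
      rw [mul_pow, ← ENNReal.rpow_natCast, ← ENNReal.rpow_mul, ← ENNReal.rpow_natCast,
        ← ENNReal.rpow_mul]
      simp

end Weights

section Fibres

variable {k : ℕ}

theorem measurable_pt : Measurable fun q : X k × X k => pt q.1 q.2 :=
  WithLp.measurable_toLp 2 _

@[simp] theorem pt_fst (p τ : X k) : (pt p τ).fst = p := rfl

@[simp] theorem pt_snd (p τ : X k) : (pt p τ).snd = τ := rfl

theorem pt_eta (ξ : M k) : pt ξ.fst ξ.snd = ξ := rfl

theorem continuous_pt : Continuous fun q : X k × X k => pt q.1 q.2 :=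
  WithLp.prod_continuous_toLp 2 _ _

theorem measurable_fst_M : Measurable fun ξ : M k => ξ.fst :=
  measurable_fst.comp (WithLp.measurable_ofLp 2 (X k × X k))

theorem measurable_snd_M : Measurable fun ξ : M k => ξ.snd :=
  measurable_snd.comp (WithLp.measurable_ofLp 2 (X k × X k))

theorem norm_sq_M (ξ : M k) : ‖ξ‖ ^ 2 = ‖ξ.fst‖ ^ 2 + ‖ξ.snd‖ ^ 2 :=
  WithLp.prod_norm_sq_eq_of_L2 ξ

theorem lintegral_M {G : M k → ℝ≥0∞} (hG : Measurable G) :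
    ∫⁻ ξ, G ξ = ∫⁻ p : X k, ∫⁻ τ : X k, G (pt p τ) := by
  rw [← (WithLp.volume_preserving_toLp (X k) (X k)).lintegral_comp hG, Measure.volume_eq_prod,
    lintegral_prod (fun q : X k × X k => G (WithLp.toLp 2 q))
      (hG.comp (WithLp.measurable_toLp 2 _)).aemeasurable]
  rfl

theorem lintegral_M_symm {G : M k → ℝ≥0∞} (hG : Measurable G) :
    ∫⁻ ξ, G ξ = ∫⁻ τ : X k, ∫⁻ p : X k, G (pt p τ) := by
  rw [← (WithLp.volume_preserving_toLp (X k) (X k)).lintegral_comp hG, Measure.volume_eq_prod,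
    lintegral_prod_symm (fun q : X k × X k => G (WithLp.toLp 2 q))
      (hG.comp (WithLp.measurable_toLp 2 _)).aemeasurable]
  rfl

theorem integrable_pt_iff {F : Type*} [NormedAddCommGroup F] {f : M k → F} :
    Integrable (fun q : X k × X k => f (pt q.1 q.2)) (volume.prod volume) ↔ Integrable f :=
  (WithLp.volume_preserving_toLp (X k) (X k)).integrable_comp_emb
    (MeasurableEquiv.toLp 2 (X k × X k)).measurableEmbedding

theorem integral_pt {F : Type*} [NormedAddCommGroup F] [NormedSpace ℝ F] (f : M k → F) :
    ∫ q : X k × X k, f (pt q.1 q.2) ∂(volume.prod volume) = ∫ ξ, f ξ :=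
  (WithLp.volume_preserving_toLp (X k) (X k)).integral_comp
    (MeasurableEquiv.toLp 2 (X k × X k)).measurableEmbedding f

theorem integral_M {F : Type*} [NormedAddCommGroup F] [NormedSpace ℝ F] {f : M k → F}
    (hf : Integrable f) : ∫ ξ, f ξ = ∫ p : X k, ∫ τ : X k, f (pt p τ) := by
  rw [← integral_pt, integral_prod _ (integrable_pt_iff.2 hf)]

theorem integral_M_symm {F : Type*} [NormedAddCommGroup F] [NormedSpace ℝ F] {f : M k → F}
    (hf : Integrable f) : ∫ ξ, f ξ = ∫ τ : X k, ∫ p : X k, f (pt p τ) := by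
  rw [← integral_pt, integral_prod_symm _ (integrable_pt_iff.2 hf)]

theorem one_add_norm_sq_pt (p τ : X k) : 1 + ‖pt p τ‖ ^ 2 = 1 + ‖p‖ ^ 2 + ‖τ‖ ^ 2 := by
  rw [norm_sq_M, pt_fst, pt_snd, add_assoc]

theorem lintegral_weight_fibre (r : ℝ) (p : X k) :
    ∫⁻ τ : X k, ENNReal.ofReal ((1 + ‖pt p τ‖ ^ 2) ^ r) =
      ENNReal.ofReal ((1 + ‖p‖ ^ 2) ^ (k / 2 + r)) * bracketConst (X k) (-r) := by
  have := lintegral_bracket (E := X k) (a := 1 + ‖p‖ ^ 2) (by positivity) (-r)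
  simp only [neg_neg, finrank_euclideanSpace, Fintype.card_fin, sub_neg_eq_add] at this
  simp_rw [one_add_norm_sq_pt]
  exact this

theorem norm_pt_comm (p τ : X k) : ‖pt p τ‖ = ‖pt τ p‖ := by
  rw [← sq_eq_sq₀ (norm_nonneg _) (norm_nonneg _), norm_sq_M, norm_sq_M]
  simp [add_comm]

/-- Integrating out `τ` turns the weight of order `r` on `M` into the weight of order `r + k/2` on
`X`. -/
theorem lintegral_weightMeasure_fst (r s : ℝ) (hs : s = k / 2 + r) {G : X k → ℝ≥0∞}
    (hG : Measurable G) :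
    ∫⁻ ξ, G ξ.fst ∂(weightMeasure (M k) r) =
      bracketConst (X k) (-r) * ∫⁻ p, G p ∂(weightMeasure (X k) s) := by
  have hm := measurable_fst_M (k := k)
  rw [lintegral_weightMeasure r (G := fun ξ : M k => G ξ.fst) (hG.comp hm), lintegral_M (by fun_prop),
    lintegral_weightMeasure s hG, ← lintegral_const_mul _ (by fun_prop)]
  refine lintegral_congr fun p => ?_
  have : Measurable fun τ : X k => ENNReal.ofReal ((1 + ‖pt p τ‖ ^ 2) ^ r) := by
    simp_rw [one_add_norm_sq_pt]; fun_prop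
  simp only [pt_fst]
  rw [lintegral_mul_const _ this, lintegral_weight_fibre, hs]
  ring

theorem lintegral_weightMeasure_snd (r s : ℝ) (hs : s = k / 2 + r) {G : X k → ℝ≥0∞}
    (hG : Measurable G) :
    ∫⁻ ξ, G ξ.snd ∂(weightMeasure (M k) r) =
      bracketConst (X k) (-r) * ∫⁻ p, G p ∂(weightMeasure (X k) s) := by
  have hm := measurable_snd_M (k := k)
  rw [lintegral_weightMeasure r (G := fun ξ : M k => G ξ.snd) (hG.comp hm), lintegral_M_symm (by fun_prop),
    lintegral_weightMeasure s hG, ← lintegral_const_mul _ (by fun_prop)]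
  refine lintegral_congr fun p => ?_
  simp_rw [norm_pt_comm _ p]
  have : Measurable fun τ : X k => ENNReal.ofReal ((1 + ‖pt p τ‖ ^ 2) ^ r) := by
    simp_rw [one_add_norm_sq_pt]; fun_prop
  simp only [pt_snd]
  rw [lintegral_mul_const _ this, lintegral_weight_fibre, hs]
  ring

theorem bracketConst_X_lt_top {e : ℝ} (he : (k : ℝ) / 2 < e) : bracketConst (X k) e < ⊤ :=
  bracketConst_lt_top (by simpa using he)

theorem sq_lintegral_fibre_le {r σ : ℝ} (hσ : σ = r - k / 2) {w : M k → ℝ≥0∞}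
    (hw : Measurable w) (p : X k) :
    ENNReal.ofReal ((1 + ‖p‖ ^ 2) ^ σ) * (∫⁻ τ, w (pt p τ)) ^ 2 ≤
      bracketConst (X k) r * ∫⁻ τ, ENNReal.ofReal ((1 + ‖pt p τ‖ ^ 2) ^ r) * w (pt p τ) ^ 2 := by
  have hpt : Measurable fun τ => pt p τ := measurable_pt.comp measurable_prodMk_left
  have h := sq_lintegral_le_weighted (μ := volume) (hw.comp hpt)
    (w := fun τ => (1 + ‖pt p τ‖ ^ 2) ^ r) (by fun_prop) (fun τ => by positivity)
  have h1 : ∀ τ, ((1 + ‖pt p τ‖ ^ 2) ^ r)⁻¹ = (1 + ‖pt p τ‖ ^ 2) ^ (-r) := fun τ =>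
    (Real.rpow_neg (by positivity) r).symm
  simp_rw [h1] at h
  rw [lintegral_weight_fibre, neg_neg] at h
  refine (mul_le_mul_right h _).trans (le_of_eq ?_)
  have h2 : ENNReal.ofReal ((1 + ‖p‖ ^ 2) ^ σ) * ENNReal.ofReal ((1 + ‖p‖ ^ 2) ^ ((k : ℝ) / 2 + -r))
      = 1 := by
    rw [← ENNReal.ofReal_mul (by positivity), ← Real.rpow_add (by positivity), hσ]
    ring_nf
    simp
  calc _ = (ENNReal.ofReal ((1 + ‖p‖ ^ 2) ^ σ) *
        ENNReal.ofReal ((1 + ‖p‖ ^ 2) ^ ((k : ℝ) / 2 + -r))) * (bracketConst (X k) r *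
        ∫⁻ τ, ENNReal.ofReal ((1 + ‖pt p τ‖ ^ 2) ^ r) * w (pt p τ) ^ 2) := by
        simp only [Function.comp_apply]
        ring
    _ = _ := by rw [h2, one_mul]

end Fibres

/-! ### The elementary operators in dual coordinates -/

section Operators

variable {E : Type*} [NormedAddCommGroup E] [InnerProductSpace ℝ E] [FiniteDimensional ℝ E]
  [MeasurableSpace E] [BorelSpace E]

theorem volume_absolutelyContinuous_weightMeasure (s : ℝ) :
    (volume : Measure E) ≪ weightMeasure E s :=
  Measure.ae_le_iff_absolutelyContinuous.1 fun _ h => (ae_weightMeasure_iff s _).1 h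

theorem DualSobolev.measurable {s : ℝ} (f : DualSobolev E s) : Measurable f :=
  (Lp.stronglyMeasurable f).measurable

theorem integrable_weight_mul_sq {s : ℝ} {f : E → ℂ} (hf : MemLp f 2 (weightMeasure E s)) :
    Integrable fun p => (1 + ‖p‖ ^ 2) ^ s * ‖f p‖ ^ 2 := by
  have h := hf.integrable_norm_pow (p := 2) (by norm_num)
  rw [weightMeasure, integrable_withDensity_iff_integrable_smul' (measurable_weight E s)
    (Filter.Eventually.of_forall fun _ => ENNReal.ofReal_lt_top)] at h
  refine h.congr (Filter.Eventually.of_forall fun p => ?_)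
  simp only [ENNReal.toReal_ofReal (weight_pos E s p).le, smul_eq_mul]

/-- The spaces `H̃^r` and `H̃^{-r}` are in duality. -/
theorem integrable_mul_of_memLp_weight {r : ℝ} {f g : E → ℂ}
    (hf : MemLp f 2 (weightMeasure E r)) (hg : MemLp g 2 (weightMeasure E (-r))) :
    Integrable fun p => f p * g p := by
  refine ((integrable_weight_mul_sq hf).add (integrable_weight_mul_sq hg)).mono' ?_ ?_
  · exact (hf.1.mono_ac (volume_absolutelyContinuous_weightMeasure r)).mul
      (hg.1.mono_ac (volume_absolutelyContinuous_weightMeasure (-r)))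
  · refine Filter.Eventually.of_forall fun p => ?_
    have hw : 0 < (1 + ‖p‖ ^ 2) ^ (r / 2) := by positivity
    have h1 : (1 + ‖p‖ ^ 2) ^ r = ((1 + ‖p‖ ^ 2) ^ (r / 2)) ^ 2 := by
      rw [← Real.rpow_natCast ((1 + ‖p‖ ^ 2) ^ (r / 2)), ← Real.rpow_mul (by positivity)]
      congr 1
      push_cast
      ring
    simp only [Pi.add_apply]
    rw [norm_mul, Real.rpow_neg (by positivity), h1]
    set u := (1 + ‖p‖ ^ 2) ^ (r / 2)
    have h2 : ‖f p‖ * ‖g p‖ = (u * ‖f p‖) * (u⁻¹ * ‖g p‖) := by field_simp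
    rw [h2, ← inv_pow, ← mul_pow, ← mul_pow]
    nlinarith [sq_nonneg (u * ‖f p‖ - u⁻¹ * ‖g p‖), sq_nonneg (u * ‖f p‖),
      sq_nonneg (u⁻¹ * ‖g p‖)]

end Operators

section Fibres

variable {k : ℕ}

theorem ae_pt_of_ae {P : M k → Prop} (h : ∀ᵐ ξ : M k, P ξ) :
    ∀ᵐ p : X k, ∀ᵐ τ : X k, P (pt p τ) :=
  Measure.ae_ae_of_ae_prod
    ((WithLp.volume_preserving_toLp (X k) (X k)).quasiMeasurePreserving.ae h)

theorem ae_fst_of_ae {P : X k → Prop} (h : ∀ᵐ p : X k, P p) : ∀ᵐ ξ : M k, P ξ.fst := by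
  have h1 : ∀ᵐ q : X k × X k ∂(volume.prod volume), P q.1 :=
    Measure.quasiMeasurePreserving_fst.ae h
  exact (WithLp.volume_preserving_ofLp (X k) (X k)).quasiMeasurePreserving.ae h1

/-- The coboundary operator in dual coordinates, up to the value of the constant `c`. -/
theorem exists_pullbackOperator {s r : ℝ} (hr : r = s - k / 2) (hs : s < 0) (c : ℂ) :
    ∃ C : DualSobolev (X k) s →L[ℂ] DualSobolev (M k) r,
      ∀ f, ∀ᵐ ξ : M k, C f ξ = c * f ξ.fst := by
  have hD : bracketConst (X k) (-r) < ⊤ := bracketConst_X_lt_top (by linarith)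
  obtain ⟨C, hC⟩ := exists_weightedCompOperator (μ := weightMeasure (X k) s)
    (ν := weightMeasure (M k) r) measurable_fst_M (κ := fun _ => c) measurable_const
    (‖c‖ₑ ^ 2 * bracketConst (X k) (-r)) (ENNReal.mul_ne_top (by simp) hD.ne) (by
      intro G hG
      have hGm : Measurable fun ξ : M k => G ξ.fst := hG.comp measurable_fst_M
      rw [lintegral_const_mul _ hGm,
        lintegral_weightMeasure_fst r s (by linarith) hG, mul_assoc])
  exact ⟨C, fun f => (ae_weightMeasure_iff r _).1 (hC f)⟩

/-- The Cauchy–Schwarz inequality on each fibre `{p} × X`, integrated over `p`. -/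
theorem lintegral_fibre_le {r : ℝ} (w : DualSobolev (M k) r) :
    ∫⁻ p : X k, ENNReal.ofReal ((1 + ‖p‖ ^ 2) ^ (r - k / 2)) * (∫⁻ τ, ‖w (pt p τ)‖ₑ) ^ 2 ≤
      bracketConst (X k) r * ∫⁻ ξ, ‖w ξ‖ₑ ^ 2 ∂(weightMeasure (M k) r) := by
  have hw := w.measurable
  have hpt := measurable_pt (k := k)
  have hmeas : Measurable fun ξ : M k => ENNReal.ofReal ((1 + ‖ξ‖ ^ 2) ^ r) * ‖w ξ‖ₑ ^ 2 := by
    fun_prop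
  rw [lintegral_weightMeasure _ (by fun_prop), lintegral_M hmeas, ← lintegral_const_mul]
  · exact lintegral_mono fun p => sq_lintegral_fibre_le rfl (w := fun ξ => ‖w ξ‖ₑ) (by fun_prop) p
  · exact Measurable.lintegral_prod_right' (hmeas.comp hpt)

theorem ae_integrable_fibre {r : ℝ} (hr : k / 2 < r) (w : DualSobolev (M k) r) :
    ∀ᵐ p : X k, Integrable fun τ : X k => w (pt p τ) := by
  have hw := w.measurable
  have hpt := measurable_pt (k := k)
  have hD : bracketConst (X k) r < ⊤ := bracketConst_X_lt_top hr
  have h := (lintegral_fibre_le w).trans_lt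
    (ENNReal.mul_lt_top hD ((memLp_two_iff_lintegral (Lp.aestronglyMeasurable w)).1 (Lp.memLp w)))
  have hin : Measurable fun p : X k => ∫⁻ τ, ‖w (pt p τ)‖ₑ :=
    Measurable.lintegral_prod_right' (f := fun q : X k × X k => ‖w (pt q.1 q.2)‖ₑ) (by fun_prop)
  filter_upwards [ae_lt_top (by fun_prop) h.ne] with p hp
  refine ⟨(hw.comp (hpt.comp measurable_prodMk_left)).aestronglyMeasurable, ?_⟩
  by_contra hcon
  rw [HasFiniteIntegral, not_lt_top_iff] at hcon
  rw [hcon, ENNReal.top_pow (by norm_num), ENNReal.mul_top] at hp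
  · exact lt_irrefl _ hp
  · simp [weight_pos (X k) _ p]

/-- The boundary operator in dual coordinates, up to a constant factor. -/
theorem exists_fibreIntegralOperator {r σ : ℝ} (hσ : σ = r - k / 2) (hr : k / 2 < r) :
    ∃ B : DualSobolev (M k) r →L[ℂ] DualSobolev (X k) σ,
      ∀ w, ∀ᵐ p : X k, B w p = ∫ τ, w (pt p τ) := by
  subst hσ
  have hD : bracketConst (X k) r < ⊤ := bracketConst_X_lt_top hr
  have hpt := measurable_pt (k := k)
  have hae : ∀ f g : M k → ℂ, f =ᵐ[weightMeasure (M k) r] g →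
      ∀ᵐ p : X k, ∀ᵐ τ : X k, f (pt p τ) = g (pt p τ) := fun f g h =>
    ae_pt_of_ae ((ae_weightMeasure_iff r _).1 h)
  have hsm : ∀ w : DualSobolev (M k) r, StronglyMeasurable fun p : X k => ∫ τ, w (pt p τ) :=
    fun w => StronglyMeasurable.integral_prod_right'
      (f := fun q : X k × X k => w (pt q.1 q.2)) (w.measurable.comp hpt).stronglyMeasurable
  obtain ⟨B, hB⟩ := exists_operator_of_bound (μ := weightMeasure (M k) r)
    (ν := weightMeasure (X k) (r - k / 2)) (fun w p => ∫ τ, w (pt p τ))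
    (bracketConst (X k) r) hD.ne (fun w => (hsm w).aestronglyMeasurable) (by
      intro f g
      refine (ae_weightMeasure_iff _ _).2 ?_
      filter_upwards [hae _ _ (Lp.coeFn_add f g), ae_integrable_fibre hr f,
        ae_integrable_fibre hr g] with p h1 h2 h3
      rw [Pi.add_apply, ← integral_add h2 h3]
      exact integral_congr_ae h1) (by
      intro c f
      refine (ae_weightMeasure_iff _ _).2 ?_
      filter_upwards [hae _ _ (Lp.coeFn_smul c f)] with p h1
      rw [Pi.smul_apply, ← integral_smul]
      exact integral_congr_ae h1) (by
      intro w
      have := hsm w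
      rw [lintegral_weightMeasure _ (this.measurable.enorm.pow_const 2)]
      refine le_trans (lintegral_mono fun p => ?_) (lintegral_fibre_le w)
      gcongr
      exact enorm_integral_le_lintegral_enorm _)
  exact ⟨B, fun w => (ae_weightMeasure_iff _ _).1 (hB w)⟩

/-- The first factor, `f ↦ K(p, p') f(p')`, of an integral operator on `X`; the second factor is the
integration over the fibres `p = const`. The variable `p'` is the second coordinate on `M`. -/
theorem exists_kernelMulOperator {s r m : ℝ} (hr : r = s - m - k / 2) (hs : s < 0)
    {K : X k → X k → ℂ} (hK : Measurable (Function.uncurry K)) (C : ℝ)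
    (hC : ∀ p p', ‖K p p'‖ ≤ C * (1 + ‖pt p p'‖ ^ 2) ^ (m / 2)) :
    ∃ W : DualSobolev (X k) s →L[ℂ] DualSobolev (M k) r,
      ∀ f, ∀ᵐ ξ : M k, W f ξ = K ξ.fst ξ.snd * f ξ.snd := by
  have hD : bracketConst (X k) (-(s - k / 2)) < ⊤ := bracketConst_X_lt_top (by linarith)
  have hκ : Measurable fun ξ : M k => K ξ.fst ξ.snd :=
    hK.comp (measurable_fst_M.prodMk measurable_snd_M)
  have hC0 : 0 ≤ C := by
    have := (norm_nonneg _).trans (hC 0 0)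
    exact nonneg_of_mul_nonneg_left this (by positivity)
  have hm2 := measurable_snd_M (k := k)
  obtain ⟨W, hW⟩ := exists_weightedCompOperator (μ := weightMeasure (X k) s)
    (ν := weightMeasure (M k) r) measurable_snd_M hκ
    (ENNReal.ofReal (C ^ 2) * bracketConst (X k) (-(s - k / 2)))
    (ENNReal.mul_ne_top (by simp) hD.ne) (by
      intro G hG
      have hGm : Measurable fun ξ : M k => G ξ.snd := hG.comp measurable_snd_M
      rw [mul_assoc, ← lintegral_weightMeasure_snd (s - k / 2) s (by linarith) hG,
        lintegral_weightMeasure _ (by fun_prop), lintegral_weightMeasure _ hGm,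
        ← lintegral_const_mul _ (by fun_prop)]
      refine lintegral_mono fun ξ => ?_
      rw [← mul_assoc, ← mul_assoc]
      refine mul_le_mul_left ?_ _
      rw [← ofReal_norm, ← ENNReal.ofReal_pow (norm_nonneg _),
        ← ENNReal.ofReal_mul (by positivity), ← ENNReal.ofReal_mul (by positivity)]
      refine ENNReal.ofReal_le_ofReal ?_
      calc (1 + ‖ξ‖ ^ 2) ^ r * ‖K ξ.fst ξ.snd‖ ^ 2
          ≤ (1 + ‖ξ‖ ^ 2) ^ r * (C * (1 + ‖ξ‖ ^ 2) ^ (m / 2)) ^ 2 := by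
            gcongr
            exact hC _ _
        _ = C ^ 2 * ((1 + ‖ξ‖ ^ 2) ^ r * (1 + ‖ξ‖ ^ 2) ^ m) := by
            rw [mul_pow, ← Real.rpow_natCast ((1 + ‖ξ‖ ^ 2) ^ (m / 2)),
              ← Real.rpow_mul (by positivity)]
            push_cast
            ring_nf
        _ = _ := by
            rw [← Real.rpow_add (by positivity), hr]
            ring_nf)
  exact ⟨W, fun f => (ae_weightMeasure_iff r _).1 (hW f)⟩

/-- A kernel of size `(1 + |p|² + |p'|²)^{m/2}` defines a bounded operator `H̃^s → H̃^{s-m-k}`, if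
`s < 0` and `s - m - k > 0`. -/
theorem exists_kernelOperator {s σ m : ℝ} (hσ : σ = s - m - k) (hs : s < 0) (hσ0 : 0 < σ)
    {K : X k → X k → ℂ} (hK : Measurable (Function.uncurry K)) (C : ℝ)
    (hC : ∀ p p', ‖K p p'‖ ≤ C * (1 + ‖pt p p'‖ ^ 2) ^ (m / 2)) :
    ∃ A : DualSobolev (X k) s →L[ℂ] DualSobolev (X k) σ, IsIntegralOperator K A := by
  have hk : (0 : ℝ) ≤ k := Nat.cast_nonneg k
  obtain ⟨W, hW⟩ := exists_kernelMulOperator (k := k) (r := s - m - k / 2) rfl hs hK C hC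
  have hr : (k : ℝ) / 2 < s - m - k / 2 := by linarith
  obtain ⟨B, hB⟩ := exists_fibreIntegralOperator (k := k) (r := s - m - k / 2) (σ := σ)
    (by rw [hσ]; ring) hr
  refine ⟨B ∘L W, fun f => ?_⟩
  filter_upwards [ae_pt_of_ae (hW f), hB (W f), ae_integrable_fibre hr (W f)] with p h2 h3 h4
  refine ⟨h4.congr h2, ?_⟩
  rw [ContinuousLinearMap.comp_apply, h3]
  exact integral_congr_ae h2

theorem memLp_comp_fst {r : ℝ} (hr : k / 2 < r) {g : X k → ℂ} (hg : Measurable g)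
    (hgL : MemLp g 2 (weightMeasure (X k) (k / 2 - r))) :
    MemLp (fun ξ : M k => g ξ.fst) 2 (weightMeasure (M k) (-r)) := by
  have hgm : Measurable fun ξ : M k => g ξ.fst := hg.comp measurable_fst_M
  rw [memLp_two_iff_lintegral hgm.aestronglyMeasurable,
    lintegral_weightMeasure_fst (-r) (k / 2 - r) (by ring) (G := fun p => ‖g p‖ₑ ^ 2)
    (by fun_prop), neg_neg]
  exact ENNReal.mul_lt_top (bracketConst_X_lt_top hr)
    ((memLp_two_iff_lintegral hg.aestronglyMeasurable).1 hgL)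

/-- Fubini's theorem for an element of `H̃^r(M)` paired with a function of `p`. -/
theorem integral_mul_fibreIntegral {r : ℝ} (hr : k / 2 < r) (w : DualSobolev (M k) r)
    {g : X k → ℂ} (hg : Measurable g) (hgL : MemLp g 2 (weightMeasure (X k) (k / 2 - r))) :
    Integrable (fun ξ : M k => g ξ.fst * w ξ) ∧
      ∫ p, g p * ∫ τ, w (pt p τ) = ∫ ξ : M k, g ξ.fst * w ξ := by
  have hint : Integrable (fun ξ : M k => g ξ.fst * w ξ) :=
    (integrable_mul_of_memLp_weight (Lp.memLp w) (memLp_comp_fst hr hg hgL)).congr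
      (Filter.Eventually.of_forall fun ξ => mul_comm _ _)
  refine ⟨hint, ?_⟩
  rw [integral_M hint]
  simp_rw [pt_fst, integral_const_mul]

end Fibres

theorem ofReal_norm_sq_Lp {α : Type*} [MeasurableSpace α] {μ : Measure α} (f : Lp ℂ 2 μ) :
    ENNReal.ofReal (‖f‖ ^ 2) = ∫⁻ x, ‖f x‖ₑ ^ 2 ∂μ := by
  rw [← eLpNorm_two_sq, ENNReal.ofReal_pow (norm_nonneg _), Lp.norm_def,
    ENNReal.ofReal_toReal (Lp.eLpNorm_ne_top f)]

/-! ### Hilbert–Schmidt kernels on weighted spaces -/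

section HilbertSchmidt

variable {E : Type*} [NormedAddCommGroup E] [InnerProductSpace ℝ E] [FiniteDimensional ℝ E]
  [MeasurableSpace E] [BorelSpace E]

/-- Bessel's inequality for the functionals `f ↦ ∫ κ f`: in the weighted space such a functional is
the inner product with `conj κ · (1 + |p'|²)^{-s}`. -/
theorem sum_sq_integral_le {s : ℝ} {n : ℕ} {e : Fin n → DualSobolev E s} (he : Orthonormal ℂ e)
    {κ : E → ℂ} (hκ : Measurable κ) :
    ∑ i, ‖∫ p', κ p' * e i p'‖ₑ ^ 2 ≤
      ∫⁻ p', ENNReal.ofReal ((1 + ‖p'‖ ^ 2) ^ (-s)) * ‖κ p'‖ₑ ^ 2 := by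
  rcases eq_or_ne (∫⁻ p', ENNReal.ofReal ((1 + ‖p'‖ ^ 2) ^ (-s)) * ‖κ p'‖ₑ ^ 2) ⊤ with htop | htop
  · rw [htop]; exact le_top
  set v : E → ℂ := fun p' => (starRingEnd ℂ) (κ p') * (((1 + ‖p'‖ ^ 2) ^ (-s) : ℝ) : ℂ) with hv
  have hvm : Measurable v := by
    refine Measurable.mul ?_ (by fun_prop)
    exact Complex.continuous_conj.measurable.comp hκ
  have hvn : ∫⁻ p', ‖v p'‖ₑ ^ 2 ∂(weightMeasure E s) =
      ∫⁻ p', ENNReal.ofReal ((1 + ‖p'‖ ^ 2) ^ (-s)) * ‖κ p'‖ₑ ^ 2 := by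
    rw [lintegral_weightMeasure _ (by fun_prop)]
    refine lintegral_congr fun p => ?_
    have hw := weight_pos E (-s) p
    have h1 : ‖v p‖ₑ = ‖κ p‖ₑ * ENNReal.ofReal ((1 + ‖p‖ ^ 2) ^ (-s)) := by
      rw [hv, enorm_mul]
      congr 1
      · rw [← ofReal_norm, ← ofReal_norm, Complex.norm_conj]
      · rw [← ofReal_norm, Complex.norm_real, Real.norm_of_nonneg hw.le]
    have h2 : ENNReal.ofReal ((1 + ‖p‖ ^ 2) ^ s) * ENNReal.ofReal ((1 + ‖p‖ ^ 2) ^ (-s)) = 1 := by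
      rw [← ENNReal.ofReal_mul (by positivity), ← Real.rpow_add (by positivity)]
      simp
    rw [h1]
    calc _ = (ENNReal.ofReal ((1 + ‖p‖ ^ 2) ^ s) * ENNReal.ofReal ((1 + ‖p‖ ^ 2) ^ (-s))) *
          (ENNReal.ofReal ((1 + ‖p‖ ^ 2) ^ (-s)) * ‖κ p‖ₑ ^ 2) := by ring
      _ = _ := by rw [h2, one_mul]
  have hmem : MemLp v 2 (weightMeasure E s) := by
    rw [memLp_two_iff_lintegral hvm.aestronglyMeasurable, hvn]
    exact htop.lt_top
  have hinner : ∀ i, ∫ p', κ p' * e i p' = inner ℂ (hmem.toLp v) (e i) := by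
    intro i
    rw [L2.inner_def]
    have h1 : ∫ p', inner ℂ (hmem.toLp v p') (e i p') ∂(weightMeasure E s) =
        ∫ p', inner ℂ (v p') (e i p') ∂(weightMeasure E s) :=
      integral_congr_ae (by filter_upwards [hmem.coeFn_toLp] with p hp; rw [hp])
    rw [h1, integral_weightMeasure]
    refine integral_congr_ae (Filter.Eventually.of_forall fun p => ?_)
    have hw : (((1 + ‖p‖ ^ 2) ^ s : ℝ) : ℂ) * (((1 + ‖p‖ ^ 2) ^ (-s) : ℝ) : ℂ) = 1 := by
      rw [← Complex.ofReal_mul, ← Real.rpow_add (by positivity)]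
      simp
    simp only [hv, RCLike.inner_apply, map_mul, Complex.conj_conj, Complex.conj_ofReal]
    calc κ p * e i p = 1 * (κ p * e i p) := (one_mul _).symm
      _ = _ := by rw [← hw]; ring
  rw [← hvn]
  have hn : ∫⁻ p', ‖v p'‖ₑ ^ 2 ∂(weightMeasure E s) = ENNReal.ofReal (‖hmem.toLp v‖ ^ 2) := by
    rw [ofReal_norm_sq_Lp]
    refine lintegral_congr_ae ?_
    filter_upwards [hmem.coeFn_toLp] with p hp
    rw [hp]
  rw [hn]
  have hb := he.sum_inner_products_le (x := hmem.toLp v) (s := Finset.univ)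
  refine le_trans (le_of_eq ?_) (ENNReal.ofReal_le_ofReal hb)
  rw [ENNReal.ofReal_sum_of_nonneg fun i _ => by positivity]
  refine Finset.sum_congr rfl fun i _ => ?_
  rw [hinner i, ENNReal.ofReal_pow (norm_nonneg _), ← ofReal_norm, norm_inner_symm]

theorem isCompactOperator_of_hilbertSchmidt {s σ : ℝ} {K : E → E → ℂ}
    (hK : Measurable (Function.uncurry K)) {R : DualSobolev E s →L[ℂ] DualSobolev E σ}
    (hR : IsIntegralOperator K R)
    (hfin : ∫⁻ p, ENNReal.ofReal ((1 + ‖p‖ ^ 2) ^ σ) *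
      ∫⁻ p', ENNReal.ofReal ((1 + ‖p'‖ ^ 2) ^ (-s)) * ‖K p p'‖ₑ ^ 2 < ⊤) :
    IsCompactOperator R := by
  refine isCompactOperator_of_sum_sq_le R (ENNReal.toReal _) fun n e he =>
    (ENNReal.ofReal_le_iff_le_toReal hfin.ne).1 ?_
  rw [ENNReal.ofReal_sum_of_nonneg fun i _ => by positivity]
  have hm : ∀ i, Measurable (R (e i)) := fun i => DualSobolev.measurable _
  simp_rw [ofReal_norm_sq_Lp]
  rw [← lintegral_finsetSum _ fun i _ => by have := hm i; fun_prop,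
    lintegral_weightMeasure _ (Finset.measurable_fun_sum _ fun i _ => by have := hm i; fun_prop)]
  refine lintegral_mono_ae ?_
  filter_upwards [ae_all_iff.2 fun i => hR (e i)] with p hp
  gcongr
  have hKp : Measurable (K p) := hK.comp measurable_prodMk_left
  refine le_trans (le_of_eq ?_) (sum_sq_integral_le he hKp)
  exact Finset.sum_congr rfl fun i _ => by rw [(hp i).2]

end HilbertSchmidt

section Truncated

variable {k : ℕ}

theorem lintegral_ball_weight_lt_top (e R : ℝ) :
    ∫⁻ p : X k, (Metric.closedBall (0 : X k) R).indicator
      (fun p => ENNReal.ofReal ((1 + ‖p‖ ^ 2) ^ e)) p < ⊤ := by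
  rw [lintegral_indicator measurableSet_closedBall]
  have hc : Continuous fun p : X k => (1 + ‖p‖ ^ 2) ^ e :=
    Continuous.rpow_const (by fun_prop) fun p => Or.inl (by positivity)
  exact (hc.continuousOn.integrableOn_compact (isCompact_closedBall (0 : X k) R)).lintegral_lt_top

/-- If a kernel of size `(1 + |p|² + |p'|²)^{m/2}` vanishes when `|p|` and `|p'|` are both large, then
its operator is compact: where one variable is bounded, the kernel is square integrable in the
other one with respect to the weights. -/
theorem isCompactOperator_of_truncated {s σ m : ℝ} (hσ : σ = s - m - k) (hs : s < 0)
    (hσ0 : 0 < σ) {K : X k → X k → ℂ} (hK : Measurable (Function.uncurry K)) {C : ℝ}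
    (hC : ∀ p p', ‖K p p'‖ ≤ C * (1 + ‖pt p p'‖ ^ 2) ^ (m / 2)) {ρ : ℝ}
    (hsupp : ∀ p p', ρ < ‖p‖ → ρ < ‖p'‖ → K p p' = 0)
    {R : DualSobolev (X k) s →L[ℂ] DualSobolev (X k) σ} (hR : IsIntegralOperator K R) :
    IsCompactOperator R := by
  have hk : (0 : ℝ) ≤ k := Nat.cast_nonneg k
  have hm : m < 0 := by linarith
  have hC0 : 0 ≤ C := by
    have := (norm_nonneg _).trans (hC 0 0)
    exact nonneg_of_mul_nonneg_left this (by positivity)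
  refine isCompactOperator_of_hilbertSchmidt hK hR ?_
  set W : ℝ → X k → ℝ≥0∞ := fun e p => ENNReal.ofReal ((1 + ‖p‖ ^ 2) ^ e) with hW
  have hWm : ∀ e, Measurable (W e) := fun e => measurable_weight (X k) e
  set χ : ℝ → X k → ℝ≥0∞ := fun e => (Metric.closedBall (0 : X k) ρ).indicator (W e) with hχ
  have hχm : ∀ e, Measurable (χ e) := fun e => (hWm e).indicator measurableSet_closedBall
  have hWadd : ∀ a b p, W a p * W b p = W (a + b) p := fun a b p => by
    rw [hW]
    simp only
    rw [← ENNReal.ofReal_mul (by positivity), ← Real.rpow_add (by positivity)]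
  have hKsq : ∀ p p', ‖K p p'‖ₑ ^ 2 ≤ ENNReal.ofReal (C ^ 2) * W m p ∧
      ‖K p p'‖ₑ ^ 2 ≤ ENNReal.ofReal (C ^ 2) * W m p' := by
    intro p p'
    have h1 : ‖K p p'‖ₑ ^ 2 ≤ ENNReal.ofReal (C ^ 2 * (1 + ‖pt p p'‖ ^ 2) ^ m) := by
      rw [← ofReal_norm, ← ENNReal.ofReal_pow (norm_nonneg _)]
      refine ENNReal.ofReal_le_ofReal ?_
      calc ‖K p p'‖ ^ 2 ≤ (C * (1 + ‖pt p p'‖ ^ 2) ^ (m / 2)) ^ 2 := by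
            gcongr
            exact hC p p'
        _ = _ := by
            rw [mul_pow, ← Real.rpow_natCast ((1 + ‖pt p p'‖ ^ 2) ^ (m / 2)),
              ← Real.rpow_mul (by positivity)]
            push_cast
            ring_nf
    rw [one_add_norm_sq_pt] at h1
    constructor <;> refine h1.trans ?_ <;> rw [ENNReal.ofReal_mul (by positivity)] <;>
      refine mul_le_mul_right (ENNReal.ofReal_le_ofReal ?_) _ <;>
      refine Real.rpow_le_rpow_of_nonpos (by positivity) ?_ hm.le <;> nlinarith [sq_nonneg ‖p‖, sq_nonneg ‖p'‖]
  have hpt : ∀ p p', W σ p * (W (-s) p' * ‖K p p'‖ₑ ^ 2) ≤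
      ENNReal.ofReal (C ^ 2) * (χ σ p * W (m - s) p' + W (σ + m) p * χ (-s) p') := by
    intro p p'
    by_cases hp : ‖p‖ ≤ ρ
    · have h1 : χ σ p = W σ p := Set.indicator_of_mem (by simpa using hp) _
      calc _ ≤ W σ p * (W (-s) p' * (ENNReal.ofReal (C ^ 2) * W m p')) := by
            gcongr
            exact (hKsq p p').2
        _ = ENNReal.ofReal (C ^ 2) * (W σ p * (W m p' * W (-s) p')) := by ring
        _ = ENNReal.ofReal (C ^ 2) * (χ σ p * W (m - s) p') := by
            rw [hWadd, h1, sub_eq_add_neg]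
        _ ≤ _ := by gcongr; exact le_self_add
    by_cases hp' : ‖p'‖ ≤ ρ
    · have h1 : χ (-s) p' = W (-s) p' := Set.indicator_of_mem (by simpa using hp') _
      calc _ ≤ W σ p * (W (-s) p' * (ENNReal.ofReal (C ^ 2) * W m p)) := by
            gcongr
            exact (hKsq p p').1
        _ = ENNReal.ofReal (C ^ 2) * ((W σ p * W m p) * W (-s) p') := by ring
        _ = ENNReal.ofReal (C ^ 2) * (W (σ + m) p * χ (-s) p') := by rw [hWadd, h1]
        _ ≤ _ := by gcongr; exact le_add_self
    · rw [hsupp p p' (not_le.1 hp) (not_le.1 hp')]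
      simp
  have hI1 : ∫⁻ p', W (m - s) p' < ⊤ := by
    have := bracketConst_X_lt_top (k := k) (e := s - m) (by linarith)
    rwa [bracketConst, neg_sub] at this
  have hI2 : ∫⁻ p, W (σ + m) p < ⊤ := by
    have := bracketConst_X_lt_top (k := k) (e := k - s) (by linarith)
    rwa [bracketConst, show -((k : ℝ) - s) = σ + m by rw [hσ]; ring] at this
  have hI3 : ∀ e, ∫⁻ p, χ e p < ⊤ := fun e => lintegral_ball_weight_lt_top e ρ
  have hinner : ∀ p, W σ p * ∫⁻ p', W (-s) p' * ‖K p p'‖ₑ ^ 2 ≤ ENNReal.ofReal (C ^ 2) *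
      (χ σ p * ∫⁻ p', W (m - s) p') +
      ENNReal.ofReal (C ^ 2) * (W (σ + m) p * ∫⁻ p', χ (-s) p') := by
    intro p
    have hKp : Measurable (K p) := hK.comp measurable_prodMk_left
    have hw1 := hWm (-s)
    have hw2 := hWm (m - s)
    have hx := hχm (-s)
    rw [← lintegral_const_mul _ (by fun_prop)]
    refine (lintegral_mono (hpt p)).trans (le_of_eq ?_)
    rw [lintegral_const_mul _ (by fun_prop), lintegral_add_left (by fun_prop),
      lintegral_const_mul _ hw2, lintegral_const_mul _ hx, mul_add]
  refine (lintegral_mono hinner).trans_lt ?_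
  have hw3 := hWm (σ + m)
  have hx := hχm σ
  rw [lintegral_add_left (by fun_prop), lintegral_const_mul _ (by fun_prop),
    lintegral_const_mul _ (by fun_prop), lintegral_mul_const _ hx, lintegral_mul_const _ hw3]
  exact ENNReal.add_lt_top.2 ⟨ENNReal.mul_lt_top ENNReal.ofReal_lt_top
    (ENNReal.mul_lt_top (hI3 _) hI1), ENNReal.mul_lt_top ENNReal.ofReal_lt_top
    (ENNReal.mul_lt_top hI2 (hI3 _))⟩

end Truncated

/-! ### The Fourier transform, restriction to `X`, and the uniqueness of the factors -/

section Fourier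

variable {E : Type*} [NormedAddCommGroup E] [InnerProductSpace ℝ E] [FiniteDimensional ℝ E]
  [MeasurableSpace E] [BorelSpace E]

variable (E) in
/-- The normalizing factor `(2π)^{-d/2}`, `d = dim E`. -/
noncomputable def fourierConst : ℂ := (((2 * Real.pi) ^ (-(Module.finrank ℝ E : ℝ) / 2) : ℝ) : ℂ)

theorem fourierSchwartzInv_apply (φ : 𝓢(E, ℂ)) (p : E) :
    fourierSchwartzInv E φ p =
      fourierConst E * ∫ x, Complex.exp (Complex.I * (inner ℝ x p : ℝ)) * φ x := by
  have hπ := Real.two_pi_pos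
  have hscale := Measure.integral_comp_smul (volume : Measure E)
    (fun x => Complex.exp (Complex.I * (inner ℝ x p : ℝ)) * φ x) (2 * Real.pi)
  have h1 : fourierSchwartzInv E φ p = (fourierConst E)⁻¹ *
      ∫ x, Complex.exp (Complex.I * (inner ℝ ((2 * Real.pi) • x) p : ℝ)) *
        φ ((2 * Real.pi) • x) := by
    simp only [fourierSchwartzInv, fourierConst, _root_.smul_apply,
      ContinuousLinearMap.comp_apply, smul_eq_mul]
    congr 1
    simp only [compCLMOfContinuousLinearEquiv_apply, Function.comp_apply, fourierInvCLM_apply,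
      fourierInv_coe, Real.fourierInv_eq]
    refine integral_congr_ae (Filter.Eventually.of_forall fun x => ?_)
    simp only [Circle.smul_def, Real.fourierChar_apply, smul_eq_mul]
    have h2 : ((ContinuousLinearEquiv.smulLeft (Units.mk0 (2 * Real.pi) Real.two_pi_pos.ne') :
        E ≃L[ℝ] E) x) = (2 * Real.pi) • x := rfl
    rw [h2, real_inner_smul_left]
    congr 2
    push_cast
    ring
  rw [h1, hscale, abs_of_pos (by positivity), Complex.real_smul, ← mul_assoc]
  congr 1
  rw [fourierConst, ← Complex.ofReal_inv, ← Complex.ofReal_mul]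
  congr 1
  rw [← Real.rpow_natCast, ← Real.rpow_neg hπ.le, ← Real.rpow_neg hπ.le, ← Real.rpow_add hπ]
  congr 1
  ring

/-- Fubini's theorem for an oscillating kernel `e^{iεB(v,w)}`; with `ε = ±1` it serves the Fourier
transform and its inverse alike. -/
theorem integral_exp_mul_swap {V W : Type*} [NormedAddCommGroup V] [InnerProductSpace ℝ V]
    [FiniteDimensional ℝ V] [MeasurableSpace V] [BorelSpace V] [NormedAddCommGroup W]
    [InnerProductSpace ℝ W] [FiniteDimensional ℝ W] [MeasurableSpace W] [BorelSpace W]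
    {B : V → W → ℝ} (hB : Continuous (Function.uncurry B)) {f : V → ℂ} {g : W → ℂ}
    (hf : Integrable f) (hg : Integrable g) (ε : ℝ) :
    ∫ w, (∫ v, Complex.exp (ε * (Complex.I * B v w)) * f v) * g w =
      ∫ v, f v * ∫ w, Complex.exp (ε * (Complex.I * B v w)) * g w := by
  have hint : Integrable (Function.uncurry fun (w : W) (v : V) =>
      Complex.exp (ε * (Complex.I * B v w)) * f v * g w) (volume.prod volume) := by
    have h1 : Integrable (fun q : W × V => g q.1 * f q.2) (volume.prod volume) := hg.mul_prod hf
    refine (h1.bdd_mul (c := 1) (f := fun q : W × V =>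
      Complex.exp (ε * (Complex.I * B q.2 q.1))) ?_ ?_).congr ?_
    · have : Continuous fun q : W × V => B q.2 q.1 := hB.comp continuous_swap
      exact Continuous.aestronglyMeasurable (by fun_prop)
    · refine Filter.Eventually.of_forall fun q => ?_
      rw [Complex.norm_exp]
      simp
    · refine Filter.Eventually.of_forall fun q => ?_
      simp only [Function.uncurry]
      ring
  calc _ = ∫ w, ∫ v, Complex.exp (ε * (Complex.I * B v w)) * f v * g w := by
        refine integral_congr_ae (Filter.Eventually.of_forall fun w => ?_)
        exact (integral_mul_const _ _).symm
    _ = ∫ v, ∫ w, Complex.exp (ε * (Complex.I * B v w)) * f v * g w := integral_integral_swap hint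
    _ = _ := by
        refine integral_congr_ae (Filter.Eventually.of_forall fun v => ?_)
        simp only
        rw [← integral_const_mul]
        refine integral_congr_ae (Filter.Eventually.of_forall fun w => ?_)
        simp only
        ring

theorem fourierSchwartz_eq (φ : 𝓢(E, ℂ)) (p : E) : fourierSchwartz E φ p =
    fourierConst E * ∫ x, Complex.exp ((-1 : ℝ) * (Complex.I * (inner ℝ x p : ℝ))) * φ x := by
  rw [fourierSchwartz_apply, fourierConst]
  simp

theorem fourierSchwartzInv_eq (φ : 𝓢(E, ℂ)) (p : E) : fourierSchwartzInv E φ p =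
    fourierConst E * ∫ x, Complex.exp ((1 : ℝ) * (Complex.I * (inner ℝ x p : ℝ))) * φ x := by
  rw [fourierSchwartzInv_apply]
  simp

/-- The transforms with the kernels `e^{iε⟨x,p⟩}` are symmetric for the bilinear pairing. -/
theorem integral_selfadjoint_aux (ε : ℝ) {T : 𝓢(E, ℂ) → 𝓢(E, ℂ)}
    (hT : ∀ φ p, T φ p =
      fourierConst E * ∫ x, Complex.exp (ε * (Complex.I * (inner ℝ x p : ℝ))) * φ x)
    (φ ψ : 𝓢(E, ℂ)) : ∫ p, T φ p * ψ p = ∫ p, φ p * T ψ p := by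
  have h := integral_exp_mul_swap (B := fun x p : E => inner ℝ x p)
    (by simp only [Function.uncurry_def]; fun_prop) (φ.integrable (μ := volume))
    (ψ.integrable (μ := volume)) ε
  simp_rw [hT]
  simp_rw [mul_assoc, integral_const_mul, mul_left_comm _ (fourierConst E), integral_const_mul]
  rw [h]
  simp_rw [real_inner_comm]

theorem integral_fourierSchwartz_mul (φ ψ : 𝓢(E, ℂ)) :
    ∫ p, fourierSchwartz E φ p * ψ p = ∫ p, φ p * fourierSchwartz E ψ p :=
  integral_selfadjoint_aux (-1) fourierSchwartz_eq φ ψ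

theorem integral_fourierSchwartzInv_mul (φ ψ : 𝓢(E, ℂ)) :
    ∫ p, fourierSchwartzInv E φ p * ψ p = ∫ p, φ p * fourierSchwartzInv E ψ p :=
  integral_selfadjoint_aux 1 fourierSchwartzInv_eq φ ψ

theorem Sobolev.dist_apply {s : ℝ} (u : Sobolev E s) (φ : 𝓢(E, ℂ)) :
    u.dist φ = ∫ p, fourierSchwartzInv E φ p * fourierIso E s u p := by
  rw [← toDist_apply, toDist_fourierIso]
  change u.dist φ = u.dist (fourierSchwartz E (fourierSchwartzInv E φ))
  rw [fourierSchwartz_fourierSchwartzInv]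

theorem Sobolev.dist_injective {s : ℝ} : Function.Injective (Sobolev.dist (E := E) (s := s)) :=
  Subtype.val_injective

theorem continuous_toDist_apply (s : ℝ) (φ : 𝓢(E, ℂ)) :
    Continuous fun f : DualSobolev E s => toDist E s f φ := by
  have h : ∀ f : DualSobolev E s, toDist E s f φ =
      Lp.toTemperedDistributionCLM ℂ (weightMeasure E s) 2 f (SchwartzMap.smulLeftCLM ℂ
        (fun p : E => (((1 + ‖p‖ ^ 2) ^ (-s) : ℝ) : ℂ)) φ) := fun f => rfl
  simp_rw [h]
  exact (PointwiseConvergenceCLM.evalCLM (RingHom.id ℂ) ℂ _).continuous.comp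
    (Lp.toTemperedDistributionCLM ℂ (weightMeasure E s) 2).continuous

theorem toTemperedDistribution_apply_eq (φ ψ : 𝓢(E, ℂ)) :
    toTemperedDistributionCLM E ℂ volume φ ψ = ∫ x, ψ x * φ x :=
  toTemperedDistributionCLM_apply_apply volume φ ψ

theorem denseRange_schwartz_toLp (s : ℝ) :
    DenseRange fun φ : 𝓢(E, ℂ) => (φ.toLp 2 (weightMeasure E s) : DualSobolev E s) :=
  denseRange_toLpCLM (F := ℂ) (by norm_num)

theorem coeFn_schwartz_toLp (s : ℝ) (φ : 𝓢(E, ℂ)) :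
    ∀ᵐ p : E, φ.toLp 2 (weightMeasure E s) p = φ p :=
  (ae_weightMeasure_iff s _).1 (φ.coeFn_toLp 2 (weightMeasure E s))

theorem fourierIso_of_dist_eq {s : ℝ} {u : Sobolev E s} {φ : 𝓢(E, ℂ)}
    (h : u.dist = toTemperedDistributionCLM E ℂ volume φ) :
    fourierIso E s u = (fourierSchwartz E φ).toLp 2 (weightMeasure E s) := by
  apply toDist_injective
  rw [toDist_fourierIso, h]
  ext ψ
  rw [toDist_apply]
  change toTemperedDistributionCLM E ℂ volume φ (fourierSchwartz E ψ) = _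
  rw [toTemperedDistribution_apply_eq]
  rw [integral_fourierSchwartz_mul]
  refine integral_congr_ae ?_
  filter_upwards [coeFn_schwartz_toLp s (fourierSchwartz E φ)] with p hp
  rw [hp]

theorem dist_fourierIso_symm_schwartz (s : ℝ) (χ : 𝓢(E, ℂ)) :
    ((fourierIso E s).symm (χ.toLp 2 (weightMeasure E s))).dist =
      toTemperedDistributionCLM E ℂ volume (fourierSchwartzInv E χ) := by
  ext φ
  rw [Sobolev.dist_apply, LinearIsometryEquiv.apply_symm_apply,
    toTemperedDistribution_apply_eq]
  rw [← integral_fourierSchwartzInv_mul]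
  refine integral_congr_ae ?_
  filter_upwards [coeFn_schwartz_toLp s χ] with p hp
  rw [hp]

/-- An operator between the dual spaces `H̃`, written in physical coordinates. -/
noncomputable def conjFourier {E' : Type*} [NormedAddCommGroup E'] [InnerProductSpace ℝ E']
    [FiniteDimensional ℝ E'] [MeasurableSpace E'] [BorelSpace E'] {s σ : ℝ}
    (R : DualSobolev E s →L[ℂ] DualSobolev E' σ) : Sobolev E s →L[ℂ] Sobolev E' σ :=
  ((fourierIso E' σ).symm.toContinuousLinearEquiv : DualSobolev E' σ →L[ℂ] Sobolev E' σ) ∘L R ∘L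
    ((fourierIso E s).toContinuousLinearEquiv : Sobolev E s →L[ℂ] DualSobolev E s)

theorem fourierIso_conjFourier {E' : Type*} [NormedAddCommGroup E'] [InnerProductSpace ℝ E']
    [FiniteDimensional ℝ E'] [MeasurableSpace E'] [BorelSpace E'] {s σ : ℝ}
    (R : DualSobolev E s →L[ℂ] DualSobolev E' σ) (u : Sobolev E s) :
    fourierIso E' σ (conjFourier R u) = R (fourierIso E s u) :=
  (fourierIso E' σ).apply_symm_apply _

end Fourier

section Restriction

variable {k : ℕ}

theorem finrank_M : Module.finrank ℝ (M k) = k + k := by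
  rw [(WithLp.linearEquiv 2 ℝ (X k × X k)).finrank_eq, Module.finrank_prod]
  simp

theorem fourierConst_X_sq : fourierConst (X k) * fourierConst (X k) = fourierConst (M k) := by
  rw [fourierConst, fourierConst, ← Complex.ofReal_mul, ← Real.rpow_add Real.two_pi_pos, finrank_M]
  congr 2
  simp

theorem inner_pt_zero (x : X k) (ξ : M k) : inner ℝ ξ (pt x 0) = inner ℝ x ξ.fst := by
  rw [real_inner_comm, WithLp.prod_inner_apply]
  simp [pt]

/-- Restriction to `X` becomes integration over the fibres `p = const` in dual coordinates. -/
theorem integral_fibre_aux (ε : ℝ) {T : 𝓢(X k, ℂ) → 𝓢(X k, ℂ)} {T' : 𝓢(M k, ℂ) → 𝓢(M k, ℂ)}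
    (hT : ∀ φ p, T φ p =
      fourierConst (X k) * ∫ x, Complex.exp (ε * (Complex.I * (inner ℝ x p : ℝ))) * φ x)
    (hT' : ∀ φ p, T' φ p =
      fourierConst (M k) * ∫ x, Complex.exp (ε * (Complex.I * (inner ℝ x p : ℝ))) * φ x)
    (θ : 𝓢(X k, ℂ)) (χ : 𝓢(M k, ℂ)) :
    ∫ ξ, T θ ξ.fst * (fourierConst (X k) * χ ξ) = ∫ x, θ x * T' χ (pt x 0) := by
  have hfst : Continuous fun ξ : M k => ξ.fst := continuous_fst.comp (WithLp.prod_continuous_ofLp 2 _ _)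
  have h := integral_exp_mul_swap (B := fun (x : X k) (ξ : M k) => inner ℝ x ξ.fst)
    (by simp only [Function.uncurry_def]; fun_prop) (θ.integrable (μ := volume))
    (χ.integrable (μ := volume)) ε
  simp_rw [hT, hT', ← fourierConst_X_sq, inner_pt_zero]
  have h1 : ∀ a b c : ℂ, a * b * (a * c) = a * a * (b * c) := fun a b c => by ring
  simp_rw [h1, mul_left_comm _ (fourierConst (X k) * fourierConst (X k)), integral_const_mul]
  rw [h]

theorem integral_fourierSchwartz_fst (θ : 𝓢(X k, ℂ)) (χ : 𝓢(M k, ℂ)) :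
    ∫ ξ : M k, fourierSchwartz (X k) θ ξ.fst * (fourierConst (X k) * χ ξ) =
      ∫ x, θ x * fourierSchwartz (M k) χ (pt x 0) :=
  integral_fibre_aux (-1) fourierSchwartz_eq fourierSchwartz_eq θ χ

theorem integral_fourierSchwartzInv_fst (θ : 𝓢(X k, ℂ)) (χ : 𝓢(M k, ℂ)) :
    ∫ ξ : M k, fourierSchwartzInv (X k) θ ξ.fst * (fourierConst (X k) * χ ξ) =
      ∫ x, θ x * fourierSchwartzInv (M k) χ (pt x 0) :=
  integral_fibre_aux 1 fourierSchwartzInv_eq fourierSchwartzInv_eq θ χ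

/-- Both sides of the defining identity are continuous in `F u`, so that it suffices to compare them
for `F u` in the dense set of Schwartz functions. -/
theorem isCoboundaryOperator_conjFourier {s r : ℝ}
    {C : DualSobolev (X k) s →L[ℂ] DualSobolev (M k) r}
    (hC : ∀ f, ∀ᵐ ξ : M k, C f ξ = fourierConst (X k) * f ξ.fst) :
    IsCoboundaryOperator (conjFourier C) := by
  intro u φ
  rw [Sobolev.dist_apply, Sobolev.dist_apply, fourierIso_conjFourier, ← toDist_apply,
    ← toDist_apply]
  refine congrFun ((denseRange_schwartz_toLp s).equalizer
    ((continuous_toDist_apply r _).comp C.continuous) (continuous_toDist_apply s _) ?_)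
    (fourierIso (X k) s u)
  funext θ
  simp only [Function.comp_apply]
  rw [toDist_apply, toDist_apply]
  have h1 : ∫ p, fourierSchwartzInv (M k) φ p * C (θ.toLp 2 (weightMeasure (X k) s)) p =
      ∫ ξ : M k, θ ξ.fst * (fourierConst (X k) * fourierSchwartzInv (M k) φ ξ) := by
    refine integral_congr_ae ?_
    filter_upwards [hC (θ.toLp 2 (weightMeasure (X k) s)),
      ae_fst_of_ae (coeFn_schwartz_toLp s θ)] with ξ h2 h3
    rw [h2, h3]
    ring
  have h2 : ∫ p, fourierSchwartzInv (X k) (restrictSchwartz k φ) p *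
      θ.toLp 2 (weightMeasure (X k) s) p =
      ∫ p, fourierSchwartzInv (X k) (restrictSchwartz k φ) p * θ p := by
    refine integral_congr_ae ?_
    filter_upwards [coeFn_schwartz_toLp s θ] with p h3
    rw [h3]
  have h3 := integral_fourierSchwartz_fst (fourierSchwartzInv (X k) θ) (fourierSchwartzInv (M k) φ)
  rw [fourierSchwartz_fourierSchwartzInv, fourierSchwartz_fourierSchwartzInv] at h3
  rw [h1, h2, h3, integral_fourierSchwartzInv_mul]
  refine integral_congr_ae (Filter.Eventually.of_forall fun x => ?_)
  simp only [restrictSchwartz_apply]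
  ring

theorem isBoundaryOperator_conjFourier {r σ : ℝ}
    {B : DualSobolev (M k) r →L[ℂ] DualSobolev (X k) σ}
    (hB : ∀ w, ∀ᵐ p : X k, B w p = fourierConst (X k) * ∫ τ, w (pt p τ)) :
    IsBoundaryOperator (conjFourier B) := by
  intro v φ hv
  ext θ
  rw [Sobolev.dist_apply, fourierIso_conjFourier, fourierIso_of_dist_eq hv,
    toTemperedDistribution_apply_eq]
  have hint : Integrable fun ξ : M k => fourierSchwartzInv (X k) θ ξ.fst *
      (fourierConst (X k) * fourierSchwartz (M k) φ ξ) := by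
    have hb : Continuous fun ξ : M k => fourierSchwartzInv (X k) θ ξ.fst :=
      (fourierSchwartzInv (X k) θ).continuous.comp
        (continuous_fst.comp (WithLp.prod_continuous_ofLp 2 _ _))
    refine (((fourierSchwartz (M k) φ).integrable (μ := volume)).const_mul _).bdd_mul
      (c := ‖(fourierSchwartzInv (X k) θ).toBoundedContinuousFunction‖) hb.aestronglyMeasurable ?_
    exact Filter.Eventually.of_forall fun ξ =>
      (fourierSchwartzInv (X k) θ).toBoundedContinuousFunction.norm_coe_le_norm ξ.fst
  have h3 := integral_fourierSchwartzInv_fst θ (fourierSchwartz (M k) φ)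
  rw [fourierSchwartzInv_fourierSchwartz, integral_M hint] at h3
  simp only [restrictSchwartz_apply]
  rw [← h3]
  refine integral_congr_ae ?_
  filter_upwards [hB ((fourierSchwartz (M k) φ).toLp 2 (weightMeasure (M k) r)),
    ae_pt_of_ae (coeFn_schwartz_toLp r (fourierSchwartz (M k) φ))] with p h1 h2
  rw [h1, integral_congr_ae h2]
  simp only [pt_fst]
  rw [integral_const_mul, integral_const_mul]

theorem IsCoboundaryOperator.unique {s r : ℝ} {C C' : Sobolev (X k) s →L[ℂ] Sobolev (M k) r}
    (h : IsCoboundaryOperator C) (h' : IsCoboundaryOperator C') : C = C' := by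
  ext u
  apply Sobolev.dist_injective
  ext φ
  rw [h u φ, h' u φ]

/-- The boundary operator is prescribed on Schwartz functions, which are dense. -/
theorem IsBoundaryOperator.unique {r σ : ℝ} {B B' : Sobolev (M k) r →L[ℂ] Sobolev (X k) σ}
    (h : IsBoundaryOperator B) (h' : IsBoundaryOperator B') : B = B' := by
  have hd : DenseRange fun χ : 𝓢(M k, ℂ) =>
      (fourierIso (M k) r).symm (χ.toLp 2 (weightMeasure (M k) r)) :=
    (fourierIso (M k) r).symm.surjective.denseRange.comp (denseRange_schwartz_toLp r)
      (fourierIso (M k) r).symm.continuous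
  refine ContinuousLinearMap.coeFn_injective (hd.equalizer B.continuous B'.continuous ?_)
  funext χ
  apply Sobolev.dist_injective
  simp only [Function.comp_apply]
  rw [h _ _ (dist_fourierIso_symm_schwartz r χ), h' _ _ (dist_fourierIso_symm_schwartz r χ)]

theorem IsFourierIntegralOperator.unique {S : M k → M k → ℝ} {A : M k → ℂ} {r r' : ℝ}
    {Φ Φ' : Sobolev (M k) r →L[ℂ] Sobolev (M k) r'} (h : IsFourierIntegralOperator S A Φ)
    (h' : IsFourierIntegralOperator S A Φ') : Φ = Φ' := by
  ext v
  apply Sobolev.dist_injective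
  ext φ
  rw [(h v φ).2, (h' v φ).2]

theorem IsTrace.unique {S : M k → M k → ℝ} {A : M k → ℂ} {m s : ℝ}
    {T T' : Sobolev (X k) s →L[ℂ] Sobolev (X k) (s - m - k)} (h : IsTrace S A m s T)
    (h' : IsTrace S A m s T') : T = T' := by
  obtain ⟨C, Φ, B, hC, hΦ, hB, rfl⟩ := h
  obtain ⟨C', Φ', B', hC', hΦ', hB', rfl⟩ := h'
  rw [hC.unique hC', hΦ.unique hΦ', hB.unique hB']

end Restriction

/-! ### Homogeneous maps and homogeneous diffeomorphisms -/

section Homogeneous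

variable {F G : Type*} [NormedAddCommGroup F] [NormedSpace ℝ F] [FiniteDimensional ℝ F]
  [NormedAddCommGroup G] [NormedSpace ℝ G]

/-- A continuous homogeneous map is controlled by its values on the unit sphere. -/
theorem IsHomogeneous.exists_bound {d : ℝ} {f : F → G} (hf : IsHomogeneous d f)
    (hc : ContinuousOn f {0}ᶜ) : ∃ C : ℝ, 0 < C ∧ ∀ ξ : F, ξ ≠ 0 → ‖f ξ‖ ≤ C * ‖ξ‖ ^ d := by
  have : ProperSpace F := FiniteDimensional.proper ℝ F
  have hsub : Metric.sphere (0 : F) 1 ⊆ {0}ᶜ := by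
    rintro x hx rfl
    simp at hx
  obtain ⟨C, hC⟩ := (isCompact_sphere (0 : F) 1).exists_bound_of_continuousOn (hc.mono hsub)
  refine ⟨max C 1, by positivity, fun ξ hξ => ?_⟩
  have hn : 0 < ‖ξ‖ := norm_pos_iff.2 hξ
  have hmem : ‖ξ‖⁻¹ • ξ ∈ Metric.sphere (0 : F) 1 := by
    simp [norm_smul, hn.ne']
  have h1 := hf (‖ξ‖⁻¹ • ξ) ‖ξ‖ (hsub hmem) hn
  rw [smul_smul, mul_inv_cancel₀ hn.ne', one_smul] at h1
  rw [h1, norm_smul, Real.norm_of_nonneg (by positivity), mul_comm]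
  gcongr
  exact (hC _ hmem).trans (le_max_left _ _)

/-- The derivative of a homogeneous map of degree `1` is homogeneous of degree `0`. -/
theorem IsHomogeneous.fderiv {f : F → G} (hf : IsHomogeneous 1 f) :
    IsHomogeneous 0 (fderiv ℝ f) := by
  intro ξ c hξ hc
  have h1 : (fun x => f (c • x)) =ᶠ[𝓝 ξ] fun x => c • f x := by
    filter_upwards [isOpen_compl_singleton.mem_nhds hξ] with x hx
    rw [hf x c hx hc, Real.rpow_one]
  have h2 := h1.fderiv_eq (𝕜 := ℝ)
  let _ : Invertible c := invertibleOfNonzero hc.ne'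
  have h3 : _root_.fderiv ℝ (fun x => c • f x) ξ = c • _root_.fderiv ℝ f ξ :=
    fderiv_const_smul_of_invertible c
  rw [fderiv_comp_smul, h3] at h2
  rw [Real.rpow_zero, one_smul]
  exact smul_right_injective _ hc.ne' h2

/-- The determinant of an endomorphism is a polynomial in its matrix entries. -/
theorem contDiff_det {E : Type*} [NormedAddCommGroup E] [NormedSpace ℝ E] [FiniteDimensional ℝ E] :
    ContDiff ℝ ∞ fun L : E →L[ℝ] E => L.det := by
  let b := Module.finBasis ℝ E
  have h : ∀ L : E →L[ℝ] E, L.det = ∑ σ : Equiv.Perm (Fin (Module.finrank ℝ E)),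
      ((Equiv.Perm.sign σ : ℤ) : ℝ) * ∏ i, b.repr (L (b i)) (σ i) := by
    intro L
    rw [ContinuousLinearMap.det, ← LinearMap.det_toMatrix b, Matrix.det_apply']
    simp [LinearMap.toMatrix_apply]
  simp_rw [h]
  refine ContDiff.sum fun σ _ => contDiff_const.mul (contDiff_prod fun i _ => ?_)
  have h2 : ContDiff ℝ ∞ fun L : E →L[ℝ] E => L (b i) := by fun_prop
  exact ((LinearMap.toContinuousLinearMap (b.coord (σ i))).contDiff).comp h2

/-- `Ψ` is a diffeomorphism of the complement of the origin onto itself, homogeneous of degree `1`,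
with the inverse `Ψ'`. -/
structure IsHomogeneousDiffeo (Ψ Ψ' : F → F) : Prop where
  smooth : ContDiffOn ℝ ∞ Ψ {0}ᶜ
  mapsTo : ∀ ξ, ξ ≠ 0 → Ψ ξ ≠ 0
  mapsTo_inv : ∀ η, η ≠ 0 → Ψ' η ≠ 0
  left_inv : ∀ ξ, ξ ≠ 0 → Ψ' (Ψ ξ) = ξ
  right_inv : ∀ η, η ≠ 0 → Ψ (Ψ' η) = η
  homogeneous : IsHomogeneous 1 Ψ
  injective_fderiv : ∀ ξ, ξ ≠ 0 → Function.Injective (fderiv ℝ Ψ ξ)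

namespace IsHomogeneousDiffeo

variable {Ψ Ψ' : F → F} (H : IsHomogeneousDiffeo Ψ Ψ')
include H

theorem contDiffAt {ξ : F} (hξ : ξ ≠ 0) : ContDiffAt ℝ ∞ Ψ ξ :=
  H.smooth.contDiffAt (isOpen_compl_singleton.mem_nhds hξ)

theorem hasFDerivAt {ξ : F} (hξ : ξ ≠ 0) : HasFDerivAt Ψ (fderiv ℝ Ψ ξ) ξ :=
  ((H.contDiffAt hξ).differentiableAt (by simp)).hasFDerivAt

theorem smooth_inv : ContDiffOn ℝ ∞ Ψ' {0}ᶜ := by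
  have : CompleteSpace F := FiniteDimensional.complete ℝ F
  intro η hη
  refine ContDiffAt.contDiffWithinAt ?_
  have hξ := H.mapsTo_inv η hη
  set ξ := Ψ' η with hξdef
  have hΨξ : Ψ ξ = η := H.right_inv η hη
  have hc := H.contDiffAt hξ
  let L : F ≃L[ℝ] F := (LinearEquiv.ofInjectiveEndo (fderiv ℝ Ψ ξ : F →ₗ[ℝ] F)
    (H.injective_fderiv ξ hξ)).toContinuousLinearEquiv
  have hL : HasFDerivAt Ψ (L : F →L[ℝ] F) ξ := by
    convert! H.hasFDerivAt hξ using 1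
  have hn : (∞ : WithTop ℕ∞) ≠ 0 := by simp
  have h1 := hc.to_localInverse hL hn
  rw [hΨξ] at h1
  refine h1.congr_of_eventuallyEq ?_
  have h2 : ∀ᶠ y in 𝓝 η, Ψ (hc.localInverse hL hn y) = y := by
    have := (hc.hasStrictFDerivAt' hL hn).eventually_right_inverse
    rwa [hΨξ] at this
  have h3 : ∀ᶠ y in 𝓝 η, hc.localInverse hL hn y ≠ 0 := by
    have h4 := h1.continuousAt
    refine h4.eventually_ne ?_
    have := hc.localInverse_apply_image hL hn
    rw [hΨξ] at this
    rwa [this]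
  filter_upwards [h2, h3] with y hy2 hy3
  conv_lhs => rw [← hy2]
  exact H.left_inv _ hy3

theorem homogeneous_inv : IsHomogeneous 1 Ψ' := by
  intro η c hη hc
  have h1 := H.homogeneous (Ψ' η) c (H.mapsTo_inv η hη) hc
  rw [H.right_inv η hη] at h1
  rw [Real.rpow_one] at h1 ⊢
  rw [← h1, H.left_inv _ (smul_ne_zero hc.ne' (H.mapsTo_inv η hη))]

theorem image_compl : Ψ '' {0}ᶜ = {0}ᶜ := by
  ext η
  constructor
  · rintro ⟨ξ, hξ, rfl⟩
    exact H.mapsTo ξ hξ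
  · intro hη
    exact ⟨Ψ' η, H.mapsTo_inv η hη, H.right_inv η hη⟩

theorem injOn : Set.InjOn Ψ {0}ᶜ := fun ξ hξ ξ' hξ' h => by
  rw [← H.left_inv ξ hξ, h, H.left_inv ξ' hξ']

theorem det_fderiv_ne_zero {ξ : F} (hξ : ξ ≠ 0) : (fderiv ℝ Ψ ξ).det ≠ 0 := by
  have h := LinearEquiv.isUnit_det' (LinearEquiv.ofInjectiveEndo (fderiv ℝ Ψ ξ : F →ₗ[ℝ] F)
    (H.injective_fderiv ξ hξ))
  exact h.ne_zero

theorem contDiffOn_det_fderiv : ContDiffOn ℝ ∞ (fun ξ => (fderiv ℝ Ψ ξ).det) {0}ᶜ :=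
  contDiff_det.comp_contDiffOn
    (H.smooth.fderiv_of_isOpen isOpen_compl_singleton (by simp))

theorem exists_norm_le : ∃ C : ℝ, 0 < C ∧ ∀ ξ : F, ξ ≠ 0 → ‖Ψ ξ‖ ≤ C * ‖ξ‖ := by
  obtain ⟨C, hC0, hC⟩ := H.homogeneous.exists_bound H.smooth.continuousOn
  exact ⟨C, hC0, fun ξ hξ => by simpa using hC ξ hξ⟩

theorem exists_abs_det_inv_le :
    ∃ C : ℝ, 0 < C ∧ ∀ ξ : F, ξ ≠ 0 → |(fderiv ℝ Ψ ξ).det|⁻¹ ≤ C := by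
  have hh : IsHomogeneous 0 fun ξ => ((fderiv ℝ Ψ ξ).det)⁻¹ := fun ξ c hξ hc => by
    simp only
    rw [H.homogeneous.fderiv ξ c hξ hc, Real.rpow_zero, one_smul, one_smul]
  obtain ⟨C, hC0, hC⟩ := hh.exists_bound (H.contDiffOn_det_fderiv.continuousOn.inv₀
    fun ξ hξ => H.det_fderiv_ne_zero hξ)
  exact ⟨C, hC0, fun ξ hξ => by simpa using hC ξ hξ⟩

end IsHomogeneousDiffeo

end Homogeneous

/-! ### The canonical transformation on the fibre over the fixed point -/

section Generic

variable {V W Z : Type*} [NormedAddCommGroup V] [NormedSpace ℝ V] [NormedAddCommGroup W]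
  [NormedSpace ℝ W] [NormedAddCommGroup Z] [NormedSpace ℝ Z]

theorem hasFDerivAt_comp_prodMk_right {f : V × W → Z} {f' : V × W →L[ℝ] Z} {a : V} {b : W}
    (hf : HasFDerivAt f f' (a, b)) :
    HasFDerivAt (fun w => f (a, w)) (f'.comp (ContinuousLinearMap.inr ℝ V W)) b :=
  hf.comp b (hasFDerivAt_prodMk_right a b)

variable {E : Type*} [NormedAddCommGroup E] [InnerProductSpace ℝ E] [FiniteDimensional ℝ E]

/-- If `g` maps the fibre over `0` into itself by `H`, and `dg` preserves the symplectic form, then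
`dH` is injective: a vertical vector in the kernel of `dg` would be symplectically orthogonal to
everything. -/
theorem injective_fderiv_of_symplectic {g : E × E → E × E} {H : E → E} {ξ : E}
    (hd : DifferentiableAt ℝ g (0, ξ)) (hH : ∀ᶠ η in 𝓝 ξ, g (0, η) = (0, H η))
    (hs : ∀ u v : E × E, inner ℝ (fderiv ℝ g (0, ξ) u).2 (fderiv ℝ g (0, ξ) v).1 -
      inner ℝ (fderiv ℝ g (0, ξ) v).2 (fderiv ℝ g (0, ξ) u).1 =
        inner ℝ u.2 v.1 - inner ℝ v.2 u.1) : Function.Injective (fderiv ℝ H ξ) := by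
  rw [injective_iff_map_eq_zero]
  intro v hv
  have h1 := hasFDerivAt_comp_prodMk_right hd.hasFDerivAt
  have h3 : HasFDerivAt H (fderiv ℝ H ξ) ξ := by
    refine (h1.snd.differentiableAt.congr_of_eventuallyEq ?_).hasFDerivAt
    filter_upwards [hH] with η hη
    rw [hη]
  have h2 : HasFDerivAt (fun η => g (0, η)) ((0 : E →L[ℝ] E).prod (fderiv ℝ H ξ)) ξ :=
    ((hasFDerivAt_const (0 : E) ξ).prodMk h3).congr_of_eventuallyEq hH
  have h4 : fderiv ℝ g (0, ξ) (0, v) = 0 := by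
    have := congrArg (fun L : E →L[ℝ] E × E => L v) (h1.unique h2)
    exact this.trans (by simp [hv])
  have h5 := hs (0, v) (v, 0)
  rw [h4] at h5
  simp only [Prod.fst_zero, Prod.snd_zero, inner_zero_left, inner_zero_right, sub_zero] at h5
  exact inner_self_eq_zero.1 h5.symm

theorem IsHomogeneous.eq_zero_of_gradient_eq_zero {f : E → ℝ} (hf : IsHomogeneous 1 f) {ξ : E}
    (hξ : ξ ≠ 0) (hd : DifferentiableAt ℝ f ξ) (hg : gradient f ξ = 0) : f ξ = 0 := by
  have hgr := hd.hasGradientAt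
  rw [hg] at hgr
  have hfd : HasFDerivAt f (0 : E →L[ℝ] ℝ) ((1 : ℝ) • ξ) := by
    rw [one_smul]
    simpa using hgr.hasFDerivAt
  -- Euler's identity: the derivative along the ray through `ξ` is `f ξ`.
  have hray : HasDerivAt (fun c : ℝ => f (c • ξ)) 0 1 := by
    have hl : HasDerivAt (fun c : ℝ => c • ξ) ((1 : ℝ) • ξ) 1 :=
      (hasDerivAt_id (1 : ℝ)).smul_const ξ
    exact hfd.comp_hasDerivAt (1 : ℝ) hl
  have hlin : HasDerivAt (fun c : ℝ => f (c • ξ)) (f ξ) 1 := by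
    have hl : HasDerivAt (fun c : ℝ => c * f ξ) (f ξ) 1 := by
      simpa using (hasDerivAt_id (1 : ℝ)).mul_const (f ξ)
    refine hl.congr_of_eventuallyEq ?_
    filter_upwards [lt_mem_nhds (zero_lt_one' ℝ)] with c hc
    simpa using hf ξ c hξ hc
  exact hlin.unique hray

theorem eq_inner_gradient_of_affine {f : E → ℝ} {ℓ : E →L[ℝ] ℝ}
    (hf : ∀ y, f y = f 0 + ℓ y) (y : E) : ℓ y = inner ℝ y (gradient f 0) := by
  have hfd : HasFDerivAt f ℓ 0 :=
    (ℓ.hasFDerivAt.const_add (f 0)).congr_of_eventuallyEq (Filter.Eventually.of_forall hf)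
  rw [← hfd.differentiableAt.hasGradientAt.hasFDerivAt.unique hfd, real_inner_comm]
  simp

end Generic

variable {k : ℕ}

section Phase

/-- The map of the fibre over the fixed point `0` that is induced by `g`. -/
noncomputable def fibreMap (g : M k × M k → M k × M k) (ξ' : M k) : M k := (g (0, ξ')).2

variable {Ω : Set (M k)} {g : M k × M k → M k × M k}

theorem apply_zero_eq (hA : ConditionA Ω g) {ξ' : M k} (hξ' : ξ' ≠ 0) :
    g (0, ξ') = (0, fibreMap g ξ') ∧ fibreMap g ξ' ≠ 0 := by
  have h : g (0, ξ') ∈ ({0} : Set (M k)) ×ˢ ({0}ᶜ : Set (M k)) := by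
    rw [← hA.fibre]
    exact ⟨(0, ξ'), ⟨rfl, hξ'⟩, rfl⟩
  exact ⟨Prod.ext h.1 rfl, h.2⟩

theorem contDiffOn_apply_zero (hg : IsCanonicalTransformation Ω g) (h0 : (0 : M k) ∈ Ω) :
    ContDiffOn ℝ ∞ (fun ξ' : M k => g (0, ξ')) {0}ᶜ :=
  hg.smooth.comp (by fun_prop) fun _ hξ => ⟨h0, hξ⟩

theorem isHomogeneousDiffeo_fibreMap (hΩ : IsOpen Ω) (h0 : (0 : M k) ∈ Ω)
    (hg : IsCanonicalTransformation Ω g) (hA : ConditionA Ω g) :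
    IsHomogeneousDiffeo (fibreMap g) (Function.invFunOn (fibreMap g) {0}ᶜ) := by
  have hsurj : Set.SurjOn (fibreMap g) {0}ᶜ {0}ᶜ := by
    intro ξ hξ
    have h : ((0, ξ) : M k × M k) ∈ ({0} : Set (M k)) ×ˢ ({0}ᶜ : Set (M k)) := ⟨rfl, hξ⟩
    rw [← hA.fibre] at h
    obtain ⟨⟨y, ξ'⟩, ⟨hy, hξ'⟩, he⟩ := h
    obtain rfl : y = 0 := hy
    exact ⟨ξ', hξ', by rw [fibreMap, he]⟩
  have hinj : Set.InjOn (fibreMap g) {0}ᶜ := by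
    intro ξ hξ η hη he
    have h1 : g (0, ξ) = g (0, η) := by
      rw [(apply_zero_eq hA hξ).1, (apply_zero_eq hA hη).1, he]
    exact congrArg Prod.snd (hg.injOn ⟨h0, hξ⟩ ⟨h0, hη⟩ h1)
  refine ⟨contDiff_snd.comp_contDiffOn (contDiffOn_apply_zero hg h0),
    fun ξ hξ => (apply_zero_eq hA hξ).2, fun η hη => Function.invFunOn_mem (hsurj hη),
    fun ξ hξ => hinj.leftInvOn_invFunOn hξ, fun η hη => Function.invFunOn_eq (hsurj hη), ?_, ?_⟩
  · intro ξ c hξ hc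
    rw [fibreMap, hg.homogeneous 0 h0 ξ hξ c hc, Real.rpow_one, fibreMap]
  · intro ξ hξ
    have hopen : IsOpen (Ω ×ˢ ({0}ᶜ : Set (M k))) := hΩ.prod isOpen_compl_singleton
    have hmem : ((0, ξ) : M k × M k) ∈ Ω ×ˢ ({0}ᶜ : Set (M k)) := ⟨h0, hξ⟩
    refine injective_fderiv_of_symplectic
      ((hg.smooth.contDiffAt (hopen.mem_nhds hmem)).differentiableAt (by simp)) ?_
      (hg.symplectic _ hmem)
    filter_upwards [isOpen_compl_singleton.mem_nhds hξ] with η hη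
    exact (apply_zero_eq hA hη).1

/-- The generating function is `S(y, ξ') = ⟨y, H(ξ')⟩`, where `H` is the map of the fibre over the
fixed point. -/
theorem phase_eq_inner {S : M k → M k → ℝ} (hA : ConditionA Ω g)
    (hS : IsLinearGeneratingFunction Ω g S) (y : M k) {ξ' : M k} (hξ' : ξ' ≠ 0) :
    S y ξ' = inner ℝ y (fibreMap g ξ') := by
  obtain ⟨U, hU, -, hgraph⟩ := hS.graph
  have h0U := mem_of_mem_nhds hU
  obtain ⟨hg0, hne⟩ := apply_zero_eq hA hξ'
  obtain ⟨h1, h2⟩ := (hgraph 0 h0U 0 h0U _ ξ' hne hξ').1 hg0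
  have hS0 : S 0 ξ' = 0 := by
    have hopen : IsOpen ((Set.univ : Set (M k)) ×ˢ ({0}ᶜ : Set (M k))) :=
      isOpen_univ.prod isOpen_compl_singleton
    have hmem : ((0, ξ') : M k × M k) ∈ (Set.univ : Set (M k)) ×ˢ ({0}ᶜ : Set (M k)) :=
      ⟨trivial, hξ'⟩
    have hd : DifferentiableAt ℝ (fun w : M k × M k => S w.1 w.2) (0, ξ') :=
      (hS.smooth.contDiffAt (hopen.mem_nhds hmem)).differentiableAt (by simp)
    exact (hS.homogeneous 0).eq_zero_of_gradient_eq_zero hξ'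
      (hasFDerivAt_comp_prodMk_right hd.hasFDerivAt).differentiableAt h1.symm
  obtain ⟨ℓ, hℓ⟩ := hS.linear ξ' hξ'
  rw [hℓ y, hS0, zero_add, eq_inner_gradient_of_affine (f := fun z => S z ξ') hℓ, ← h2]

end Phase

/-! ### The inverse of `h` along the fibres, and its Jacobian -/

section Fibre

theorem IsDiffeomorphismOn.bijOn {F : Type*} [NormedAddCommGroup F] [NormedSpace ℝ F]
    {f : F → F} {U V : Set F} (hf : IsDiffeomorphismOn f U V) : Set.BijOn f U V := by
  obtain ⟨-, hm, f', -, hm', hinv⟩ := hf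
  exact hinv.bijOn hm hm'

theorem pt_ne_zero {p τ : X k} : pt p τ ≠ 0 ↔ (p, τ) ≠ 0 := by
  rw [pt, ne_eq, WithLp.toLp_eq_zero]

/-- The shear `(p', τ') ↦ (p', h(p', τ'))`. -/
def shear (h : X k → X k → X k) (q : X k × X k) : X k × X k := (q.1, h q.1 q.2)

/-- The inverse shear `(p', p) ↦ (p', h⁻¹(p', p))`. -/
noncomputable def shearInv (h : X k → X k → X k) (q : X k × X k) : X k × X k :=
  (q.1, fibreInverse h q.1 q.2)

variable {Ω : Set (M k)} {g : M k × M k → M k × M k} {h : X k → X k → X k}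

/-- The two cases `p' ≠ 0` and `p' = 0` in one statement: the fibre is `X` or `X ∖ {0}`. -/
theorem ConditionB.isDiffeomorphismOn (hB : ConditionB g h) (p' : X k) :
    IsDiffeomorphismOn (h p') {τ' | pt p' τ' ≠ 0} {τ' | pt p' τ' ≠ 0} := by
  by_cases hp : p' = 0
  · subst hp
    have : {τ' : X k | pt 0 τ' ≠ 0} = {0}ᶜ := by
      ext τ
      simp [pt_ne_zero]
    rw [this]
    exact hB.diffeo_zero
  · have : {τ' : X k | pt p' τ' ≠ 0} = Set.univ := by
      ext τ
      simp [pt_ne_zero, hp]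
    rw [this]
    exact hB.diffeo p' hp

theorem isOpen_fibre (p' : X k) : IsOpen {τ' : X k | pt p' τ' ≠ 0} :=
  isOpen_ne.preimage (continuous_pt.comp (by fun_prop : Continuous fun τ : X k => (p', τ)))

theorem ConditionB.contDiffOn (h0 : (0 : M k) ∈ Ω) (hg : IsCanonicalTransformation Ω g)
    (hB : ConditionB g h) : ContDiffOn ℝ ∞ (fun q : X k × X k => h q.1 q.2) {0}ᶜ := by
  have hpt : ContDiff ℝ ∞ fun q : X k × X k => pt q.1 q.2 :=
    (WithLp.prodContinuousLinearEquiv 2 ℝ (X k) (X k)).symm.contDiff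
  have hfst : ContDiff ℝ ∞ fun ξ : M k => ξ.fst :=
    contDiff_fst.comp (WithLp.prodContinuousLinearEquiv 2 ℝ (X k) (X k)).contDiff
  have h1 : ContDiffOn ℝ ∞ (fun q : X k × X k => (g (0, pt q.1 q.2)).2.fst) {0}ᶜ :=
    hfst.comp_contDiffOn (contDiff_snd.comp_contDiffOn
      ((contDiffOn_apply_zero hg h0).comp hpt.contDiffOn fun q hq => pt_ne_zero.2 hq))
  refine h1.congr fun q hq => ?_
  obtain ⟨τ, hτ⟩ := hB.eq q.1 q.2 (pt_ne_zero.2 hq)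
  rw [hτ]
  rfl

/-- The differential of the shear is block triangular; its lower diagonal block is invertible, for
`h(p', ·)` has a smooth inverse. -/
theorem isHomogeneousDiffeo_shear (h0 : (0 : M k) ∈ Ω) (hg : IsCanonicalTransformation Ω g)
    (hB : ConditionB g h) : IsHomogeneousDiffeo (shear h) (shearInv h) := by
  have hbij := fun p' => (hB.isDiffeomorphismOn p').bijOn
  have hsm := hB.contDiffOn h0 hg
  refine ⟨contDiffOn_fst.prodMk hsm, fun q hq => ?_, fun q hq => ?_, fun q hq => ?_,
    fun q hq => ?_, ?_, ?_⟩
  · exact pt_ne_zero.1 ((hbij q.1).mapsTo (pt_ne_zero.2 hq))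
  · exact pt_ne_zero.1 (Function.invFunOn_mem ((hbij q.1).surjOn (pt_ne_zero.2 hq)))
  · exact Prod.ext rfl ((hbij q.1).injOn.leftInvOn_invFunOn (pt_ne_zero.2 hq))
  · exact Prod.ext rfl (Function.invFunOn_eq ((hbij q.1).surjOn (pt_ne_zero.2 hq)))
  · intro q c hq hc
    have := hB.homogeneous (pt q.1 q.2) c (pt_ne_zero.2 hq) hc
    exact Prod.ext (by simp [shear]) this
  · intro q hq
    rw [injective_iff_map_eq_zero]
    rintro ⟨u, v⟩ huv
    have hd : HasFDerivAt (fun q : X k × X k => h q.1 q.2)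
        (fderiv ℝ (fun q : X k × X k => h q.1 q.2) q) q :=
      ((hsm.contDiffAt (isOpen_compl_singleton.mem_nhds hq)).differentiableAt
        (by simp)).hasFDerivAt
    have hs : HasFDerivAt (shear h) ((ContinuousLinearMap.fst ℝ (X k) (X k)).prod
        (fderiv ℝ (fun q : X k × X k => h q.1 q.2) q)) q := hasFDerivAt_fst.prodMk hd
    rw [hs.fderiv] at huv
    obtain ⟨h1, h2⟩ := Prod.ext_iff.1 huv
    obtain rfl : u = 0 := h1
    obtain ⟨-, hm, f', hf', -, hinv⟩ := hB.isDiffeomorphismOn q.1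
    have hq2 : q.2 ∈ {τ' : X k | pt q.1 τ' ≠ 0} := pt_ne_zero.2 hq
    have h3 : HasFDerivAt (h q.1) ((fderiv ℝ (fun q : X k × X k => h q.1 q.2) q).comp
        (ContinuousLinearMap.inr ℝ (X k) (X k))) q.2 :=
      hasFDerivAt_comp_prodMk_right hd
    have h4 : HasFDerivAt f' (fderiv ℝ f' (h q.1 q.2)) (h q.1 q.2) :=
      ((hf'.contDiffAt ((isOpen_fibre q.1).mem_nhds (hm hq2))).differentiableAt
        (by simp)).hasFDerivAt
    have h5 : HasFDerivAt (fun τ => f' (h q.1 τ)) (ContinuousLinearMap.id ℝ (X k)) q.2 := by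
      refine (hasFDerivAt_id q.2).congr_of_eventuallyEq ?_
      filter_upwards [(isOpen_fibre q.1).mem_nhds hq2] with τ hτ
      exact hinv.1 hτ
    have h6 := congrArg (fun L : X k →L[ℝ] X k => L v) ((h4.comp q.2 h3).unique h5)
    have h7 : fderiv ℝ (fun q : X k × X k => h q.1 q.2) q (0, v) = 0 := h2
    simp only [ContinuousLinearMap.comp_apply, ContinuousLinearMap.inr_apply, h7, map_zero,
      ContinuousLinearMap.id_apply] at h6
    rw [← h6]
    rfl

variable (hh : IsHomogeneousDiffeo (shear h) (shearInv h))
include hh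

theorem hasFDerivAt_fibreInverse {q : X k × X k} (hq : q ≠ 0) :
    HasFDerivAt (fibreInverse h q.1) (((ContinuousLinearMap.snd ℝ (X k) (X k)).comp
      (fderiv ℝ (shearInv h) q)).comp (ContinuousLinearMap.inr ℝ (X k) (X k))) q.2 := by
  have hd : HasFDerivAt (shearInv h) (fderiv ℝ (shearInv h) q) q :=
    ((hh.smooth_inv.contDiffAt (isOpen_compl_singleton.mem_nhds hq)).differentiableAt
      (by simp)).hasFDerivAt
  exact hasFDerivAt_comp_prodMk_right hd.snd

/-- The Jacobian is the determinant of a block of the differential of the inverse shear, and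
therefore depends smoothly on both variables. -/
theorem jacobian_eq {q : X k × X k} (hq : q ≠ 0) :
    jacobian h q.1 q.2 = (((ContinuousLinearMap.snd ℝ (X k) (X k)).comp
      (fderiv ℝ (shearInv h) q)).comp (ContinuousLinearMap.inr ℝ (X k) (X k))).det := by
  rw [jacobian, (hasFDerivAt_fibreInverse hh hq).fderiv]

theorem contDiffOn_jacobian :
    ContDiffOn ℝ ∞ (fun q : X k × X k => jacobian h q.1 q.2) {0}ᶜ := by
  have h1 : ContDiffOn ℝ ∞ (fun q => fderiv ℝ (shearInv h) q) {0}ᶜ :=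
    hh.smooth_inv.fderiv_of_isOpen isOpen_compl_singleton (by simp)
  have h2 : ContDiffOn ℝ ∞ (fun q => ((ContinuousLinearMap.snd ℝ (X k) (X k)).comp
      (fderiv ℝ (shearInv h) q)).comp (ContinuousLinearMap.inr ℝ (X k) (X k))) {0}ᶜ :=
    (contDiffOn_const.clm_comp h1).clm_comp contDiffOn_const
  exact (contDiff_det.comp_contDiffOn h2).congr fun q hq => jacobian_eq hh hq

theorem isHomogeneous_jacobian : IsHomogeneous 0 fun q : X k × X k => jacobian h q.1 q.2 := by
  intro q c hq hc
  have h1 := hh.homogeneous_inv.fderiv q c hq hc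
  simp only
  rw [jacobian_eq hh (smul_ne_zero hc.ne' hq), jacobian_eq hh hq, h1]
  simp

theorem jacobian_ne_zero {q : X k × X k} (hq : q ≠ 0) : jacobian h q.1 q.2 ≠ 0 := by
  rw [jacobian_eq hh hq]
  set L := ((ContinuousLinearMap.snd ℝ (X k) (X k)).comp
      (fderiv ℝ (shearInv h) q)).comp (ContinuousLinearMap.inr ℝ (X k) (X k)) with hL
  have hinj : Function.Injective L := by
    rw [injective_iff_map_eq_zero]
    intro v hv
    have hτ := hh.mapsTo_inv q hq
    have h1 : HasFDerivAt (fun τ => (shear h (q.1, τ)).2) _ (fibreInverse h q.1 q.2) :=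
      hasFDerivAt_comp_prodMk_right (hh.hasFDerivAt hτ).snd
    have h2 := h1.comp q.2 (hasFDerivAt_fibreInverse hh hq)
    have h3 : HasFDerivAt (fun η => (shear h (q.1, fibreInverse h q.1 η)).2)
        (ContinuousLinearMap.id ℝ (X k)) q.2 := by
      refine (hasFDerivAt_id q.2).congr_of_eventuallyEq ?_
      filter_upwards [(isOpen_fibre q.1).mem_nhds (pt_ne_zero.2 hq)] with η hη
      exact congrArg Prod.snd (hh.right_inv (q.1, η) (pt_ne_zero.1 hη))
    have h4 := congrArg (fun L : X k →L[ℝ] X k => L v) (h2.unique h3)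
    rw [← hL] at h4
    simp only [ContinuousLinearMap.comp_apply, hv, map_zero, ContinuousLinearMap.id_apply] at h4
    exact h4.symm
  exact (LinearEquiv.isUnit_det' (LinearEquiv.ofInjectiveEndo (L : X k →ₗ[ℝ] X k) hinj)).ne_zero

end Fibre

/-! ### Bounds for amplitudes and kernels -/

section Amplitudes

/-- For a non-positive order a bound for brackets from above reverses. -/
theorem rpow_half_le_of_le {A B K m : ℝ} (hB : 0 < B) (hK : 0 < K) (h : B ≤ K * A)
    (hm : m ≤ 0) : A ^ (m / 2) ≤ K ^ (-(m / 2)) * B ^ (m / 2) := by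
  have h1 : B / K ≤ A := by rwa [div_le_iff₀' hK]
  calc A ^ (m / 2) ≤ (B / K) ^ (m / 2) :=
        Real.rpow_le_rpow_of_nonpos (by positivity) h1 (by linarith)
    _ = _ := by rw [Real.div_rpow hB.le hK.le, Real.rpow_neg hK.le, div_eq_inv_mul]

theorem exists_norm_bound_of_eventually {E : Type*} [NormedAddCommGroup E] [ProperSpace E]
    {p : E → Prop} (h : ∀ᶠ x in Filter.cocompact E, p x) : ∃ ρ : ℝ, ∀ x, ρ < ‖x‖ → p x := by
  rw [← Metric.cobounded_eq_cocompact, (Metric.hasBasis_cobounded_compl_closedBall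
    (0 : E)).eventually_iff] at h
  obtain ⟨ρ, -, hρ⟩ := h
  exact ⟨ρ, fun x hx => hρ (by simpa using hx)⟩

theorem contDiffOn_densityAmplitude {μ : M k → ℝ} (hμ : IsHomogeneousDensity μ) {a : M k → ℂ}
    (ha : ContDiffOn ℝ ∞ a {0}ᶜ) : ContDiffOn ℝ ∞ (densityAmplitude μ a) {0}ᶜ := by
  have h1 : ContDiffOn ℝ ∞ (fun ξ => Real.sqrt (μ ξ)) {0}ᶜ :=
    hμ.smooth.sqrt fun ξ hξ => (hμ.pos ξ hξ).ne'
  exact (Complex.ofRealCLM.contDiff.comp_contDiffOn h1).mul ha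

theorem isHomogeneous_densityAmplitude {μ : M k → ℝ} (hμ : IsHomogeneousDensity μ) {m : ℝ}
    {a₀ : M k → ℂ} (ha : IsHomogeneous m a₀) : IsHomogeneous m (densityAmplitude μ a₀) := by
  intro ξ c hξ hc
  rw [densityAmplitude, hμ.homogeneous ξ c hξ hc, ha ξ c hξ hc, Real.rpow_zero, one_smul,
    densityAmplitude, mul_smul_comm]

theorem exists_densityAmplitude_bound {μ : M k → ℝ} (hμ : IsHomogeneousDensity μ) {m : ℝ}
    (hm : m ≤ 0) {a₀ a : M k → ℂ} (ha : IsSmoothedAmplitude m a₀ a) :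
    ∃ C : ℝ, 0 < C ∧ ∀ ξ, ξ ≠ 0 → ‖densityAmplitude μ a ξ‖ ≤ C * (1 + ‖ξ‖ ^ 2) ^ (m / 2) := by
  obtain ⟨C₁, hC₁, h₁⟩ := hμ.homogeneous.exists_bound hμ.smooth.continuousOn
  obtain ⟨C₂, hC₂, h₂⟩ := ha.homogeneous.exists_bound ha.smooth_homogeneous.continuousOn
  obtain ⟨ρ, hρ⟩ := exists_norm_bound_of_eventually ha.eq_at_infinity
  set R := max ρ 1 with hR
  obtain ⟨C₃, h₃⟩ := (isCompact_closedBall (0 : M k) R).exists_bound_of_continuousOn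
    ha.smooth.continuous.continuousOn
  have hsqrt : ∀ ξ, ξ ≠ 0 → Real.sqrt (μ ξ) ≤ Real.sqrt C₁ := by
    intro ξ hξ
    refine Real.sqrt_le_sqrt ((le_abs_self _).trans ?_)
    simpa using h₁ ξ hξ
  have hbound : ∃ C : ℝ, 0 < C ∧ ∀ ξ, ξ ≠ 0 → ‖a ξ‖ ≤ C * (1 + ‖ξ‖ ^ 2) ^ (m / 2) := by
    refine ⟨max (C₂ * 2 ^ (-(m / 2))) (|C₃| * (1 + R ^ 2) ^ (-(m / 2))), lt_max_of_lt_left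
      (by positivity), fun ξ hξ => ?_⟩
    by_cases hξR : ‖ξ‖ ≤ R
    · have h4 := h₃ ξ (by simpa using hξR)
      have h5 := rpow_half_le_of_le (A := 1) (B := 1 + ‖ξ‖ ^ 2) (K := 1 + R ^ 2) (m := m)
        (by positivity) (by positivity) (by rw [mul_one]; gcongr) hm
      rw [Real.one_rpow] at h5
      calc ‖a ξ‖ ≤ |C₃| * 1 := by rw [mul_one]; exact h4.trans (le_abs_self _)
        _ ≤ |C₃| * ((1 + R ^ 2) ^ (-(m / 2)) * (1 + ‖ξ‖ ^ 2) ^ (m / 2)) := by gcongr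
        _ = (|C₃| * (1 + R ^ 2) ^ (-(m / 2))) * (1 + ‖ξ‖ ^ 2) ^ (m / 2) := by ring
        _ ≤ _ := by gcongr; exact le_max_right _ _
    · have hgt : R < ‖ξ‖ := not_le.1 hξR
      have h1 : 1 < ‖ξ‖ := (le_max_right _ _).trans_lt hgt
      rw [hρ ξ ((le_max_left _ _).trans_lt hgt)]
      have h5 := rpow_half_le_of_le (A := ‖ξ‖ ^ 2) (B := 1 + ‖ξ‖ ^ 2) (K := 2) (m := m)
        (by positivity) (by positivity) (by nlinarith) hm
      have h6 : (‖ξ‖ ^ 2) ^ (m / 2) = ‖ξ‖ ^ m := by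
        rw [← Real.rpow_natCast, ← Real.rpow_mul (norm_nonneg _)]
        congr 1
        push_cast
        ring
      rw [h6] at h5
      calc ‖a₀ ξ‖ ≤ C₂ * ‖ξ‖ ^ m := h₂ ξ hξ
        _ ≤ C₂ * (2 ^ (-(m / 2)) * (1 + ‖ξ‖ ^ 2) ^ (m / 2)) := by gcongr
        _ = (C₂ * 2 ^ (-(m / 2))) * (1 + ‖ξ‖ ^ 2) ^ (m / 2) := by ring
        _ ≤ _ := by gcongr; exact le_max_left _ _
  obtain ⟨C, hC0, hC⟩ := hbound
  refine ⟨Real.sqrt C₁ * C, by positivity, fun ξ hξ => ?_⟩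
  rw [densityAmplitude, norm_mul, Complex.norm_real, Real.norm_of_nonneg (Real.sqrt_nonneg _),
    mul_assoc]
  exact mul_le_mul (hsqrt ξ hξ) (hC ξ hξ) (norm_nonneg _) (Real.sqrt_nonneg _)

end Amplitudes

section Kernel

/-- The kernel `|J(p', p)| α(p', h⁻¹(p', p))` with the amplitude `α`. -/
noncomputable def traceKernel (h : X k → X k → X k) (α : M k → ℂ) (p p' : X k) : ℂ :=
  ((|jacobian h p' p| : ℝ) : ℂ) * α (pt p' (fibreInverse h p' p))

variable {h : X k → X k → X k} (hh : IsHomogeneousDiffeo (shear h) (shearInv h))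
include hh

theorem pt_fibreInverse_ne_zero {p p' : X k} (hp : (p', p) ≠ 0) :
    pt p' (fibreInverse h p' p) ≠ 0 :=
  pt_ne_zero.2 (hh.mapsTo_inv (p', p) hp)

theorem contDiffOn_traceKernel {α : M k → ℂ} (hα : ContDiffOn ℝ ∞ α {0}ᶜ) :
    ContDiffOn ℝ ∞ (fun q : X k × X k => traceKernel h α q.1 q.2) {0}ᶜ := by
  have hJ : ContDiffOn ℝ ∞ (fun q : X k × X k => |jacobian h q.1 q.2|) {0}ᶜ := fun q hq =>
    (contDiffOn_jacobian hh q hq).abs (jacobian_ne_zero hh hq)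
  have hpt : ContDiff ℝ ∞ fun q : X k × X k => pt q.1 q.2 :=
    (WithLp.prodContinuousLinearEquiv 2 ℝ (X k) (X k)).symm.contDiff
  have h1 : ContDiffOn ℝ ∞ (fun q : X k × X k => α (pt q.1 (fibreInverse h q.1 q.2))) {0}ᶜ :=
    hα.comp (hpt.comp_contDiffOn hh.smooth_inv) fun q hq => pt_fibreInverse_ne_zero hh hq
  have h2 : ContDiffOn ℝ ∞ (fun q : X k × X k => ((|jacobian h q.1 q.2| : ℝ) : ℂ) *
      α (pt q.1 (fibreInverse h q.1 q.2))) {0}ᶜ :=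
    (Complex.ofRealCLM.contDiff.comp_contDiffOn hJ).mul h1
  refine h2.comp (contDiff_snd.prodMk contDiff_fst).contDiffOn fun q hq hq0 => hq ?_
  exact Prod.ext (congrArg Prod.snd hq0) (congrArg Prod.fst hq0)

theorem measurable_traceKernel {α : M k → ℂ} (hα : ContDiffOn ℝ ∞ α {0}ᶜ) :
    Measurable (Function.uncurry (traceKernel h α)) :=
  measurable_of_continuousOn_compl_singleton 0 (contDiffOn_traceKernel hh hα).continuousOn

theorem isHomogeneous_traceKernel {α : M k → ℂ} {m : ℝ} (hα : IsHomogeneous m α) :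
    IsHomogeneous m fun q : X k × X k => traceKernel h α q.1 q.2 := by
  rintro ⟨p, p'⟩ c hq hc
  have hq' : (p', p) ≠ 0 := fun h0 =>
    hq (Prod.ext (congrArg Prod.snd h0) (congrArg Prod.fst h0))
  have h1 : jacobian h (c • p') (c • p) = jacobian h p' p := by
    simpa using isHomogeneous_jacobian hh (p', p) c hq' hc
  have h2 : fibreInverse h (c • p') (c • p) = c • fibreInverse h p' p := by
    have h3 := congrArg Prod.snd (hh.homogeneous_inv (p', p) c hq' hc)
    rw [Real.rpow_one] at h3
    exact h3
  have h3 : pt (c • p') (c • fibreInverse h p' p) = c • pt p' (fibreInverse h p' p) := rfl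
  simp only [traceKernel, Prod.smul_fst, Prod.smul_snd]
  rw [h1, h2, h3, hα _ c (pt_fibreInverse_ne_zero hh hq') hc, mul_smul_comm]

/-- The kernel inherits the bound of the amplitude, because the argument `(p', h⁻¹(p', p))` is at
least comparable to `(p', p)` and the Jacobian is bounded. The value at the origin, where the inverse
is not determined, is absorbed into the constant. -/
theorem exists_traceKernel_bound {α : M k → ℂ} {m C : ℝ} (hm : m ≤ 0) (hC0 : 0 < C)
    (hα : ∀ ξ, ξ ≠ 0 → ‖α ξ‖ ≤ C * (1 + ‖ξ‖ ^ 2) ^ (m / 2)) :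
    ∃ C' : ℝ, ∀ p p', ‖traceKernel h α p p'‖ ≤ C' * (1 + ‖pt p p'‖ ^ 2) ^ (m / 2) := by
  obtain ⟨CJ, hCJ, hJ⟩ := (isHomogeneous_jacobian hh).exists_bound
    (contDiffOn_jacobian hh).continuousOn
  obtain ⟨D, hD, hDle⟩ := hh.exists_norm_le
  set K : ℝ := 1 + 2 * D ^ 2 with hK
  refine ⟨max (CJ * (C * K ^ (-(m / 2)))) ‖traceKernel h α 0 0‖, fun p p' => ?_⟩
  by_cases hq : (p', p) = 0
  · obtain ⟨rfl, rfl⟩ := Prod.ext_iff.1 hq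
    have : (1 + ‖pt (0 : X k) (0 : X k)‖ ^ 2) ^ (m / 2) = 1 := by
      rw [one_add_norm_sq_pt]
      simp
    simp only [Prod.fst_zero, Prod.snd_zero]
    rw [this, mul_one]
    exact le_max_right _ _
  · set τ := fibreInverse h p' p with hτ
    have h1 := hDle _ (hh.mapsTo_inv _ hq)
    rw [hh.right_inv _ hq] at h1
    have h2 : ‖shearInv h (p', p)‖ ≤ ‖pt p' τ‖ := by
      refine max_le ?_ ?_
      · rw [← sq_le_sq₀ (norm_nonneg _) (norm_nonneg _), norm_sq_M]
        exact le_add_of_nonneg_right (sq_nonneg _)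
      · rw [← sq_le_sq₀ (norm_nonneg _) (norm_nonneg _), norm_sq_M]
        exact le_add_of_nonneg_left (sq_nonneg _)
    have h3 : ‖(p', p)‖ ≤ D * ‖pt p' τ‖ := h1.trans (by gcongr)
    have h4 : ‖pt p p'‖ ^ 2 ≤ 2 * ‖(p', p)‖ ^ 2 := by
      rw [norm_sq_M, pt_fst, pt_snd]
      have h5 : ‖p'‖ ≤ ‖(p', p)‖ := norm_fst_le (p', p)
      have h6 : ‖p‖ ≤ ‖(p', p)‖ := norm_snd_le (p', p)
      nlinarith [norm_nonneg p, norm_nonneg p']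
    have h5 : 1 + ‖pt p p'‖ ^ 2 ≤ K * (1 + ‖pt p' τ‖ ^ 2) := by
      have : ‖(p', p)‖ ^ 2 ≤ (D * ‖pt p' τ‖) ^ 2 := by gcongr
      rw [hK]
      nlinarith [sq_nonneg D, sq_nonneg ‖pt p' τ‖]
    have h6 := rpow_half_le_of_le (m := m) (by positivity) (by positivity) h5 hm
    have hJ' : |jacobian h p' p| ≤ CJ := by simpa using hJ (p', p) hq
    rw [traceKernel, norm_mul, Complex.norm_real, Real.norm_of_nonneg (abs_nonneg _)]
    calc |jacobian h p' p| * ‖α (pt p' τ)‖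
        ≤ CJ * (C * (K ^ (-(m / 2)) * (1 + ‖pt p p'‖ ^ 2) ^ (m / 2))) := by
          refine mul_le_mul hJ' ((hα _ (pt_fibreInverse_ne_zero hh hq)).trans ?_) (norm_nonneg _)
            hCJ.le
          gcongr
      _ = (CJ * (C * K ^ (-(m / 2)))) * (1 + ‖pt p p'‖ ^ 2) ^ (m / 2) := by ring
      _ ≤ _ := by gcongr; exact le_max_left _ _

end Kernel

section Cut

theorem IsCutoff.exists_bound {ψ : X k → ℝ} (hψ : IsCutoff ψ) :
    ∃ C : ℝ, 0 < C ∧ ∀ p, |ψ p| ≤ C := by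
  obtain ⟨ρ, hρ⟩ := exists_norm_bound_of_eventually hψ.eq_one
  obtain ⟨C, hC⟩ := (isCompact_closedBall (0 : X k) ρ).exists_bound_of_continuousOn
    hψ.smooth.continuous.continuousOn
  refine ⟨max C 1, by positivity, fun p => ?_⟩
  by_cases hp : ‖p‖ ≤ ρ
  · exact (hC p (by simpa using hp)).trans (le_max_left _ _)
  · rw [hρ p (not_le.1 hp), abs_one]
    exact le_max_right _ _

/-- The cut-off function keeps `(p, p')` away from the origin, where the homogeneous kernel is
singular. -/
theorem exists_cutKernel_bound {ψ ψ' : X k → ℝ} (hψ : IsCutoff ψ) (hψ' : IsCutoff ψ') {m : ℝ}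
    (hm : m ≤ 0) {b : X k → X k → ℂ} (hb : IsHomogeneous m fun q : X k × X k => b q.1 q.2)
    (hc : ContinuousOn (fun q : X k × X k => b q.1 q.2) {0}ᶜ) :
    ∃ C : ℝ, ∀ p p', ‖cutKernel ψ ψ' b p p'‖ ≤ C * (1 + ‖pt p p'‖ ^ 2) ^ (m / 2) := by
  obtain ⟨C₁, hC₁, h₁⟩ := hψ.exists_bound
  obtain ⟨C₂, hC₂, h₂⟩ := hψ'.exists_bound
  obtain ⟨C₃, hC₃, h₃⟩ := hb.exists_bound hc
  obtain ⟨ε, hε, hball⟩ := Metric.eventually_nhds_iff.1 hψ.eq_zero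
  set K : ℝ := ε⁻¹ ^ 2 + 2 with hK
  refine ⟨C₁ * (C₃ * K ^ (-(m / 2))) * C₂, fun p p' => ?_⟩
  by_cases hp : ‖p‖ < ε
  · rw [cutKernel, hball (by simpa using hp)]
    simp only [Complex.ofReal_zero, zero_mul, norm_zero]
    positivity
  · have hp1 : ε ≤ ‖p‖ := not_lt.1 hp
    have hp0 : p ≠ 0 := by
      rintro rfl
      simp at hp1
      linarith
    have hq : ((p, p') : X k × X k) ≠ 0 := fun h0 => hp0 (congrArg Prod.fst h0)
    have h5 : ‖p‖ ≤ ‖(p, p')‖ := norm_fst_le (p, p')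
    have h6 : ‖p'‖ ≤ ‖(p, p')‖ := norm_snd_le (p, p')
    have h7 : 1 ≤ ε⁻¹ * ‖(p, p')‖ := by
      rw [inv_mul_eq_div, one_le_div hε]
      exact hp1.trans h5
    have h8 : 1 + ‖pt p p'‖ ^ 2 ≤ K * ‖(p, p')‖ ^ 2 := by
      rw [norm_sq_M, pt_fst, pt_snd, hK]
      have : 1 ≤ (ε⁻¹ * ‖(p, p')‖) ^ 2 := one_le_pow₀ h7
      nlinarith [norm_nonneg p, norm_nonneg p']
    have h9 := rpow_half_le_of_le (m := m) (by positivity) (by positivity) h8 hm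
    have h10 : (‖(p, p')‖ ^ 2) ^ (m / 2) = ‖(p, p')‖ ^ m := by
      rw [← Real.rpow_natCast, ← Real.rpow_mul (norm_nonneg _)]
      congr 1
      push_cast
      ring
    rw [h10] at h9
    rw [cutKernel, norm_mul, norm_mul, Complex.norm_real, Complex.norm_real, Real.norm_eq_abs,
      Real.norm_eq_abs]
    calc |ψ p| * ‖b p p'‖ * |ψ' p'|
        ≤ C₁ * (C₃ * (K ^ (-(m / 2)) * (1 + ‖pt p p'‖ ^ 2) ^ (m / 2))) * C₂ := by
          refine mul_le_mul (mul_le_mul (h₁ p) ((h₃ _ hq).trans ?_) (norm_nonneg _) hC₁.le) (h₂ p')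
            (abs_nonneg _) (by positivity)
          gcongr
      _ = _ := by ring

theorem measurable_cutKernel {ψ ψ' : X k → ℝ} (hψ : IsCutoff ψ) (hψ' : IsCutoff ψ')
    {b : X k → X k → ℂ} (hb : Measurable (Function.uncurry b)) :
    Measurable (Function.uncurry (cutKernel ψ ψ' b)) := by
  have h1 := hψ.smooth.continuous.measurable
  have h2 := hψ'.smooth.continuous.measurable
  exact ((Complex.measurable_ofReal.comp (h1.comp measurable_fst)).mul hb).mul
    (Complex.measurable_ofReal.comp (h2.comp measurable_snd))

/-- Where both cut-off functions equal `1` and the amplitude is homogeneous, the two kernels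
coincide. -/
theorem exists_traceKernel_eq_cutKernel (h : X k → X k → X k) {ψ ψ' : X k → ℝ} (hψ : IsCutoff ψ)
    (hψ' : IsCutoff ψ') (μ : M k → ℝ) {m : ℝ} {a₀ a : M k → ℂ} (ha : IsSmoothedAmplitude m a₀ a) :
    ∃ ρ : ℝ, ∀ p p', ρ < ‖p‖ → ρ < ‖p'‖ → traceKernel h (densityAmplitude μ a) p p' -
      cutKernel ψ ψ' (homogeneousKernel h μ a₀) p p' = 0 := by
  obtain ⟨ρ₁, h₁⟩ := exists_norm_bound_of_eventually hψ.eq_one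
  obtain ⟨ρ₂, h₂⟩ := exists_norm_bound_of_eventually hψ'.eq_one
  obtain ⟨ρ₃, h₃⟩ := exists_norm_bound_of_eventually ha.eq_at_infinity
  refine ⟨max ρ₁ (max ρ₂ ρ₃), fun p p' hp hp' => ?_⟩
  rw [max_lt_iff, max_lt_iff] at hp hp'
  have h4 : ‖p'‖ ≤ ‖pt p' (fibreInverse h p' p)‖ := by
    rw [← sq_le_sq₀ (norm_nonneg _) (norm_nonneg _), norm_sq_M]
    exact le_add_of_nonneg_right (sq_nonneg _)
  rw [cutKernel, h₁ p hp.1, h₂ p' hp'.2.1, traceKernel, homogeneousKernel, densityAmplitude,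
    densityAmplitude, h₃ _ (hp'.2.2.trans_le h4)]
  simp

end Cut

/-! ### The Fourier integral operator in dual coordinates -/

theorem ae_ne_zero {E : Type*} [Zero E] [MeasurableSpace E] (μ : Measure E)
    [NullSingletonClass μ] : ∀ᵐ x ∂μ, x ≠ 0 := by
  rw [ae_iff]
  simp

namespace IsHomogeneousDiffeo

section ChangeOfVariables

variable {F : Type*} [NormedAddCommGroup F] [NormedSpace ℝ F] [FiniteDimensional ℝ F]
  [MeasurableSpace F] [BorelSpace F] {μ : Measure F} [μ.IsAddHaarMeasure]
  [NullSingletonClass μ] {Ψ Ψ' : F → F} (H : IsHomogeneousDiffeo Ψ Ψ')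
include H

theorem measurable : Measurable Ψ :=
  measurable_of_continuousOn_compl_singleton 0 H.smooth.continuousOn

theorem measurable_inv : Measurable Ψ' :=
  measurable_of_continuousOn_compl_singleton 0 H.smooth_inv.continuousOn

theorem measurable_det : Measurable fun ξ => (fderiv ℝ Ψ ξ).det :=
  measurable_of_continuousOn_compl_singleton 0 H.contDiffOn_det_fderiv.continuousOn

theorem lintegral_comp (G : F → ℝ≥0∞) :
    ∫⁻ ξ, G ξ ∂μ = ∫⁻ ξ, ENNReal.ofReal |(fderiv ℝ Ψ ξ).det| * G (Ψ ξ) ∂μ := by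
  have h := lintegral_image_eq_lintegral_abs_det_fderiv_mul μ (measurableSet_singleton 0).compl
    (fun ξ hξ => (H.hasFDerivAt hξ).hasFDerivWithinAt) H.injOn G
  rwa [H.image_compl, restrict_compl_singleton] at h

theorem integrable_iff {f : F → ℂ} :
    Integrable f μ ↔ Integrable (fun ξ => |(fderiv ℝ Ψ ξ).det| • f (Ψ ξ)) μ := by
  have h := integrableOn_image_iff_integrableOn_abs_det_fderiv_smul μ
    (measurableSet_singleton 0).compl
    (fun ξ hξ => (H.hasFDerivAt hξ).hasFDerivWithinAt) H.injOn f
  rwa [H.image_compl, IntegrableOn, IntegrableOn, restrict_compl_singleton] at h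

theorem integral_comp (f : F → ℂ) :
    ∫ ξ, f ξ ∂μ = ∫ ξ, |(fderiv ℝ Ψ ξ).det| • f (Ψ ξ) ∂μ := by
  have h := integral_image_eq_integral_abs_det_fderiv_smul μ
    (measurableSet_singleton 0).compl
    (fun ξ hξ => (H.hasFDerivAt hξ).hasFDerivWithinAt) H.injOn f
  rwa [H.image_compl, restrict_compl_singleton] at h

end ChangeOfVariables

end IsHomogeneousDiffeo

section FourierIntegral

variable [NullSingletonClass (volume : Measure (M k))] {H H' : M k → M k}
  (hH : IsHomogeneousDiffeo H H')
include hH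

/-- The factor in front of `v ∘ H⁻¹` in the dual form of the Fourier integral operator with the
phase function `⟨y, H(ξ')⟩` and the amplitude `α`. -/
noncomputable def dualFactor (H H' : M k → M k) (α : M k → ℂ) (ξ : M k) : ℂ :=
  (fourierConst (M k))⁻¹ * ((|(fderiv ℝ H (H' ξ)).det|⁻¹ : ℝ) : ℂ) * α (H' ξ)

/-- The substitution `ξ = H(ξ')` removes the Jacobian from the dual factor. -/
theorem abs_det_smul_dualFactor (α : M k → ℂ) {ξ : M k} (hξ : ξ ≠ 0) (z : ℂ) :
    |(fderiv ℝ H ξ).det| • (dualFactor H H' α (H ξ) * z) =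
      (fourierConst (M k))⁻¹ * α ξ * z := by
  have hd : |(fderiv ℝ H ξ).det| ≠ 0 := abs_ne_zero.2 (hH.det_fderiv_ne_zero hξ)
  have hd' : ((|(fderiv ℝ H ξ).det| : ℝ) : ℂ) ≠ 0 := Complex.ofReal_ne_zero.2 hd
  rw [dualFactor, hH.left_inv ξ hξ, Complex.real_smul, Complex.ofReal_inv]
  field_simp

/-- The dual form of the Fourier integral operator is bounded `H̃^r → H̃^{r-m}`. -/
theorem exists_dualFourierIntegralOperator {α : M k → ℂ} (hα : ContDiffOn ℝ ∞ α {0}ᶜ)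
    {r r' m C : ℝ} (hr : r' = r - m) (hr' : 0 ≤ r')
    (hC : ∀ ξ, ξ ≠ 0 → ‖α ξ‖ ≤ C * (1 + ‖ξ‖ ^ 2) ^ (m / 2)) :
    ∃ Φ : DualSobolev (M k) r →L[ℂ] DualSobolev (M k) r',
      ∀ v, ∀ᵐ ξ, Φ v ξ = dualFactor H H' α ξ * v (H' ξ) := by
  have hαm : Measurable α := measurable_of_continuousOn_compl_singleton 0 hα.continuousOn
  have hHm' := hH.measurable_inv
  have hHm := hH.measurable
  have hdet := hH.measurable_det
  have hκ : Measurable (dualFactor H H' α) := by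
    have h1 : Measurable fun ξ => |(fderiv ℝ H (H' ξ)).det|⁻¹ := by
      simp_rw [← abs_inv]
      exact ((hdet.comp hHm').inv).abs
    exact ((Complex.measurable_ofReal.comp h1).const_mul _).mul (hαm.comp hHm')
  obtain ⟨D, hD, hDle⟩ := hH.exists_norm_le
  obtain ⟨J, hJ, hJle⟩ := hH.exists_abs_det_inv_le
  set c : ℝ := ‖(fourierConst (M k))⁻¹‖ with hc
  set K : ℝ := 1 + D ^ 2 with hK
  obtain ⟨Φ, hΦ⟩ := exists_weightedCompOperator (μ := weightMeasure (M k) r)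
    (ν := weightMeasure (M k) r') hHm' hκ (ENNReal.ofReal (c ^ 2 * J * C ^ 2 * K ^ r'))
    ENNReal.ofReal_ne_top (by
      intro G hG
      rw [lintegral_weightMeasure _ (by fun_prop), lintegral_weightMeasure _ hG,
        hH.lintegral_comp, ← lintegral_const_mul _ (by fun_prop)]
      refine lintegral_mono_ae ?_
      filter_upwards [ae_ne_zero volume] with ξ hξ
      rw [hH.left_inv ξ hξ, ← mul_assoc, ← mul_assoc, ← mul_assoc]
      refine mul_le_mul_left ?_ _
      have hd : 0 < |(fderiv ℝ H ξ).det| := abs_pos.2 (hH.det_fderiv_ne_zero hξ)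
      rw [← ofReal_norm, ← ENNReal.ofReal_pow (norm_nonneg _),
        ← ENNReal.ofReal_mul (by positivity), ← ENNReal.ofReal_mul (by positivity),
        ← ENNReal.ofReal_mul (by positivity)]
      refine ENNReal.ofReal_le_ofReal ?_
      have h1 : ‖dualFactor H H' α (H ξ)‖ = c * |(fderiv ℝ H ξ).det|⁻¹ * ‖α ξ‖ := by
        rw [dualFactor, hH.left_inv ξ hξ, norm_mul, norm_mul, Complex.norm_real,
          Real.norm_of_nonneg (by positivity)]
      have h2 : (1 + ‖H ξ‖ ^ 2) ^ r' ≤ K ^ r' * (1 + ‖ξ‖ ^ 2) ^ r' := by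
        rw [← Real.mul_rpow (by positivity) (by positivity)]
        refine Real.rpow_le_rpow (by positivity) ?_ hr'
        have h3 : ‖H ξ‖ ^ 2 ≤ (D * ‖ξ‖) ^ 2 := by
          gcongr
          exact hDle ξ hξ
        rw [hK]
        nlinarith [sq_nonneg D, sq_nonneg ‖ξ‖]
      have h4 : ‖α ξ‖ ^ 2 ≤ C ^ 2 * (1 + ‖ξ‖ ^ 2) ^ m := by
        calc ‖α ξ‖ ^ 2 ≤ (C * (1 + ‖ξ‖ ^ 2) ^ (m / 2)) ^ 2 := by
              gcongr
              exact hC ξ hξ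
          _ = _ := by
              rw [mul_pow, ← Real.rpow_natCast ((1 + ‖ξ‖ ^ 2) ^ (m / 2)),
                ← Real.rpow_mul (by positivity)]
              push_cast
              ring_nf
      have h5 : (1 + ‖ξ‖ ^ 2) ^ r = (1 + ‖ξ‖ ^ 2) ^ r' * (1 + ‖ξ‖ ^ 2) ^ m := by
        rw [← Real.rpow_add (by positivity), hr]
        ring_nf
      rw [h1, h5]
      calc |(fderiv ℝ H ξ).det| * (1 + ‖H ξ‖ ^ 2) ^ r' * (c * |(fderiv ℝ H ξ).det|⁻¹ * ‖α ξ‖) ^ 2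
          = c ^ 2 * |(fderiv ℝ H ξ).det|⁻¹ * ‖α ξ‖ ^ 2 * (1 + ‖H ξ‖ ^ 2) ^ r' := by
            field_simp
        _ ≤ c ^ 2 * J * (C ^ 2 * (1 + ‖ξ‖ ^ 2) ^ m) * (K ^ r' * (1 + ‖ξ‖ ^ 2) ^ r') := by
            gcongr
            exact hJle ξ hξ
        _ = _ := by ring)
  exact ⟨Φ, fun v => (ae_weightMeasure_iff r' _).1 (hΦ v)⟩

theorem isFourierIntegralOperator_conjFourier {S : M k → M k → ℝ} {α : M k → ℂ} {r r' : ℝ}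
    (hS : ∀ y ξ', ξ' ≠ 0 → S y ξ' = inner ℝ y (H ξ'))
    {Φ : DualSobolev (M k) r →L[ℂ] DualSobolev (M k) r'}
    (hΦ : ∀ v, ∀ᵐ ξ, Φ v ξ = dualFactor H H' α ξ * v (H' ξ)) :
    IsFourierIntegralOperator S α (conjFourier Φ) := by
  intro v φ
  set f := fourierIso (M k) r v with hf
  set χ := fourierSchwartzInv (M k) φ with hχ
  have hc : fourierConst (M k) ≠ 0 := fourier_const_ne_zero (M k)
  have hint : Integrable fun ξ => χ ξ * (dualFactor H H' α ξ * f (H' ξ)) := by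
    have h1 := integrable_mul_of_memLp_weight (Lp.memLp (Φ f))
      (χ.memLp 2 (weightMeasure (M k) (-r')))
    refine h1.congr ?_
    filter_upwards [hΦ f] with ξ hξ
    rw [hξ, mul_comm]
  have hpt : ∀ᵐ ξ : M k, |(fderiv ℝ H ξ).det| •
      (χ (H ξ) * (dualFactor H H' α (H ξ) * f (H' (H ξ)))) =
      (∫ y : M k, Complex.exp (Complex.I * S y ξ) * φ y) * α ξ * f ξ := by
    filter_upwards [ae_ne_zero volume] with ξ hξ
    rw [hH.left_inv ξ hξ, mul_left_comm, abs_det_smul_dualFactor hH α hξ, hχ,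
      fourierSchwartzInv_apply]
    simp_rw [hS _ ξ hξ]
    field_simp
  constructor
  · exact (hH.integrable_iff.1 hint).congr hpt
  · rw [Sobolev.dist_apply, fourierIso_conjFourier, ← integral_congr_ae hpt,
      ← hH.integral_comp fun ξ => χ ξ * (dualFactor H H' α ξ * f (H' ξ))]
    refine integral_congr_ae ?_
    filter_upwards [hΦ f] with ξ hξ
    rw [hξ]

end FourierIntegral

section Trace

variable {h : X k → X k → X k} (hh : IsHomogeneousDiffeo (shear h) (shearInv h))
include hh

theorem integral_comp_fibre {p' : X k} (hp' : p' ≠ 0) (f : X k → ℂ) :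
    ∫ τ, f τ = ∫ η, |jacobian h p' η| • f (fibreInverse h p' η) := by
  have hne : ∀ η : X k, (p', η) ≠ 0 := fun η h0 => hp' (congrArg Prod.fst h0)
  have hinj : Set.InjOn (fibreInverse h p') Set.univ := by
    intro η _ η' _ he
    have h1 := congrArg Prod.snd (hh.right_inv _ (hne η))
    have h2 := congrArg Prod.snd (hh.right_inv _ (hne η'))
    simp only [shear, shearInv] at h1 h2
    rw [← h1, ← h2, he]
  have himg : fibreInverse h p' '' Set.univ = Set.univ := by
    refine Set.eq_univ_of_forall fun τ => ⟨h p' τ, trivial, ?_⟩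
    exact congrArg Prod.snd (hh.left_inv _ (hne τ))
  have h3 := integral_image_eq_integral_abs_det_fderiv_smul volume MeasurableSet.univ
    (f := fibreInverse h p') (f' := fun η => fderiv ℝ (fibreInverse h p') η)
    (fun η _ => (hasFDerivAt_fibreInverse hh
      (hne η)).differentiableAt.hasFDerivAt.hasFDerivWithinAt) hinj f
  rw [himg, Measure.restrict_univ] at h3
  exact h3

/-- The substitution `τ' = h⁻¹(p', η)` for each fixed `p' ≠ 0`. -/
theorem integral_amplitude_eq_integral_traceKernel [NullSingletonClass (volume : Measure (X k))]
    {α : M k → ℂ} {f g : X k → ℂ}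
    (h1 : Integrable fun ξ : M k => g (h ξ.fst ξ.snd) * (α ξ * f ξ.fst))
    (h2 : Integrable fun ξ : M k => g ξ.fst * (traceKernel h α ξ.fst ξ.snd * f ξ.snd)) :
    ∫ ξ : M k, g (h ξ.fst ξ.snd) * (α ξ * f ξ.fst) =
      ∫ ξ : M k, g ξ.fst * (traceKernel h α ξ.fst ξ.snd * f ξ.snd) := by
  rw [integral_M h1, integral_M_symm h2]
  refine integral_congr_ae ?_
  filter_upwards [ae_ne_zero volume] with p' hp'
  simp only [pt_fst, pt_snd]
  rw [integral_comp_fibre hh hp']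
  refine integral_congr_ae (Filter.Eventually.of_forall fun η => ?_)
  have hη : h p' (fibreInverse h p' η) = η :=
    congrArg Prod.snd (hh.right_inv (p', η) fun h0 => hp' (congrArg Prod.fst h0))
  simp only [hη, traceKernel, Complex.real_smul]
  ring

end Trace

/-! ### The trace as an integral operator -/

/-- Over the fixed point there is a non-zero covector, so that `k ≥ 1`. -/
theorem ConditionA.nontrivial {Ω : Set (M k)} {g : M k × M k → M k × M k}
    (hA : ConditionA Ω g) : Nontrivial (X k) := by
  have h : ((0, 0) : X k × X k) ∈ ({(0, 0)} : Set (X k × X k)) := rfl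
  rw [← hA.projection] at h
  obtain ⟨-, -, ξ, ξ', hξ', -⟩ := h
  by_contra hcon
  rw [not_nontrivial_iff_subsingleton] at hcon
  exact (pt_ne_zero (p := ξ'.fst) (τ := ξ'.snd)).1 hξ' (Subsingleton.elim _ _)

theorem memLp_schwartz_weight (φ : 𝓢(X k, ℂ)) (r : ℝ) : MemLp φ 2 (weightMeasure (X k) r) :=
  φ.memLp 2 (weightMeasure (X k) r)

theorem nullSingletonClass_volume (E : Type*) [NormedAddCommGroup E] [InnerProductSpace ℝ E]
    [FiniteDimensional ℝ E] [MeasurableSpace E] [BorelSpace E] [Nontrivial E] :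
    NullSingletonClass (volume : Measure E) := inferInstance

theorem dualOperator_apply {E : Type*} [NormedAddCommGroup E] [InnerProductSpace ℝ E]
    [FiniteDimensional ℝ E] [MeasurableSpace E] [BorelSpace E] {s σ : ℝ}
    (A : Sobolev E s →L[ℂ] Sobolev E σ) (f : DualSobolev E s) :
    dualOperator A f = fourierIso E σ (A ((fourierIso E s).symm f)) := rfl

theorem dualOperator_conjFourier_comp {E E' : Type*}
    [NormedAddCommGroup E] [InnerProductSpace ℝ E] [FiniteDimensional ℝ E]
    [MeasurableSpace E] [BorelSpace E]
    [NormedAddCommGroup E'] [InnerProductSpace ℝ E'] [FiniteDimensional ℝ E']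
    [MeasurableSpace E'] [BorelSpace E'] {s r r' σ : ℝ}
    (C : DualSobolev E s →L[ℂ] DualSobolev E' r) (Φ : DualSobolev E' r →L[ℂ] DualSobolev E' r')
    (B : DualSobolev E' r' →L[ℂ] DualSobolev E σ) :
    dualOperator (conjFourier B ∘L conjFourier Φ ∘L conjFourier C) = B ∘L Φ ∘L C := by
  refine ContinuousLinearMap.ext fun f => ?_
  rw [dualOperator_apply, ContinuousLinearMap.comp_apply, ContinuousLinearMap.comp_apply,
    fourierIso_conjFourier, fourierIso_conjFourier, fourierIso_conjFourier,
    LinearIsometryEquiv.apply_symm_apply, ContinuousLinearMap.comp_apply,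
    ContinuousLinearMap.comp_apply]

/-- The composition of the three factors, written in dual coordinates, is the integral operator with
the kernel `traceKernel h α`: its pairing with a test function `φ(p)` becomes
`∫ φ(h(p', τ')) α(p', τ') f(p') dp' dτ'`. -/
theorem eq_kernelOperator_of_factors {H H' : M k → M k} {h : X k → X k → X k}
    [NullSingletonClass (volume : Measure (M k))] [NullSingletonClass (volume : Measure (X k))]
    (hH : IsHomogeneousDiffeo H H') (hh : IsHomogeneousDiffeo (shear h) (shearInv h))
    (hHh : ∀ ξ, ξ ≠ 0 → (H ξ).fst = h ξ.fst ξ.snd) {α : M k → ℂ}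
    {s r r' σ : ℝ} (hr' : k / 2 < r')
    {C : DualSobolev (X k) s →L[ℂ] DualSobolev (M k) r}
    (hC : ∀ f, ∀ᵐ ξ : M k, C f ξ = fourierConst (X k) * f ξ.fst)
    {Φ : DualSobolev (M k) r →L[ℂ] DualSobolev (M k) r'}
    (hΦ : ∀ v, ∀ᵐ ξ, Φ v ξ = dualFactor H H' α ξ * v (H' ξ))
    {B : DualSobolev (M k) r' →L[ℂ] DualSobolev (X k) σ}
    (hB : ∀ w, ∀ᵐ p : X k, B w p = ∫ τ, w (pt p τ))
    {W : DualSobolev (X k) s →L[ℂ] DualSobolev (M k) r'}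
    (hW : ∀ f, ∀ᵐ ξ : M k, W f ξ = traceKernel h α ξ.fst ξ.snd * f ξ.snd) :
    (fourierConst (X k) • B) ∘L Φ ∘L C = B ∘L W := by
  ext1 f
  apply toDist_injective
  ext φ
  have hφ : Measurable φ := φ.continuous.measurable
  have hφL := memLp_schwartz_weight φ (k / 2 - r')
  obtain ⟨hi1, he1⟩ := integral_mul_fibreIntegral hr' (Φ (C f)) hφ hφL
  obtain ⟨hi2, he2⟩ := integral_mul_fibreIntegral hr' (W f) hφ hφL
  have hc0 : fourierConst (X k) ≠ 0 := fourier_const_ne_zero (X k)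
  have hl : toDist (X k) σ (((fourierConst (X k) • B) ∘L Φ ∘L C) f) φ =
      fourierConst (X k) * ∫ ξ : M k, φ ξ.fst * Φ (C f) ξ := by
    rw [← he1, ← integral_const_mul]
    have h1 : ((fourierConst (X k) • B) ∘L Φ ∘L C) f = fourierConst (X k) • B (Φ (C f)) := rfl
    rw [h1, map_smul]
    change fourierConst (X k) * toDist (X k) σ (B (Φ (C f))) φ = _
    rw [toDist_apply, ← integral_const_mul]
    refine integral_congr_ae ?_
    filter_upwards [hB (Φ (C f))] with p hp
    rw [hp]
  have hr : toDist (X k) σ ((B ∘L W) f) φ = ∫ ξ : M k, φ ξ.fst * W f ξ := by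
    rw [← he2, toDist_apply]
    refine integral_congr_ae ?_
    filter_upwards [hB (W f)] with p hp
    rw [ContinuousLinearMap.comp_apply, hp]
  rw [hl, hr]
  have hW' : (fun ξ : M k => φ ξ.fst * W f ξ) =ᵐ[volume]
      fun ξ => φ ξ.fst * (traceKernel h α ξ.fst ξ.snd * f ξ.snd) := by
    filter_upwards [hW f] with ξ hξ
    rw [hξ]
  have hΦ' : (fun ξ : M k => φ ξ.fst * Φ (C f) ξ) =ᵐ[volume]
      fun ξ => φ ξ.fst * (dualFactor H H' α ξ * C f (H' ξ)) := by
    filter_upwards [hΦ (C f)] with ξ hξ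
    rw [hξ]
  have hpt : ∀ᵐ ξ : M k, |(fderiv ℝ H ξ).det| •
      (φ (H ξ).fst * (dualFactor H H' α (H ξ) * C f (H' (H ξ)))) =
      (fourierConst (X k))⁻¹ * (φ (h ξ.fst ξ.snd) * (α ξ * f ξ.fst)) := by
    filter_upwards [ae_ne_zero volume, hC f] with ξ hξ hξC
    rw [hH.left_inv ξ hξ, mul_left_comm, abs_det_smul_dualFactor hH α hξ, hHh ξ hξ, hξC,
      ← fourierConst_X_sq]
    field_simp
  have hi3 := (hH.integrable_iff.1 (hi1.congr hΦ')).congr hpt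
  have hi4 : Integrable fun ξ : M k => φ (h ξ.fst ξ.snd) * (α ξ * f ξ.fst) := by
    refine (hi3.const_mul (fourierConst (X k))).congr (Filter.Eventually.of_forall fun ξ => ?_)
    simp only
    rw [← mul_assoc, mul_inv_cancel₀ hc0, one_mul]
  rw [integral_congr_ae hΦ', integral_congr_ae hW',
    hH.integral_comp fun ξ => φ ξ.fst * (dualFactor H H' α ξ * C f (H' ξ)),
    integral_congr_ae hpt, integral_const_mul, ← mul_assoc, mul_inv_cancel₀ hc0, one_mul]
  exact integral_amplitude_eq_integral_traceKernel hh hi4 (hi2.congr hW')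

/-- The trace exists, and in dual coordinates it is exactly the integral operator with the kernel
`traceKernel h α`. -/
theorem exists_trace {H H' : M k → M k} {h : X k → X k → X k}
    [NullSingletonClass (volume : Measure (M k))] [NullSingletonClass (volume : Measure (X k))]
    (hH : IsHomogeneousDiffeo H H') (hh : IsHomogeneousDiffeo (shear h) (shearInv h))
    (hHh : ∀ ξ, ξ ≠ 0 → (H ξ).fst = h ξ.fst ξ.snd)
    {S : M k → M k → ℝ} (hS : ∀ y ξ', ξ' ≠ 0 → S y ξ' = inner ℝ y (H ξ'))
    {α : M k → ℂ} (hα : ContDiffOn ℝ ∞ α {0}ᶜ) {m s c : ℝ} (hc : 0 < c)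
    (hαc : ∀ ξ, ξ ≠ 0 → ‖α ξ‖ ≤ c * (1 + ‖ξ‖ ^ 2) ^ (m / 2)) (hs : s < 0) (hsm : 0 < s - m - k) :
    ∃ T : Sobolev (X k) s →L[ℂ] Sobolev (X k) (s - m - k), IsTrace S α m s T ∧
      IsIntegralOperator (traceKernel h α) (dualOperator T) := by
  have hk : (0 : ℝ) ≤ k := Nat.cast_nonneg k
  obtain ⟨C, hC⟩ := exists_pullbackOperator (k := k) (s := s) rfl hs (fourierConst (X k))
  obtain ⟨Φ, hΦ⟩ := exists_dualFourierIntegralOperator hH hα (r := s - k / 2)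
    (r' := s - k / 2 - m) rfl (by linarith) hαc
  have hr' : (k : ℝ) / 2 < s - k / 2 - m := by linarith
  obtain ⟨B, hB⟩ := exists_fibreIntegralOperator (k := k) (r := s - k / 2 - m)
    (σ := s - m - k) (by ring) hr'
  obtain ⟨c', hc'⟩ := exists_traceKernel_bound hh (m := m) (by linarith) hc hαc
  obtain ⟨W, hW⟩ := exists_kernelMulOperator (r := s - k / 2 - m) (m := m) (by ring) hs
    (measurable_traceKernel hh hα) c' hc'
  have hB' : ∀ w, ∀ᵐ p : X k, (fourierConst (X k) • B) w p =
      fourierConst (X k) * ∫ τ, w (pt p τ) := by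
    intro w
    have h1 := (ae_weightMeasure_iff _ _).1 (Lp.coeFn_smul (fourierConst (X k)) (B w))
    filter_upwards [h1, hB w] with p h2 h3
    rw [_root_.smul_apply, h2, Pi.smul_apply, h3, smul_eq_mul]
  refine ⟨conjFourier (fourierConst (X k) • B) ∘L conjFourier Φ ∘L conjFourier C,
    ⟨_, _, _, isCoboundaryOperator_conjFourier hC,
      isFourierIntegralOperator_conjFourier hH hS hΦ, isBoundaryOperator_conjFourier hB', rfl⟩, ?_⟩
  have hdual : dualOperator (conjFourier (fourierConst (X k) • B) ∘L conjFourier Φ ∘L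
      conjFourier C) = B ∘L W := by
    rw [← eq_kernelOperator_of_factors hH hh hHh hr' hC hΦ hB hW, dualOperator_conjFourier_comp]
  rw [hdual]
  intro f
  filter_upwards [ae_pt_of_ae (hW f), hB (W f), ae_integrable_fibre hr' (W f)] with p h2 h3 h4
  refine ⟨h4.congr h2, ?_⟩
  rw [ContinuousLinearMap.comp_apply, h3]
  exact integral_congr_ae h2

theorem IsIntegralOperator.sub {E : Type*} [NormedAddCommGroup E] [InnerProductSpace ℝ E]
    [FiniteDimensional ℝ E] [MeasurableSpace E] [BorelSpace E] {s σ : ℝ} {K K' : E → E → ℂ}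
    {A A' : DualSobolev E s →L[ℂ] DualSobolev E σ} (hA : IsIntegralOperator K A)
    (hA' : IsIntegralOperator K' A') :
    IsIntegralOperator (fun p p' => K p p' - K' p p') (A - A') := by
  intro f
  have h1 := (ae_weightMeasure_iff _ _).1 (Lp.coeFn_sub (A f) (A' f))
  filter_upwards [hA f, hA' f, h1] with p h2 h3 h4
  simp_rw [sub_mul]
  refine ⟨h2.1.sub h3.1, ?_⟩
  rw [integral_sub h2.1 h3.1, ← h2.2, ← h3.2, _root_.sub_apply, h4, Pi.sub_apply]

theorem isCompactInPhysicalCoordinates_of_isCompactOperator {E : Type*} [NormedAddCommGroup E]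
    [InnerProductSpace ℝ E] [FiniteDimensional ℝ E] [MeasurableSpace E] [BorelSpace E] {s σ : ℝ}
    {R : DualSobolev E s →L[ℂ] DualSobolev E σ} (hR : IsCompactOperator R) :
    IsCompactInPhysicalCoordinates R :=
  (hR.comp_clm ((fourierIso E s).toContinuousLinearEquiv :
    Sobolev E s →L[ℂ] DualSobolev E s)).clm_comp
    ((fourierIso E σ).symm.toContinuousLinearEquiv : DualSobolev E σ →L[ℂ] Sobolev E σ)

end TraceFIO

theorem proposition3 (k : ℕ)
    -- the canonical transformation, near the fibre over the fixed point `x₀ = 0`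
    (Ω : Set (M k)) (hΩ : IsOpen Ω) (h0 : (0 : M k) ∈ Ω)
    (g : M k × M k → M k × M k) (hg : IsCanonicalTransformation Ω g)
    (h : X k → X k → X k) (hA : ConditionA Ω g) (hB : ConditionB g h)
    (S : M k → M k → ℝ) (hS : IsLinearGeneratingFunction Ω g S)
    -- the amplitude `a`, which coincides at infinity with the homogeneous `a₀`, and the density
    (m : ℝ) (a₀ a : M k → ℂ) (ha : IsSmoothedAmplitude m a₀ a)
    (μ : M k → ℝ) (hμ : IsHomogeneousDensity μ)
    (s : ℝ) (hs : s < 0) (hsm : 0 < s - m - k) :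
    -- the trace is well defined
    (∃! T : Sobolev (X k) s →L[ℂ] Sobolev (X k) (s - m - k),
      IsTrace S (densityAmplitude μ a) m s T) ∧
    -- the kernel `b⁰` is homogeneous of degree `m` and smooth outside the origin
    IsHomogeneous m (fun q : X k × X k => homogeneousKernel h μ a₀ q.1 q.2) ∧
    ContDiffOn ℝ ∞ (fun q : X k × X k => homogeneousKernel h μ a₀ q.1 q.2) {0}ᶜ ∧
    ∀ ψ ψ' : X k → ℝ, IsCutoff ψ → IsCutoff ψ' →
      -- the operator with the kernel `ψ b⁰ ψ'` is bounded
      ∃ A : DualSobolev (X k) s →L[ℂ] DualSobolev (X k) (s - m - k),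
        IsIntegralOperator (cutKernel ψ ψ' (homogeneousKernel h μ a₀)) A ∧
        -- the trace in dual coordinates is this operator, modulo compact operators
        (∀ T : Sobolev (X k) s →L[ℂ] Sobolev (X k) (s - m - k),
          IsTrace S (densityAmplitude μ a) m s T →
            IsCompactInPhysicalCoordinates (dualOperator T - A)) ∧
        -- the operator does not depend on the cut-off functions, modulo compact operators
        ∀ ψ₁ ψ₁' : X k → ℝ, IsCutoff ψ₁ → IsCutoff ψ₁' →
          ∀ A₁ : DualSobolev (X k) s →L[ℂ] DualSobolev (X k) (s - m - k),
            IsIntegralOperator (cutKernel ψ₁ ψ₁' (homogeneousKernel h μ a₀)) A₁ →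
              IsCompactInPhysicalCoordinates (A - A₁) := by
  have hk : (0 : ℝ) ≤ k := Nat.cast_nonneg k
  have hm : m ≤ 0 := by linarith
  have : Nontrivial (X k) := hA.nontrivial
  have : Nontrivial (M k) := by
    obtain ⟨x, hx⟩ := exists_ne (0 : X k)
    exact ⟨pt x 0, 0, pt_ne_zero.2 fun h0 => hx (congrArg Prod.fst h0)⟩
  have := nullSingletonClass_volume (X k)
  have := nullSingletonClass_volume (M k)
  have hH := isHomogeneousDiffeo_fibreMap hΩ h0 hg hA
  have hh := isHomogeneousDiffeo_shear h0 hg hB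
  have hHh : ∀ ξ : M k, ξ ≠ 0 → (fibreMap g ξ).fst = h ξ.fst ξ.snd := by
    intro ξ hξ
    obtain ⟨τ, hτ⟩ := hB.eq ξ.fst ξ.snd hξ
    rw [pt_eta] at hτ
    rw [fibreMap, hτ, pt_fst]
  have hα := contDiffOn_densityAmplitude hμ ha.smooth.contDiffOn
  have hα₀ := contDiffOn_densityAmplitude hμ ha.smooth_homogeneous
  obtain ⟨c, hc, hαc⟩ := exists_densityAmplitude_bound hμ hm ha
  obtain ⟨T, hT, hTint⟩ := exists_trace hH hh hHh
    (fun y ξ' hξ' => phase_eq_inner hA hS y hξ') hα hc hαc hs hsm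
  have hhom : IsHomogeneous m fun q : X k × X k => homogeneousKernel h μ a₀ q.1 q.2 :=
    isHomogeneous_traceKernel hh (isHomogeneous_densityAmplitude hμ ha.homogeneous)
  have hsmooth : ContDiffOn ℝ ∞ (fun q : X k × X k => homogeneousKernel h μ a₀ q.1 q.2) {0}ᶜ :=
    contDiffOn_traceKernel hh hα₀
  have hmeas : Measurable (Function.uncurry (homogeneousKernel h μ a₀)) :=
    measurable_traceKernel hh hα₀
  have hcompact : ∀ ψ ψ' : X k → ℝ, IsCutoff ψ → IsCutoff ψ' →
      ∀ A : DualSobolev (X k) s →L[ℂ] DualSobolev (X k) (s - m - k),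
        IsIntegralOperator (cutKernel ψ ψ' (homogeneousKernel h μ a₀)) A →
          IsCompactOperator (dualOperator T - A) := by
    intro ψ ψ' hψ hψ' A hAint
    obtain ⟨C₁, hC₁⟩ := exists_traceKernel_bound hh hm hc hαc
    obtain ⟨C₂, hC₂⟩ := exists_cutKernel_bound hψ hψ' hm hhom hsmooth.continuousOn
    obtain ⟨ρ, hρ⟩ := exists_traceKernel_eq_cutKernel h hψ hψ' μ ha
    refine isCompactOperator_of_truncated (C := C₁ + C₂) (K := fun p p' =>
      traceKernel h (densityAmplitude μ a) p p' -
        cutKernel ψ ψ' (homogeneousKernel h μ a₀) p p') rfl hs hsm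
      ((measurable_traceKernel hh hα).sub (measurable_cutKernel hψ hψ' hmeas)) (fun p p' => ?_)
      hρ (hTint.sub hAint)
    rw [add_mul]
    exact (norm_sub_le _ _).trans (add_le_add (hC₁ p p') (hC₂ p p'))
  refine ⟨⟨T, hT, fun T' hT' => hT'.unique hT⟩, hhom, hsmooth, fun ψ ψ' hψ hψ' => ?_⟩
  obtain ⟨C₂, hC₂⟩ := exists_cutKernel_bound hψ hψ' hm hhom hsmooth.continuousOn
  obtain ⟨A, hAint⟩ := exists_kernelOperator (m := m) rfl hs hsm
    (measurable_cutKernel hψ hψ' hmeas) C₂ hC₂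
  refine ⟨A, hAint, fun T' hT' => ?_, fun ψ₁ ψ₁' hψ₁ hψ₁' A₁ hA₁ => ?_⟩
  · rw [hT'.unique hT]
    exact isCompactInPhysicalCoordinates_of_isCompactOperator (hcompact ψ ψ' hψ hψ' A hAint)
  · have hcomp := (hcompact ψ₁ ψ₁' hψ₁ hψ₁' A₁ hA₁).sub (hcompact ψ ψ' hψ hψ' A hAint)
    refine isCompactInPhysicalCoordinates_of_isCompactOperator ?_
    have heq : A - A₁ = (dualOperator T - A₁) - (dualOperator T - A) := by abel
    rw [heq]
    exact hcomp
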